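/- **Setting.** Let $D\subset\mathbb{Q}$ be a finite nonempty domain and $\Gamma$ a finite set of relations of finite arity on $D$ (a constraint language). An operation $f:D^m\to D$ is a polymorphism of $\Gamma$ if every relation of $\Gamma$ is closed under applying $f$ coordinatewise to $m$ of its tuples. A semilattice operation is a binary idempotent, commutative, associative operation; the dual discriminator is the ternary operation $\nabla$ with $\nabla(a,a,b)=\nabla(a,b,a)=\nabla(b,a,a)=a$ and $\nabla(a,b,c)=a$ for pairwise distinct $a,b,c$. A polynomial system over $n$ variables *comes from* $\Gamma$ if it is $\mathcal{P}=\{f_1,\dots,f_m\}\cup\{\prod_{\rho\in D}(x_i-\rho): i\le n\}$, where each $f_j\in\mathbb{Q}[x_1,\dots,x_n]$ involves only the variables of a constraint $R_j(x_{i_1},\dots,x_{i_k})$ with $R_j\in\Gamma$ and vanishes at a point of $D^n$ exactly when that constraint holds there. Let $S\subseteq\mathbb{R}^n$ be the zero set of $\mathcal{P}$, $I(S)\subseteq\mathbb{R}[x_1,\dots,x_n]$ its vanishing ideal, and $\|p\|_\infty$ the largest absolute value of a coefficient of $p$. A Polynomial Calculus (PC) derivation of $r$ from $\mathcal{P}$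 is a sequence of polynomials ending in $r$, each of which is an element of $\mathcal{P}$, or a linear combination of two earlier ones, or a variable times an earlier one; its degree is the maximal degree, and its size the total length of the binary encodings, of its lines. An SoS proof of $r\ge 0$ of degree at most $k$ is an identity $r=\sum_i s_i^2+\sum_{p\in\mathcal{P}}h_p\,p$ over $\mathbb{R}$ with $\deg s_i^2\le k$ and $\deg(h_p p)\le k$. A Nullstellensatz (Nsatz) proof of $q=0$ of degree at most $k$ is an identity $q=\sum_{p\in\mathcal{P}} h_p\,p$ with $\deg(h_p p)\le k$; $\mathcal{P}$ is Nsatz $d$-complete with constant $K$ if every $q\in I(S)$ with $\deg q\le d$ has such a proof of degree at most $Kd$. **(1)** Suppose that $\Gamma$ is closed under a semilattice polymorphism or under the dual discriminator polymorphism, and let $\Delta\in\mathbb{N}$. Then there is a constant $A$, depending only on $D$, $\Gamma$ and $\Delta$, such that for every $n$, every system $\mathcal{P}$ over $n$ variables coming from $\Gamma$ whose polynomials $f_j$ have degree at most $\Delta$ and bit size at most $\beta$, and every $d\ge1$, with $T=(n+1)^d(\beta+1)$: * (the PC criterion applies) $I(S)$ has a Gröbner basis $\mathcal{G}\subset\mathbb{Q}[x_1,\dots,x_n]$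 in the graded lexicographic order such that every $g\in\mathcal{G}$ of degree at most $2d$ satisfies $\|g\|_\infty\le 2^{A T^A}$ and has a PC derivation from $\mathcal{P}$ of degree at most $Ad$ and size at most $A T^A$; * (conclusion of the criterion) whenever $r\in\mathbb{R}[x_1,\dots,x_n]$ is such that $r\ge0$ has an SoS proof from $\mathcal{P}$ of degree at most $2d$, then for every $\varepsilon>0$ there is an SoS proof of $r+\varepsilon\ge0$ from $\mathcal{P}$ of degree at most $Ad$ in which all coefficients of all $s_i$ and $h_p$ have absolute value at most $2^{A\,(T\,(1+|\log_2\varepsilon|)\,(1+\log_2(1+\|r\|_\infty)))^A}$. **(2)** (Separation from the Nsatz criterion.) Let $\mathrm{IND}_n$ be the system in the Boolean variables $x_0,\dots,x_n$ with equations $x_0=1$, $x_i(1-x_{i+1})=0$ for $0\le i<n$, $x_n=0$ and $x_i^2=x_i$. There is a finite constraint language over $\{0,1\}$, closed under a semilattice polymorphism and under the dual discriminator, from which all $\mathrm{IND}_n$ come. There is a constant $A$ such that for all $n$ and all $d\ge1$ the two properties listed in (1) hold for $\mathrm{IND}_n$ with $T=(n+2)^d$; but there is $\delta>0$ such that, for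 all $n,K,d$ with $Kd<\delta\log(n+1)$, the system $\mathrm{IND}_n$ is not Nsatz $d$-complete with constant $K$. -/

import Mathlib

noncomputable section

namespace PCSoS

open MvPolynomial

/-! ### Constraint languages over a finite rational domain -/

/-- A relation of some finite arity on the domain `D`. -/
structure DomRelation (D : Finset ℚ) where
  arity : ℕ
  tuples : Set (Fin arity → D)

/-- The operation `f : D^m → D` is a polymorphism of the relation `R`. -/
def IsPolymorphism {D : Finset ℚ} {m : ℕ} (f : (Fin m → D) → D) (R : DomRelation D) : Prop :=
  ∀ t : Fin m → Fin R.arity → D, (∀ j, t j ∈ R.tuples) →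
    (fun i => f fun j => t j i) ∈ R.tuples

/-- A semilattice operation: binary, idempotent, commutative and associative. -/
def IsSemilatticeOp {D : Finset ℚ} (f : (Fin 2 → D) → D) : Prop :=
  (∀ a, f ![a, a] = a) ∧ (∀ a b, f ![a, b] = f ![b, a]) ∧
    ∀ a b c, f ![f ![a, b], c] = f ![a, f ![b, c]]

/-- The dual discriminator: the majority operation with value `a` on pairwise distinct
`a, b, c`. -/
def IsDualDiscriminator {D : Finset ℚ} (f : (Fin 3 → D) → D) : Prop :=
  (∀ a b, f ![a, a, b] = a ∧ f ![a, b, a] = a ∧ f ![b, a, a] = a) ∧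
    ∀ a b c, a ≠ b → a ≠ c → b ≠ c → f ![a, b, c] = a

/-- The language `Γ` is closed under some semilattice operation. -/
def SemilatticeClosed {D : Finset ℚ} (Γ : Set (DomRelation D)) : Prop :=
  ∃ f : (Fin 2 → D) → D, IsSemilatticeOp f ∧ ∀ R ∈ Γ, IsPolymorphism f R

/-- The language `Γ` is closed under the dual discriminator. -/
def DualDiscriminatorClosed {D : Finset ℚ} (Γ : Set (DomRelation D)) : Prop :=
  ∃ f : (Fin 3 → D) → D, IsDualDiscriminator f ∧ ∀ R ∈ Γ, IsPolymorphism f R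

/-- A constraint `R(x_{i_1}, …, x_{i_k})` over the language `Γ` with variables among
`x_0, …, x_{n-1}`; variables may repeat in the scope. -/
structure Constraint {D : Finset ℚ} (Γ : Set (DomRelation D)) (n : ℕ) where
  rel : DomRelation D
  mem : rel ∈ Γ
  scope : Fin rel.arity → Fin n

/-- The polynomial `p` involves only variables in the scope of the constraint `c`, and for
assignments with values in `D` it vanishes exactly when `c` is satisfied. -/
def Represents {D : Finset ℚ} {Γ : Set (DomRelation D)} {n : ℕ}
    (p : MvPolynomial (Fin n) ℚ) (c : Constraint Γ n) : Prop :=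
  (∀ i ∈ p.vars, i ∈ Set.range c.scope) ∧
    ∀ a : Fin n → D, eval (fun i => (a i : ℚ)) p = 0 ↔ (fun k => a (c.scope k)) ∈ c.rel.tuples

/-! ### Polynomial systems over a finite domain -/

/-- The domain polynomial `∏_{ρ ∈ D} (x_i - ρ)`. -/
def domainPoly (D : Finset ℚ) {n : ℕ} (i : Fin n) : MvPolynomial (Fin n) ℚ :=
  ∏ ρ ∈ D, (X i - C ρ)

/-- The polynomial system over the finite domain `D` that consists of the polynomials `f j` and
the domain polynomials of all variables. -/
def domainSystem (D : Finset ℚ) {n : ℕ} {ι : Type} (f : ι → MvPolynomial (Fin n) ℚ) :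
    ι ⊕ Fin n → MvPolynomial (Fin n) ℚ :=
  Sum.elim f (domainPoly D)

/-- A rational polynomial regarded as a real one. -/
def toReal {n : ℕ} (p : MvPolynomial (Fin n) ℚ) : MvPolynomial (Fin n) ℝ :=
  map (algebraMap ℚ ℝ) p

/-- The set of common real zeros. -/
def variety {n : ℕ} {ι : Type} (P : ι → MvPolynomial (Fin n) ℚ) : Set (Fin n → ℝ) :=
  {x | ∀ j, eval x (toReal (P j)) = 0}

/-- The ideal of all real polynomials vanishing on the variety of `P`. -/
def idealOf {n : ℕ} {ι : Type} (P : ι → MvPolynomial (Fin n) ℚ) :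
    Ideal (MvPolynomial (Fin n) ℝ) :=
  vanishingIdeal ℝ (variety P)

/-- The largest absolute value of a coefficient. -/
def coeffNorm {n : ℕ} (p : MvPolynomial (Fin n) ℝ) : NNReal :=
  p.support.sup fun m => ‖p.coeff m‖₊

/-- The length of the binary encoding of a rational polynomial: a list of terms, each with its
exponent vector and its coefficient as a reduced fraction. -/
def bitSize {n : ℕ} (p : MvPolynomial (Fin n) ℚ) : ℕ :=
  1 + ∑ m ∈ p.support, (1 + (p.coeff m).num.natAbs.size + (p.coeff m).den.size
    + ∑ i, (1 + (m i).size))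

/-! ### Gröbner bases in the graded lexicographic order -/

/-- `G` is a Gröbner basis of `I` for the graded lexicographic order with `x_0 > x_1 > ⋯`:
it generates `I`, and the leading monomial of every nonzero element of `I` is divisible by the
leading monomial of a nonzero element of `G`. -/
def IsGroebnerBasis {n : ℕ} (G : Set (MvPolynomial (Fin n) ℝ))
    (I : Ideal (MvPolynomial (Fin n) ℝ)) : Prop :=
  Ideal.span G = I ∧ ∀ p ∈ I, p ≠ 0 → ∃ g ∈ G, g ≠ 0 ∧
    (MonomialOrder.degLex (σ := Fin n)).degree g ≤ (MonomialOrder.degLex (σ := Fin n)).degree p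

/-! ### Polynomial Calculus -/

/-- `r` is an axiom or follows by one rule from polynomials in the list `L`. The domain
polynomials are among the axioms `P`. -/
def IsPCStep {n : ℕ} {ι : Type} (P : ι → MvPolynomial (Fin n) ℚ)
    (L : List (MvPolynomial (Fin n) ℚ)) (r : MvPolynomial (Fin n) ℚ) : Prop :=
  (∃ j, r = P j) ∨ (∃ p ∈ L, ∃ q ∈ L, ∃ a b : ℚ, r = C a * p + C b * q) ∨
    ∃ p ∈ L, ∃ i, r = X i * p

/-- Polynomial Calculus derivations, written with the most recent line first. -/
inductive IsPCDerivation {n : ℕ} {ι : Type} (P : ι → MvPolynomial (Fin n) ℚ) :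
    List (MvPolynomial (Fin n) ℚ) → Prop
  | nil : IsPCDerivation P []
  | step {L : List (MvPolynomial (Fin n) ℚ)} {r : MvPolynomial (Fin n) ℚ} :
      IsPCDerivation P L → IsPCStep P L r → IsPCDerivation P (r :: L)

/-- `r = 0` has a Polynomial Calculus derivation from `P` of degree at most `deg` and of size
(total bit size of all lines) at most `size`. -/
def HasPCDerivation {n : ℕ} {ι : Type} (P : ι → MvPolynomial (Fin n) ℚ)
    (r : MvPolynomial (Fin n) ℚ) (deg size : ℕ) : Prop :=
  ∃ L, IsPCDerivation P (r :: L) ∧ (∀ q ∈ r :: L, q.totalDegree ≤ deg) ∧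
    ((r :: L).map bitSize).sum ≤ size

/-! ### Sum-of-squares and Nullstellensatz proofs -/

/-- A sum-of-squares proof of `r ≥ 0` from `P`: an identity
`r = ∑ (s i)^2 + ∑ (h j) * (P j)`. -/
structure SoSProof {n : ℕ} {ι : Type} [Fintype ι] (P : ι → MvPolynomial (Fin n) ℚ)
    (r : MvPolynomial (Fin n) ℝ) where
  t : ℕ
  s : Fin t → MvPolynomial (Fin n) ℝ
  h : ι → MvPolynomial (Fin n) ℝ
  identity : r = ∑ i, s i ^ 2 + ∑ j, h j * toReal (P j)

/-- The proof has degree at most `k`. -/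
def SoSProof.DegreeLE {n : ℕ} {ι : Type} [Fintype ι] {P : ι → MvPolynomial (Fin n) ℚ}
    {r : MvPolynomial (Fin n) ℝ} (π : SoSProof P r) (k : ℕ) : Prop :=
  (∀ i, (π.s i ^ 2).totalDegree ≤ k) ∧ ∀ j, (π.h j * toReal (P j)).totalDegree ≤ k

/-- All coefficients of all polynomials in the proof have absolute value at most `B`. -/
def SoSProof.CoeffLE {n : ℕ} {ι : Type} [Fintype ι] {P : ι → MvPolynomial (Fin n) ℚ}
    {r : MvPolynomial (Fin n) ℝ} (π : SoSProof P r) (B : ℝ) : Prop :=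
  (∀ i, (coeffNorm (π.s i) : ℝ) ≤ B) ∧ ∀ j, (coeffNorm (π.h j) : ℝ) ≤ B

/-- `P` is Nullstellensatz `d`-complete over its variety, with the constant `K` in the degree
bound: every polynomial of degree at most `d` that vanishes on the variety has a Nullstellensatz
proof of degree at most `K * d`. -/
def NsatzComplete {n : ℕ} {ι : Type} [Fintype ι] (P : ι → MvPolynomial (Fin n) ℚ)
    (K d : ℕ) : Prop :=
  ∀ p ∈ idealOf P, p.totalDegree ≤ d →
    ∃ h : ι → MvPolynomial (Fin n) ℝ, p = ∑ j, h j * toReal (P j) ∧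
      ∀ j, (h j * toReal (P j)).totalDegree ≤ K * d

/-! ### The Polynomial Calculus criterion

A bound `poly(x, y, …)` is written `A * (x * y * ⋯) ^ A` with factors at least `1`; `n ^ d` is
replaced by `(n + 1) ^ d`, which is polynomially equivalent for `n ≥ 2`. The number `β` bounds
the bit sizes of the input polynomials. -/

/-- The hypotheses of the criterion: there is a (`2d`-truncated) Gröbner basis of the vanishing
ideal with coefficients at most `2 ^ poly(n ^ d, β)` whose elements have Polynomial Calculus
derivations from `P` of degree at most `A * d` and size `poly(n ^ d, β)`. -/
def PCCriterionApplies {n : ℕ} {ι : Type} (P : ι → MvPolynomial (Fin n) ℚ)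
    (A β d : ℕ) : Prop :=
  ∃ G : Finset (MvPolynomial (Fin n) ℚ),
    IsGroebnerBasis (toReal '' (G : Set (MvPolynomial (Fin n) ℚ))) (idealOf P) ∧
      ∀ g ∈ G, g.totalDegree ≤ 2 * d →
        (coeffNorm (toReal g) : ℝ) ≤ 2 ^ (A * ((n + 1) ^ d * (β + 1)) ^ A) ∧
          HasPCDerivation P g (A * d) (A * ((n + 1) ^ d * (β + 1)) ^ A)

/-- The conclusion of the criterion: if `r ≥ 0` has a sum-of-squares proof of degree `2d`, then
for every `ε > 0` there is one of `r + ε ≥ 0` of degree at most `A * d` with coefficients at most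
`2 ^ poly(n ^ d, β, lg (1/ε), lg ‖r‖)`. -/
def HasApproxSoSProofs {n : ℕ} {ι : Type} [Fintype ι] (P : ι → MvPolynomial (Fin n) ℚ)
    (A β d : ℕ) : Prop :=
  ∀ r : MvPolynomial (Fin n) ℝ, (∃ π : SoSProof P r, π.DegreeLE (2 * d)) →
    ∀ ε : ℝ, 0 < ε →
      ∃ π : SoSProof P (r + C ε), π.DegreeLE (A * d) ∧
        π.CoeffLE ((2 : ℝ) ^ ((A : ℝ) * (((n : ℝ) + 1) ^ d * ((β : ℝ) + 1)
          * (1 + |Real.logb 2 ε|) * (1 + Real.logb 2 (1 + (coeffNorm r : ℝ)))) ^ A))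

/-! ### The induction principle -/

/-- The Boolean domain. -/
def boolDomain : Finset ℚ := {0, 1}

/-- The equations of the induction principle on `x_0, …, x_n`: `x_0 = 1`,
`x_i (1 - x_{i+1}) = 0` for `i < n`, and `x_n = 0`. -/
def inductionEq (n : ℕ) : Fin n ⊕ Fin 2 → MvPolynomial (Fin (n + 1)) ℚ :=
  Sum.elim (fun i => X i.castSucc * (1 - X i.succ)) ![1 - X 0, X (Fin.last n)]

/-- The induction principle as a polynomial system over the Boolean domain. -/
def inductionSystem (n : ℕ) : (Fin n ⊕ Fin 2) ⊕ Fin (n + 1) → MvPolynomial (Fin (n + 1)) ℚ :=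
  domainSystem boolDomain (inductionEq n)

end PCSoS

end

noncomputable section

namespace PCSoS

open MvPolynomial

/-! ### Monomials of bounded degree -/

/-! Let `S` be the set of solutions in `D ^ n`. The positive part rests on three facts: every
low-degree polynomial vanishing on `S` has a short Polynomial Calculus derivation of low degree; the
ideal of `S` has a Gröbner basis of integer polynomials with few bits; and a derivation of `g` turns
into a sum-of-squares proof of `-g ^ 2 ≥ 0`.

Derivability (`mem_level_of_language`). If the system is satisfiable, its constraints are closed
under a semilattice operation in each coordinate: the given one, or `∇(s i, ·, ·)` for a fixed
solution `s` when the dual discriminator `∇` is a polymorphism. A polynomial of degree at most `e`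
agrees on `D ^ n` with a combination of terms, that is, indicators of `x_i ≥ τ_i` for all `i` in a
set of at most `e` variables. Propagating the constraints under a term either refutes the term or
yields the least solution `y` above it, and then the term restricts on `S` to the indicator of the
upper set of `y`. Terms with the same `y` differ by a derivable polynomial, while indicators of
distinct principal upper sets of the poset `S` are linearly independent. Hence every linear relation
between terms on `S` already holds modulo derivable polynomials. An unsatisfiable system is reduced
to a maximal satisfiable subsystem and one violated constraint.

Size. Propagation stops after about `n * |D|` rounds. In each round only polynomials with small
integer coefficients are multiplied by monomials, and a basis of the span is chosen among such
products. Cramer's rule (`exists_integer_leftInverse`) bounds the coefficients of all linear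
combinations, so bit lengths do not accumulate over the rounds. The same rule, applied to the values
of standard monomials on `S`, bounds the reduced polynomials that form the Gröbner basis.

Sums of squares. `exists_negSq_constant` follows a derivation line by line. For a given `r`, the
squares of its proof are replaced by squares of interpolants of their values on `S`, whose
coefficients are controlled by the values of `r`. The remaining difference vanishes on `S`, so it is
a bounded combination of reduced polynomials `g`, and each multiple `a * g` is absorbed by `a g + ε
= ε (1 + a g / (2 ε)) ^ 2 + a ^ 2 / (4 ε) * (-g ^ 2)`.

Separation. The induction principle has no solution, so `1` lies in its ideal. The linear functional
`refuter` maps `1` to `1` and annihilates all low-degree multiples of the axioms. It is built by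
gluing two copies for chains of half the length, which allows one more degree per doubling and gives
a logarithmic lower bound. -/

/-- The exponent vectors of total degree at most `k`. -/
def monomials (n k : ℕ) : Finset (Fin n →₀ ℕ) :=
  Finset.univ.image fun g : Fin k → Option (Fin n) =>
    ∑ j, (g j).elim 0 fun i => Finsupp.single i 1

theorem card_monomials_le (n k : ℕ) : (monomials n k).card ≤ (n + 1) ^ k := by
  refine Finset.card_image_le.trans ?_
  simp

/-- A monomial of degree at most `k` fills `k` slots, each with a variable or with nothing; this is
the source of the count `(n + 1) ^ k`. -/
theorem exists_sum_single_eq {n : ℕ} (k : ℕ) (m : Fin n →₀ ℕ) (hm : m.degree ≤ k) :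
    ∃ g : Fin k → Option (Fin n),
      ∑ j, (g j).elim 0 (fun i => (Finsupp.single i 1 : Fin n →₀ ℕ)) = m := by
  induction k generalizing m with
  | zero =>
    refine ⟨fun _ => none, ?_⟩
    have : m = 0 := (Finsupp.degree_eq_zero_iff m).1 (by omega)
    simp [this]
  | succ k ih =>
    by_cases h0 : m = 0
    · exact ⟨fun _ => none, by simp [h0]⟩
    · obtain ⟨i, hi⟩ := Finsupp.ne_iff.1 h0
      have hle : Finsupp.single i 1 ≤ m := by
        rw [Finsupp.single_le_iff]
        simp at hi
        omega
      obtain ⟨m', rfl⟩ := exists_add_of_le hle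
      have : m'.degree ≤ k := by
        rw [map_add] at hm
        simp at hm
        omega
      obtain ⟨g, hg⟩ := ih m' this
      exact ⟨Fin.cons (some i) g, by simp [Fin.sum_univ_succ, hg]⟩

theorem mem_monomials {n k : ℕ} {m : Fin n →₀ ℕ} : m ∈ monomials n k ↔ m.degree ≤ k := by
  constructor
  · intro h
    obtain ⟨g, -, rfl⟩ := Finset.mem_image.1 h
    rw [map_sum]
    calc ∑ j, Finsupp.degree ((g j).elim 0 fun i => (Finsupp.single i 1 : Fin n →₀ ℕ))
        ≤ ∑ _j : Fin k, 1 := Finset.sum_le_sum fun j _ => by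
          cases g j <;> simp
      _ = k := by simp
  · intro h
    obtain ⟨g, hg⟩ := exists_sum_single_eq k m h
    exact Finset.mem_image.2 ⟨g, Finset.mem_univ _, hg⟩

theorem degree_le_totalDegree {n : ℕ} {R : Type*} [CommSemiring R] {p : MvPolynomial (Fin n) R}
    {m : Fin n →₀ ℕ} (hm : m ∈ p.support) : m.degree ≤ p.totalDegree := by
  have := le_totalDegree hm
  exact this

theorem totalDegree_le_of_support {n k : ℕ} {R : Type*} [CommSemiring R]
    {p : MvPolynomial (Fin n) R} (h : ∀ m ∈ p.support, m.degree ≤ k) : p.totalDegree ≤ k := by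
  refine Finset.sup_le fun m hm => ?_
  have := h m hm
  exact this

theorem support_subset_monomials {n k : ℕ} {R : Type*} [CommSemiring R]
    {p : MvPolynomial (Fin n) R} (h : p.totalDegree ≤ k) : p.support ⊆ monomials n k :=
  fun _ hm => mem_monomials.2 ((degree_le_totalDegree hm).trans h)

theorem totalDegree_monomial_mul_le {n : ℕ} {R : Type*} [CommSemiring R]
    (m : Fin n →₀ ℕ) (a : R) (p : MvPolynomial (Fin n) R) :
    (monomial m a * p).totalDegree ≤ m.degree + p.totalDegree := by
  refine (totalDegree_mul _ _).trans (Nat.add_le_add_right ?_ _)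
  exact (totalDegree_monomial_le m a).trans le_rfl

/-! ### The sum of the absolute values of the coefficients -/

/-- The sum of the absolute values of the coefficients. -/
def l1 {n : ℕ} (p : MvPolynomial (Fin n) ℝ) : ℝ :=
  ∑ m ∈ p.support, |p.coeff m|

section l1

variable {n : ℕ}

theorem l1_eq_sum {p : MvPolynomial (Fin n) ℝ} {s : Finset (Fin n →₀ ℕ)} (h : p.support ⊆ s) :
    l1 p = ∑ m ∈ s, |p.coeff m| :=
  Finset.sum_subset h fun m _ hm => by simp [notMem_support_iff.1 hm]

theorem l1_nonneg (p : MvPolynomial (Fin n) ℝ) : 0 ≤ l1 p :=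
  Finset.sum_nonneg fun _ _ => abs_nonneg _

@[simp] theorem l1_zero : l1 (0 : MvPolynomial (Fin n) ℝ) = 0 := by simp [l1]

theorem l1_add_le (p q : MvPolynomial (Fin n) ℝ) : l1 (p + q) ≤ l1 p + l1 q := by
  classical
  rw [l1_eq_sum (p := p + q) (s := p.support ∪ q.support) support_add,
    l1_eq_sum (p := p) (Finset.subset_union_left (s₂ := q.support)),
    l1_eq_sum (p := q) (Finset.subset_union_right (s₁ := p.support)), ← Finset.sum_add_distrib]
  exact Finset.sum_le_sum fun m _ => by rw [coeff_add]; exact abs_add_le _ _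

@[simp] theorem l1_neg (p : MvPolynomial (Fin n) ℝ) : l1 (-p) = l1 p := by
  simp [l1]

theorem l1_sub_le (p q : MvPolynomial (Fin n) ℝ) : l1 (p - q) ≤ l1 p + l1 q := by
  rw [sub_eq_add_neg, ← l1_neg q]
  exact l1_add_le _ _

theorem l1_sum_le {κ : Type*} (s : Finset κ) (p : κ → MvPolynomial (Fin n) ℝ) :
    l1 (∑ i ∈ s, p i) ≤ ∑ i ∈ s, l1 (p i) := by
  classical
  induction s using Finset.induction_on with
  | empty => simp
  | insert a s ha ih =>
    rw [Finset.sum_insert ha, Finset.sum_insert ha]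
    exact (l1_add_le _ _).trans (by gcongr)

@[simp] theorem l1_monomial (m : Fin n →₀ ℕ) (a : ℝ) : l1 (monomial m a) = |a| := by
  rw [l1_eq_sum (s := {m}) support_monomial_subset]
  simp

@[simp] theorem l1_C (a : ℝ) : l1 (C a : MvPolynomial (Fin n) ℝ) = |a| := l1_monomial 0 a

@[simp] theorem l1_one : l1 (1 : MvPolynomial (Fin n) ℝ) = 1 := by
  rw [← C_1, l1_C, abs_one]

@[simp] theorem l1_X (i : Fin n) : l1 (X i : MvPolynomial (Fin n) ℝ) = 1 := by
  rw [X, l1_monomial, abs_one]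

/-- Submultiplicativity is the reason to work with `l1` instead of `coeffNorm`: products need no
factor for the number of monomials. -/
theorem l1_mul_le (p q : MvPolynomial (Fin n) ℝ) : l1 (p * q) ≤ l1 p * l1 q := by
  conv_lhs => rw [p.as_sum, q.as_sum, Finset.sum_mul_sum]
  refine (l1_sum_le _ _).trans ?_
  rw [l1, l1, Finset.sum_mul_sum]
  refine Finset.sum_le_sum fun m _ => (l1_sum_le _ _).trans (Finset.sum_le_sum fun m' _ => ?_)
  rw [monomial_mul, l1_monomial, abs_mul]

theorem l1_pow_le (p : MvPolynomial (Fin n) ℝ) (e : ℕ) : l1 (p ^ e) ≤ l1 p ^ e := by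
  induction e with
  | zero => simp
  | succ e ih =>
    rw [pow_succ, pow_succ]
    exact (l1_mul_le _ _).trans (mul_le_mul_of_nonneg_right ih (l1_nonneg _))

theorem l1_prod_le {κ : Type*} (s : Finset κ) (p : κ → MvPolynomial (Fin n) ℝ) :
    l1 (∏ i ∈ s, p i) ≤ ∏ i ∈ s, l1 (p i) := by
  classical
  induction s using Finset.induction_on with
  | empty => simp
  | insert a s ha ih =>
    rw [Finset.prod_insert ha, Finset.prod_insert ha]
    exact (l1_mul_le _ _).trans (mul_le_mul_of_nonneg_left ih (l1_nonneg _))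

@[simp] theorem l1_C_mul (a : ℝ) (p : MvPolynomial (Fin n) ℝ) : l1 (C a * p) = |a| * l1 p := by
  have h : (C a * p).support ⊆ p.support := by
    intro m hm
    rw [mem_support_iff, coeff_C_mul] at hm
    exact mem_support_iff.2 (right_ne_zero_of_mul hm)
  rw [l1_eq_sum h, l1, Finset.mul_sum]
  exact Finset.sum_congr rfl fun m _ => by rw [coeff_C_mul, abs_mul]

theorem l1_X_mul_le (i : Fin n) (p : MvPolynomial (Fin n) ℝ) : l1 (X i * p) ≤ l1 p := by
  simpa using l1_mul_le (X i) p

theorem l1_monomial_one_mul_le (m : Fin n →₀ ℕ) (p : MvPolynomial (Fin n) ℝ) :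
    l1 (monomial m 1 * p) ≤ l1 p := by
  simpa using l1_mul_le (monomial m 1) p

theorem abs_coeff_le_l1 (p : MvPolynomial (Fin n) ℝ) (m : Fin n →₀ ℕ) : |p.coeff m| ≤ l1 p := by
  by_cases hm : m ∈ p.support
  · exact Finset.single_le_sum (f := fun m => |p.coeff m|) (fun _ _ => abs_nonneg _) hm
  · rw [notMem_support_iff.1 hm, abs_zero]
    exact l1_nonneg _

theorem coeffNorm_le_l1 (p : MvPolynomial (Fin n) ℝ) : (coeffNorm p : ℝ) ≤ l1 p := by
  have : coeffNorm p ≤ ⟨l1 p, l1_nonneg p⟩ :=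
    Finset.sup_le fun m _ => abs_coeff_le_l1 p m
  exact NNReal.coe_le_coe.2 this

theorem l1_le_card_mul_coeffNorm {p : MvPolynomial (Fin n) ℝ} {k : ℕ} (h : p.totalDegree ≤ k) :
    l1 p ≤ ((n + 1) ^ k : ℕ) * coeffNorm p := by
  have h1 : l1 p ≤ p.support.card • (coeffNorm p : ℝ) := by
    refine Finset.sum_le_card_nsmul _ _ _ fun m hm => ?_
    have : ‖p.coeff m‖₊ ≤ coeffNorm p := Finset.le_sup (f := fun m => ‖p.coeff m‖₊) hm
    simpa using NNReal.coe_le_coe.2 this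
  refine h1.trans ?_
  rw [nsmul_eq_mul]
  gcongr
  exact (Finset.card_le_card (support_subset_monomials h)).trans (card_monomials_le n k)

theorem abs_eval_le {p : MvPolynomial (Fin n) ℝ} {k : ℕ} (h : p.totalDegree ≤ k) {M : ℝ}
    (hM : 1 ≤ M) (x : Fin n → ℝ) (hx : ∀ i, |x i| ≤ M) : |eval x p| ≤ l1 p * M ^ k := by
  rw [eval_eq, l1, Finset.sum_mul]
  refine (Finset.abs_sum_le_sum_abs _ _).trans (Finset.sum_le_sum fun m hm => ?_)
  rw [abs_mul]
  refine mul_le_mul_of_nonneg_left ?_ (abs_nonneg _)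
  rw [Finset.abs_prod]
  calc ∏ i ∈ m.support, |x i ^ m i| ≤ ∏ i ∈ m.support, M ^ m i :=
        Finset.prod_le_prod (fun _ _ => abs_nonneg _) fun i _ => by
          rw [abs_pow]
          exact pow_le_pow_left₀ (abs_nonneg _) (hx i) _
    _ = M ^ m.degree := by
        rw [Finset.prod_pow_eq_pow_sum]
        rfl
    _ ≤ M ^ k := pow_le_pow_right₀ hM ((degree_le_totalDegree hm).trans h)

end l1

/-! ### Passing from rational to real polynomials -/

section toReal

variable {n : ℕ}

@[simp] theorem toReal_add (p q : MvPolynomial (Fin n) ℚ) :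
    toReal (p + q) = toReal p + toReal q := map_add _ _ _
@[simp] theorem toReal_sub (p q : MvPolynomial (Fin n) ℚ) :
    toReal (p - q) = toReal p - toReal q := map_sub _ _ _
@[simp] theorem toReal_mul (p q : MvPolynomial (Fin n) ℚ) :
    toReal (p * q) = toReal p * toReal q := map_mul _ _ _
@[simp] theorem toReal_one : toReal (1 : MvPolynomial (Fin n) ℚ) = 1 := map_one _
@[simp] theorem toReal_zero : toReal (0 : MvPolynomial (Fin n) ℚ) = 0 := map_zero _
@[simp] theorem toReal_C (a : ℚ) : toReal (C a : MvPolynomial (Fin n) ℚ) = C (a : ℝ) := by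
  simp [toReal]
@[simp] theorem toReal_X (i : Fin n) : toReal (X i : MvPolynomial (Fin n) ℚ) = X i := by
  simp [toReal]
@[simp] theorem toReal_monomial (m : Fin n →₀ ℕ) (a : ℚ) :
    toReal (monomial m a : MvPolynomial (Fin n) ℚ) = monomial m (a : ℝ) := by
  simp [toReal]
theorem toReal_sum {κ : Type*} (s : Finset κ) (p : κ → MvPolynomial (Fin n) ℚ) :
    toReal (∑ i ∈ s, p i) = ∑ i ∈ s, toReal (p i) := map_sum _ _ _
theorem toReal_prod {κ : Type*} (s : Finset κ) (p : κ → MvPolynomial (Fin n) ℚ) :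
    toReal (∏ i ∈ s, p i) = ∏ i ∈ s, toReal (p i) := map_prod _ _ _

@[simp] theorem coeff_toReal (p : MvPolynomial (Fin n) ℚ) (m : Fin n →₀ ℕ) :
    (toReal p).coeff m = ((p.coeff m : ℚ) : ℝ) := by
  simp [toReal, coeff_map]

theorem toReal_injective : Function.Injective (toReal (n := n)) :=
  map_injective _ (algebraMap ℚ ℝ).injective

@[simp] theorem support_toReal (p : MvPolynomial (Fin n) ℚ) : (toReal p).support = p.support :=
  support_map_of_injective _ (algebraMap ℚ ℝ).injective

@[simp] theorem totalDegree_toReal (p : MvPolynomial (Fin n) ℚ) :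
    (toReal p).totalDegree = p.totalDegree := by
  rw [totalDegree, totalDegree, support_toReal]

theorem eval_toReal (p : MvPolynomial (Fin n) ℚ) (x : Fin n → ℚ) :
    eval (fun i => (x i : ℝ)) (toReal p) = (eval x p : ℚ) := by
  rw [toReal, eval_map]
  exact (eval₂_comp (algebraMap ℚ ℝ) x p).symm

end toReal

/-! ### Polynomials with integer coefficients -/

section Integral

variable {n : ℕ}

/-- The rational polynomials with integer coefficients. -/
def integralPolys (n : ℕ) : Subring (MvPolynomial (Fin n) ℚ) :=
  (map (Int.castRingHom ℚ)).range

theorem mem_integralPolys {p : MvPolynomial (Fin n) ℚ} :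
    p ∈ integralPolys n ↔ ∀ m, ∃ z : ℤ, p.coeff m = z := by
  constructor
  · rintro ⟨q, rfl⟩ m
    exact ⟨q.coeff m, by simp [coeff_map]⟩
  · intro h
    choose z hz using h
    refine ⟨∑ m ∈ p.support, monomial m (z m), ?_⟩
    conv_rhs => rw [p.as_sum]
    rw [map_sum]
    exact Finset.sum_congr rfl fun m _ => by simp [map_monomial, hz]

theorem intCast_mem_integralPolys (z : ℤ) : C (z : ℚ) ∈ integralPolys n := by
  refine ⟨C z, by simp⟩

theorem monomial_mem_integralPolys (m : Fin n →₀ ℕ) (z : ℤ) :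
    monomial m (z : ℚ) ∈ integralPolys n :=
  ⟨monomial m z, by simp⟩

theorem monomial_one_mem_integralPolys (m : Fin n →₀ ℕ) :
    monomial m (1 : ℚ) ∈ integralPolys n :=
  ⟨monomial m 1, by simp⟩

/-- The polynomials of degree at most `k` with integer coefficients whose absolute values sum up
to at most `2 ^ b`. -/
def boundedIntegral (n k b : ℕ) : Set (MvPolynomial (Fin n) ℚ) :=
  {p | p ∈ integralPolys n ∧ l1 (toReal p) ≤ 2 ^ b ∧ p.totalDegree ≤ k}

theorem bitSize_le {k b : ℕ} {p : MvPolynomial (Fin n) ℚ} (hp : p ∈ boundedIntegral n k b) :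
    bitSize p ≤ 1 + (n + 1) ^ k * (b + 3 + n * (1 + k)) := by
  obtain ⟨hz, hl, hk⟩ := hp
  rw [mem_integralPolys] at hz
  rw [bitSize]
  gcongr
  refine (Finset.sum_le_card_nsmul _ _ (b + 3 + n * (1 + k)) fun m hm => ?_).trans ?_
  · obtain ⟨z, hz⟩ := hz m
    have h1 : |(z : ℝ)| ≤ 2 ^ b := by
      have := (abs_coeff_le_l1 (toReal p) m).trans hl
      rwa [coeff_toReal, hz, Rat.cast_intCast] at this
    have h2 : z.natAbs ≤ 2 ^ b := by
      have : ((z.natAbs : ℕ) : ℝ) ≤ ((2 ^ b : ℕ) : ℝ) := by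
        rw [Nat.cast_natAbs]; push_cast; exact h1
      exact_mod_cast this
    have h3 : z.natAbs.size ≤ b + 1 := by
      rw [Nat.size_le]
      exact h2.trans_lt (Nat.pow_lt_pow_right (by norm_num) (by omega))
    have h4 : ∑ i, (1 + (m i).size) ≤ n * (1 + k) := by
      refine (Finset.sum_le_card_nsmul _ _ (1 + k) fun i _ => ?_).trans (by simp)
      have : m i ≤ k := (Finsupp.le_degree i m).trans ((degree_le_totalDegree hm).trans hk)
      have : (m i).size ≤ m i := Nat.size_le.2 Nat.lt_two_pow_self
      omega
    rw [hz]
    simp only [Rat.num_intCast, Rat.den_intCast, Nat.size_one]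
    omega
  · rw [smul_eq_mul]
    gcongr
    exact (Finset.card_le_card (support_subset_monomials hk)).trans (card_monomials_le n k)

theorem l1_toReal_le_two_pow_bitSize (p : MvPolynomial (Fin n) ℚ) :
    l1 (toReal p) ≤ 2 ^ bitSize p := by
  rw [l1, support_toReal, bitSize]
  have key : ∀ (s : Finset (Fin n →₀ ℕ)),
      ∑ m ∈ s, |(toReal p).coeff m| ≤ 2 ^ (∑ m ∈ s, (1 + (p.coeff m).num.natAbs.size
        + (p.coeff m).den.size + ∑ i, (1 + (m i).size))) := by
    intro s
    classical
    induction s using Finset.induction_on with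
    | empty => simp
    | insert a s ha ih =>
      rw [Finset.sum_insert ha, Finset.sum_insert ha, pow_add]
      set e := 1 + (p.coeff a).num.natAbs.size + (p.coeff a).den.size + ∑ i, (1 + (a i).size)
      set f := ∑ m ∈ s, (1 + (p.coeff m).num.natAbs.size
        + (p.coeff m).den.size + ∑ i, (1 + (m i).size))
      have h1 : |(toReal p).coeff a| ≤ 2 ^ (p.coeff a).num.natAbs.size := by
        rw [coeff_toReal]
        have h2 : |p.coeff a| ≤ ((p.coeff a).num.natAbs : ℚ) := by
          rw [Nat.cast_natAbs]
          conv_lhs => rw [← Rat.num_div_den (p.coeff a)]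
          rw [abs_div, Nat.abs_cast, Int.cast_abs]
          exact div_le_self (abs_nonneg _) (by exact_mod_cast (p.coeff a).den_pos)
        have h3 : (((p.coeff a).num.natAbs : ℕ) : ℝ) ≤ 2 ^ (p.coeff a).num.natAbs.size := by
          exact_mod_cast (Nat.lt_size_self _).le
        exact le_trans (by exact_mod_cast h2) h3
      -- The extra `1` that `bitSize` charges per term pays for turning a sum of two powers of two
      -- into their product.
      have h4 : (2 : ℝ) ^ ((p.coeff a).num.natAbs.size + 1) ≤ 2 ^ e :=
        pow_le_pow_right₀ (by norm_num) (by omega)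
      have h5 : (1 : ℝ) ≤ 2 ^ f := one_le_pow₀ (by norm_num)
      have h6 : (1 : ℝ) ≤ 2 ^ (p.coeff a).num.natAbs.size := one_le_pow₀ (by norm_num)
      rw [pow_succ] at h4
      have h7 : (2 : ℝ) ^ (p.coeff a).num.natAbs.size * 2 * 2 ^ f ≤ 2 ^ e * 2 ^ f := by gcongr
      nlinarith
  refine (key _).trans (pow_le_pow_right₀ (by norm_num) (by omega))

/-- A common denominator of the coefficients. -/
theorem exists_integral_multiple (p : MvPolynomial (Fin n) ℚ) :
    ∃ Z : ℕ, Z ≠ 0 ∧ Z ≤ 2 ^ bitSize p ∧ C (Z : ℚ) * p ∈ integralPolys n := by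
  classical
  refine ⟨∏ m ∈ p.support, (p.coeff m).den, ?_, ?_, ?_⟩
  · exact Finset.prod_ne_zero_iff.2 fun m _ => (p.coeff m).den_nz
  · rw [bitSize, pow_add, ← Finset.prod_pow_eq_pow_sum]
    refine le_trans (Finset.prod_le_prod' fun m _ => ?_) (Nat.le_mul_of_pos_left _ (by norm_num))
    exact (Nat.lt_size_self _).le.trans (Nat.pow_le_pow_right (by norm_num) (by omega))
  · rw [mem_integralPolys]
    intro m
    by_cases hm : m ∈ p.support
    · refine ⟨(∏ m' ∈ p.support.erase m, ((p.coeff m').den : ℤ)) * (p.coeff m).num, ?_⟩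
      rw [coeff_C_mul, ← Finset.mul_prod_erase _ _ hm]
      push_cast
      have := Rat.den_mul_eq_num (p.coeff m)
      rw [mul_right_comm, this, mul_comm]
    · exact ⟨0, by rw [coeff_C_mul, notMem_support_iff.1 hm]; simp⟩

end Integral

end PCSoS

end

noncomputable section

namespace PCSoS

open MvPolynomial

/-! ### Integer left inverses of bounded size -/

/-- A bound for the bit length of the entries of an integer left inverse, up to a common
denominator, of a matrix with at most `N` columns, at most `2 ^ x` rows and entries of absolute
value at most `2 ^ b`. -/
def inverseBits (N x b : ℕ) : ℕ := N * N + N * (x + 2 * b) + N + b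

theorem factorial_le_two_pow_sq (s : ℕ) : s.factorial ≤ 2 ^ (s * s) := by
  calc s.factorial ≤ s ^ s := Nat.factorial_le_pow s
    _ ≤ (2 ^ s) ^ s := Nat.pow_le_pow_left Nat.lt_two_pow_self.le _
    _ = 2 ^ (s * s) := by rw [pow_mul]

theorem abs_det_le_two_pow {κ : Type*} [Fintype κ] [DecidableEq κ] (M : Matrix κ κ ℤ) {N e : ℕ}
    (hκ : Fintype.card κ ≤ N) (hM : ∀ i j, |M i j| ≤ 2 ^ e) : |M.det| ≤ 2 ^ (N * N + N * e) := by
  have h := Matrix.det_le (A := M) (abv := AbsoluteValue.abs) (x := 2 ^ e) hM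
  refine h.trans ?_
  rw [nsmul_eq_mul, pow_add]
  have h1 : (((Fintype.card κ).factorial : ℕ) : ℤ) ≤ 2 ^ (N * N) := by
    have := factorial_le_two_pow_sq (Fintype.card κ)
    calc (((Fintype.card κ).factorial : ℕ) : ℤ)
        ≤ ((2 ^ (Fintype.card κ * Fintype.card κ) : ℕ) : ℤ) := by exact_mod_cast this
      _ ≤ 2 ^ (N * N) := by
        push_cast
        exact pow_le_pow_right₀ (by norm_num) (Nat.mul_le_mul hκ hκ)
  have h2 : ((2 : ℤ) ^ e) ^ Fintype.card κ ≤ 2 ^ (N * e) := by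
    rw [← pow_mul]
    exact pow_le_pow_right₀ (by norm_num) (by rw [mul_comm]; exact Nat.mul_le_mul_right _ hκ)
  gcongr

/-- For the matrix `V` with columns `v i`, independence of the columns makes the Gram matrix `G = Vᵀ
V` invertible, and `adj(G) Vᵀ V = det(G)`. So `L = adj(G) Vᵀ` is an integral left inverse up to the
factor `D = det G`. The determinants have size at most `N`; the number of rows only enters through
the size of the entries of `G`. -/
theorem exists_integer_leftInverse {κ Y : Type*} [Fintype κ] [Fintype Y] [DecidableEq κ]
    (v : κ → Y → ℤ) {N x b : ℕ} (hκ : Fintype.card κ ≤ N) (hY : Fintype.card Y ≤ 2 ^ x)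
    (hv : ∀ i y, |v i y| ≤ 2 ^ b)
    (hli : LinearIndependent ℚ fun i y => (v i y : ℚ)) :
    ∃ (D : ℤ) (L : κ → Y → ℤ), D ≠ 0 ∧ |D| ≤ 2 ^ inverseBits N x b ∧
      (∀ j y, |L j y| ≤ 2 ^ inverseBits N x b) ∧
      ∀ i j, ∑ y, L j y * v i y = if j = i then D else 0 := by
  let V : Matrix Y κ ℤ := Matrix.of fun y i => v i y
  let G : Matrix κ κ ℤ := V.transpose * V
  have hG : ∀ i j, |G i j| ≤ 2 ^ (x + 2 * b) := by
    intro i j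
    calc |G i j| = |∑ y, v i y * v j y| := rfl
      _ ≤ ∑ y, |v i y * v j y| := Finset.abs_sum_le_sum_abs _ _
      _ ≤ ∑ _y : Y, 2 ^ b * 2 ^ b := Finset.sum_le_sum fun y _ => by
          rw [abs_mul]
          exact mul_le_mul (hv _ _) (hv _ _) (abs_nonneg _) (by positivity)
      _ = Fintype.card Y * 2 ^ (2 * b) := by simp [two_mul, pow_add]
      _ ≤ 2 ^ x * 2 ^ (2 * b) := by
          gcongr
          exact_mod_cast hY
      _ = 2 ^ (x + 2 * b) := by rw [pow_add]
  have hdet : G.det ≠ 0 := by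
    intro h0
    let VQ : Matrix Y κ ℚ := V.map (Int.castRingHom ℚ)
    have hGQ : (VQ.transpose * VQ).det = 0 := by
      have : VQ.transpose * VQ = G.map (Int.castRingHom ℚ) := by
        rw [Matrix.map_mul, Matrix.transpose_map]
      rw [this, ← RingHom.mapMatrix_apply, ← RingHom.map_det, h0, map_zero]
    obtain ⟨c, hc, hc0⟩ := Matrix.exists_mulVec_eq_zero_iff.2 hGQ
    have hk : c ∈ LinearMap.ker (VQ.transpose * VQ).mulVecLin := by
      rw [LinearMap.mem_ker, Matrix.mulVecLin_apply, hc0]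
    rw [Matrix.ker_mulVecLin_transpose_mul_self] at hk
    apply hc
    have hk' : VQ.mulVec c = 0 := by simpa using hk
    have := Fintype.linearIndependent_iff.1 hli c (by
      funext y
      have := congrFun hk' y
      simp only [Matrix.mulVec, dotProduct, VQ, V, Matrix.map_apply, Matrix.of_apply,
        Pi.zero_apply] at this
      simp only [Finset.sum_apply, Pi.smul_apply, smul_eq_mul, Pi.zero_apply]
      rw [← this]
      exact Finset.sum_congr rfl fun i _ => by simp [mul_comm])
    exact funext this
  have hle : N * N + N * (x + 2 * b) ≤ inverseBits N x b := by rw [inverseBits]; omega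
  have hadj : ∀ i j, |G.adjugate i j| ≤ 2 ^ (N * N + N * (x + 2 * b)) := by
    intro i j
    rw [Matrix.adjugate_apply]
    refine abs_det_le_two_pow _ hκ fun k l => ?_
    rw [Matrix.updateRow_apply]
    split_ifs
    · have : (1 : ℤ) ≤ 2 ^ (x + 2 * b) := one_le_pow₀ (by norm_num)
      rw [Pi.single_apply]
      split_ifs <;> simp [this]
    · exact hG _ _
  refine ⟨G.det, fun j y => (G.adjugate * V.transpose) j y, hdet, ?_, ?_, ?_⟩
  · exact (abs_det_le_two_pow G hκ hG).trans (pow_le_pow_right₀ (by norm_num) hle)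
  · intro j y
    calc |(G.adjugate * V.transpose) j y| = |∑ i, G.adjugate j i * v i y| := rfl
      _ ≤ ∑ i, |G.adjugate j i * v i y| := Finset.abs_sum_le_sum_abs _ _
      _ ≤ ∑ _i : κ, 2 ^ (N * N + N * (x + 2 * b)) * 2 ^ b := Finset.sum_le_sum fun i _ => by
          rw [abs_mul]
          exact mul_le_mul (hadj _ _) (hv _ _) (abs_nonneg _) (by positivity)
      _ = Fintype.card κ * (2 ^ (N * N + N * (x + 2 * b)) * 2 ^ b) := by simp
      _ ≤ 2 ^ N * (2 ^ (N * N + N * (x + 2 * b)) * 2 ^ b) := by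
          gcongr
          exact_mod_cast hκ.trans Nat.lt_two_pow_self.le
      _ = 2 ^ inverseBits N x b := by rw [← pow_add, ← pow_add, inverseBits]; ring_nf
  · intro i j
    have h : G.adjugate * V.transpose * V = G.det • (1 : Matrix κ κ ℤ) := by
      rw [Matrix.mul_assoc]
      exact Matrix.adjugate_mul G
    have := congrFun (congrFun h j) i
    rw [Matrix.mul_apply] at this
    simpa [Matrix.one_apply, V] using this

/-- One integral inverse serves for rational coefficients, when relations on the points are found,
and for real ones, when arbitrary real polynomials are reduced. -/
theorem leftInverse_apply {κ Y K : Type*} [Fintype κ] [Fintype Y] [DecidableEq κ] [CommRing K]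
    {v : κ → Y → ℤ} {D : ℤ} {L : κ → Y → ℤ}
    (h : ∀ i j, ∑ y, L j y * v i y = if j = i then D else 0) (c : κ → K) (j : κ) :
    (D : K) * c j = ∑ y, (L j y : K) * ∑ i, c i * v i y := by
  have h' : ∀ i, ∑ y, (L j y : K) * v i y = if j = i then (D : K) else 0 := by
    intro i
    have := congrArg (Int.cast : ℤ → K) (h i j)
    push_cast at this
    rw [this]
  calc (D : K) * c j = ∑ i, c i * ∑ y, (L j y : K) * v i y := by
          simp_rw [h', mul_ite, mul_zero, Finset.sum_ite_eq, Finset.mem_univ, if_true, mul_comm]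
    _ = _ := by
      simp_rw [Finset.mul_sum]
      rw [Finset.sum_comm]
      exact Finset.sum_congr rfl fun y _ => Finset.sum_congr rfl fun i _ => by ring

end PCSoS

end

noncomputable section

namespace PCSoS

open MvPolynomial

/-! ### Polynomial Calculus derivations with bounded lines and bounded multipliers -/

/-- A line of degree at most `k`, bit size at most `h` and coefficients summing up to at most
`2 ^ h` in absolute value. -/
def IsBoundedLine {n : ℕ} (k h : ℕ) (r : MvPolynomial (Fin n) ℚ) : Prop :=
  r.totalDegree ≤ k ∧ bitSize r ≤ h ∧ l1 (toReal r) ≤ 2 ^ h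

/-- `r` is an axiom or follows by one rule from elements of `H`; the coefficients of linear
combinations are bounded by `2 ^ h`. -/
def IsBoundedStep {n : ℕ} {ι : Type} (P : ι → MvPolynomial (Fin n) ℚ) (h : ℕ)
    (H : Set (MvPolynomial (Fin n) ℚ)) (r : MvPolynomial (Fin n) ℚ) : Prop :=
  (∃ j, r = P j) ∨
    (∃ p ∈ H, ∃ q ∈ H, ∃ a b : ℚ, |a| ≤ 2 ^ h ∧ |b| ≤ 2 ^ h ∧ r = C a * p + C b * q) ∨
    ∃ p ∈ H, ∃ i, r = X i * p

/-- Bounded derivations from the axioms `P` and the hypotheses `H`, most recent line first. -/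
inductive IsBoundedDerivation {n : ℕ} {ι : Type} (P : ι → MvPolynomial (Fin n) ℚ) (k h : ℕ)
    (H : Set (MvPolynomial (Fin n) ℚ)) : List (MvPolynomial (Fin n) ℚ) → Prop
  | nil : IsBoundedDerivation P k h H []
  | step {L : List (MvPolynomial (Fin n) ℚ)} {r : MvPolynomial (Fin n) ℚ} :
      IsBoundedDerivation P k h H L → IsBoundedLine k h r →
        IsBoundedStep P h (H ∪ {p | p ∈ L}) r → IsBoundedDerivation P k h H (r :: L)

section Derivations

variable {n : ℕ} {ι : Type} {P : ι → MvPolynomial (Fin n) ℚ} {k h : ℕ}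
  {H H' : Set (MvPolynomial (Fin n) ℚ)}

theorem IsBoundedStep.mono {r : MvPolynomial (Fin n) ℚ} (hs : IsBoundedStep P h H r)
    (hH : H ⊆ H') : IsBoundedStep P h H' r := by
  rcases hs with hs | ⟨p, hp, q, hq, hs⟩ | ⟨p, hp, hs⟩
  · exact Or.inl hs
  · exact Or.inr (Or.inl ⟨p, hH hp, q, hH hq, hs⟩)
  · exact Or.inr (Or.inr ⟨p, hH hp, hs⟩)

theorem IsBoundedDerivation.append {L₁ L₀ : List (MvPolynomial (Fin n) ℚ)}
    (h₁ : IsBoundedDerivation P k h H' L₁) (h₀ : IsBoundedDerivation P k h H L₀)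
    (hH : H' ⊆ H ∪ {p | p ∈ L₀}) : IsBoundedDerivation P k h H (L₁ ++ L₀) := by
  induction h₁ with
  | nil => exact h₀
  | step _ hr hs ih =>
    refine ih.step hr (hs.mono ?_)
    rintro p (hp | hp)
    · rcases hH hp with hp | hp
      · exact Or.inl hp
      · exact Or.inr (List.mem_append_right _ hp)
    · exact Or.inr (List.mem_append_left _ hp)

theorem IsBoundedDerivation.line {L : List (MvPolynomial (Fin n) ℚ)}
    (hL : IsBoundedDerivation P k h H L) : ∀ p ∈ L, IsBoundedLine k h p := by
  induction hL with
  | nil => simp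
  | step _ hr _ ih =>
    intro p hp
    rcases List.mem_cons.1 hp with rfl | hp
    · exact hr
    · exact ih p hp

theorem IsBoundedDerivation.isPCDerivation {L : List (MvPolynomial (Fin n) ℚ)}
    (hL : IsBoundedDerivation P k h ∅ L) : IsPCDerivation P L := by
  induction hL with
  | nil => exact .nil
  | step _ _ hs ih =>
    refine ih.step ?_
    rcases hs with hs | ⟨p, hp, q, hq, a, b, -, -, hs⟩ | ⟨p, hp, hs⟩
    · exact Or.inl hs
    · exact Or.inr (Or.inl ⟨p, by simpa using hp, q, by simpa using hq, a, b, hs⟩)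
    · exact Or.inr (Or.inr ⟨p, by simpa using hp, hs⟩)

theorem IsBoundedDerivation.hasPCDerivation {L : List (MvPolynomial (Fin n) ℚ)}
    (hL : IsBoundedDerivation P k h ∅ L) {r : MvPolynomial (Fin n) ℚ} (hr : r ∈ L) :
    HasPCDerivation P r k ((L.length + 1) * h) := by
  have hlines : ∀ q ∈ r :: L, IsBoundedLine k h q := by
    intro q hq
    rcases List.mem_cons.1 hq with rfl | hq
    · exact hL.line _ hr
    · exact hL.line _ hq
  -- The polynomial `r` may occur anywhere in `L`; it is repeated as the final line in the form `1 *
  -- r + 0 * r`.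
  refine ⟨L, hL.isPCDerivation.step (Or.inr (Or.inl ⟨r, hr, r, hr, 1, 0, by simp⟩)),
    fun q hq => (hlines q hq).1, ?_⟩
  have := List.sum_le_card_nsmul ((r :: L).map bitSize) h (by
    intro x hx
    obtain ⟨q, hq, rfl⟩ := List.mem_map.1 hx
    exact (hlines q hq).2.1)
  simpa using this

theorem exists_derivation_of_forall {ℓ : ℕ} (F : Finset (MvPolynomial (Fin n) ℚ))
    (hF : ∀ p ∈ F, ∃ L, IsBoundedDerivation P k h H L ∧ p ∈ L ∧ L.length ≤ ℓ) :
    ∃ L, IsBoundedDerivation P k h H L ∧ (∀ p ∈ F, p ∈ L) ∧ L.length ≤ F.card * ℓ := by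
  classical
  induction F using Finset.induction_on with
  | empty => exact ⟨[], .nil, by simp, by simp⟩
  | insert a F ha ih =>
    obtain ⟨L, h1, h2, h3⟩ := ih fun p hp => hF p (Finset.mem_insert_of_mem hp)
    obtain ⟨L', h1', h2', h3'⟩ := hF a (Finset.mem_insert_self _ _)
    refine ⟨L' ++ L, h1'.append h1 Set.subset_union_left, ?_, ?_⟩
    · intro p hp
      rcases Finset.mem_insert.1 hp with rfl | hp
      · exact List.mem_append_left _ h2'
      · exact List.mem_append_right _ (h2 p hp)
    · rw [List.length_append, Finset.card_insert_of_notMem ha, add_mul, one_mul, add_comm]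
      exact Nat.add_le_add h3 h3'

end Derivations

/-! ### Levels of derivable polynomials -/

section Levels

variable {n : ℕ} {ι : Type}

/-- The spans of polynomials derivable from `P` in degree `k` by a given number of rounds, in each
of which polynomials with small integer coefficients are multiplied by monomials. -/
def level (P : ι → MvPolynomial (Fin n) ℚ) (k b : ℕ) : ℕ → Submodule ℚ (MvPolynomial (Fin n) ℚ)
  | 0 => Submodule.span ℚ {q | ∃ j m, m.degree + (P j).totalDegree ≤ k ∧ q = monomial m 1 * P j}
  | i + 1 => level P k b i ⊔ Submodule.span ℚ {q | ∃ c ∈ level P k b i,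
      c ∈ boundedIntegral n k b ∧ ∃ m, m.degree + c.totalDegree ≤ k ∧ q = monomial m 1 * c}

variable {P : ι → MvPolynomial (Fin n) ℚ} {k b b' : ℕ}

theorem level_mono : Monotone (level P k b) :=
  monotone_nat_of_le_succ fun _ => le_sup_left

theorem boundedIntegral_mono (h : b ≤ b') : boundedIntegral n k b ⊆ boundedIntegral n k b' :=
  fun _ hp => ⟨hp.1, hp.2.1.trans (pow_le_pow_right₀ (by norm_num) h), hp.2.2⟩

theorem monomial_mul_mem_boundedIntegral {c : MvPolynomial (Fin n) ℚ} {m : Fin n →₀ ℕ}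
    (hc : c ∈ boundedIntegral n k b) (hm : m.degree + c.totalDegree ≤ k) :
    monomial m 1 * c ∈ boundedIntegral n k b := by
  refine ⟨mul_mem (monomial_one_mem_integralPolys m) hc.1, ?_,
    (totalDegree_monomial_mul_le _ _ _).trans hm⟩
  rw [toReal_mul, toReal_monomial, Rat.cast_one]
  exact (l1_monomial_one_mul_le _ _).trans hc.2.1

/-- The coefficients of linearly independent polynomials of bounded degree are linearly
independent vectors. -/
theorem linearIndependent_coeff {κ : Type*} [Fintype κ] {u : κ → MvPolynomial (Fin n) ℚ}
    (hu : LinearIndependent ℚ u) (hk : ∀ i, (u i).totalDegree ≤ k) :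
    LinearIndependent ℚ fun (i : κ) (m : monomials n k) => (u i).coeff m := by
  rw [Fintype.linearIndependent_iff] at hu ⊢
  intro g hg
  refine hu g ?_
  ext m
  rw [coeff_sum, coeff_zero]
  by_cases hm : m ∈ monomials n k
  · have := congrFun hg ⟨m, hm⟩
    simpa using this
  · refine Finset.sum_eq_zero fun i _ => ?_
    have : m ∉ (u i).support := fun h => hm (support_subset_monomials (hk i) h)
    rw [coeff_smul, notMem_support_iff.1 this, smul_zero]

theorem card_le_of_linearIndependent {κ : Type*} [Fintype κ] {u : κ → MvPolynomial (Fin n) ℚ}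
    (hu : LinearIndependent ℚ u) (hk : ∀ i, (u i).totalDegree ≤ k) :
    Fintype.card κ ≤ (n + 1) ^ k := by
  have := (linearIndependent_coeff hu hk).fintype_card_le_finrank
  rw [Module.finrank_fintype_fun_eq_card, Fintype.card_coe] at this
  exact this.trans (card_monomials_le n k)

/-- The basis is taken from `S` itself, so its elements inherit whatever integrality and size bounds
hold on `S`. -/
theorem exists_finset_basis (S : Set (MvPolynomial (Fin n) ℚ))
    (hS : ∀ p ∈ S, p.totalDegree ≤ k) :
    ∃ F : Finset (MvPolynomial (Fin n) ℚ), (F : Set (MvPolynomial (Fin n) ℚ)) ⊆ S ∧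
      Submodule.span ℚ (F : Set (MvPolynomial (Fin n) ℚ)) = Submodule.span ℚ S ∧
      LinearIndependent ℚ ((↑) : F → MvPolynomial (Fin n) ℚ) ∧ F.card ≤ (n + 1) ^ k := by
  obtain ⟨B, hBS, hspan, hli⟩ := exists_linearIndependent ℚ S
  have hfin : B.Finite := by
    by_contra hinf
    obtain ⟨t, htB, htc⟩ := Set.Infinite.exists_subset_card_eq hinf ((n + 1) ^ k + 1)
    have hlt : LinearIndependent ℚ ((↑) : t → MvPolynomial (Fin n) ℚ) :=
      LinearIndepOn.mono (v := id) hli htB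
    have := card_le_of_linearIndependent (k := k) hlt fun p => hS _ (hBS (htB p.2))
    rw [Fintype.card_coe] at this
    omega
  obtain ⟨F, rfl⟩ := hfin.exists_finset_coe
  refine ⟨F, hBS, hspan, hli, ?_⟩
  have := card_le_of_linearIndependent (k := k) hli fun p => hS _ (hBS p.2)
  simpa using this

/-- A bound for the bit length of the coefficients of integer combinations. -/
def combinationBits (n k b : ℕ) : ℕ :=
  2 * (n + 1) ^ k + inverseBits ((n + 1) ^ k) ((n + 1) ^ k) b + 2 * b

/-- A bound for the lines of the derivations of bounded integral polynomials. -/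
def lineBits (n k b : ℕ) : ℕ :=
  1 + (n + 1) ^ k * (combinationBits n k b + 3 + n * (1 + k)) + combinationBits n k b

theorem isBoundedLine_of_mem {p : MvPolynomial (Fin n) ℚ}
    (hp : p ∈ boundedIntegral n k (combinationBits n k b)) :
    IsBoundedLine k (lineBits n k b) p :=
  ⟨hp.2.2, (bitSize_le hp).trans (Nat.le_add_right _ _),
    hp.2.1.trans (pow_le_pow_right₀ (by norm_num) (Nat.le_add_left _ _))⟩

theorem le_combinationBits : b ≤ combinationBits n k b := by
  rw [combinationBits]; omega

theorem combinationBits_le_lineBits : combinationBits n k b ≤ lineBits n k b :=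
  Nat.le_add_left _ _

/-- Cramer's rule for integer polynomials. -/
theorem exists_integer_combination {F : Finset (MvPolynomial (Fin n) ℚ)}
    (hli : LinearIndependent ℚ ((↑) : F → MvPolynomial (Fin n) ℚ))
    (hF : ∀ u ∈ F, u ∈ boundedIntegral n k b) {c : MvPolynomial (Fin n) ℚ}
    (hc : c ∈ Submodule.span ℚ (F : Set (MvPolynomial (Fin n) ℚ)))
    (hcb : c ∈ boundedIntegral n k b) :
    ∃ (D : ℤ) (e : MvPolynomial (Fin n) ℚ → ℤ), D ≠ 0 ∧
      (∀ u ∈ F, |e u| ≤ 2 ^ ((n + 1) ^ k + inverseBits ((n + 1) ^ k) ((n + 1) ^ k) b + b)) ∧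
      C (D : ℚ) * c = ∑ u ∈ F, C (e u : ℚ) * u := by
  classical
  set N := (n + 1) ^ k
  obtain ⟨a, ha⟩ := (Submodule.mem_span_finset.1 hc)
  have hintegral : ∀ p ∈ boundedIntegral n k b, ∀ m, ∃ z : ℤ, p.coeff m = z ∧ |z| ≤ 2 ^ b := by
    intro p hp m
    obtain ⟨z, hz⟩ := mem_integralPolys.1 hp.1 m
    refine ⟨z, hz, ?_⟩
    have := (abs_coeff_le_l1 (toReal p) m).trans hp.2.1
    rw [coeff_toReal, hz, Rat.cast_intCast] at this
    exact_mod_cast this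
  have hintegral' : ∀ (u : F) (m : monomials n k), ∃ z : ℤ,
      (u : MvPolynomial (Fin n) ℚ).coeff m = z ∧ |z| ≤ 2 ^ b := fun u m => hintegral u (hF u u.2) m
  choose v hv hvb using hintegral'
  choose t ht htb using hintegral c hcb
  have hdeg : ∀ u : F, (u : MvPolynomial (Fin n) ℚ).totalDegree ≤ k := fun u => (hF u u.2).2.2
  have hcardY : Fintype.card (monomials n k) ≤ N := by
    rw [Fintype.card_coe]; exact card_monomials_le n k
  have hliv : LinearIndependent ℚ fun (u : F) (m : monomials n k) => (v u m : ℚ) := by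
    have := linearIndependent_coeff hli hdeg
    simpa only [hv] using this
  obtain ⟨D, L, hD, -, hL, hLv⟩ := exists_integer_leftInverse v
    (card_le_of_linearIndependent hli hdeg) (hcardY.trans Nat.lt_two_pow_self.le) hvb hliv
  have hca : ∀ m, (c.coeff m) = ∑ u : F, a u * (u : MvPolynomial (Fin n) ℚ).coeff m := by
    intro m
    rw [← ha.2, coeff_sum, ← Finset.sum_coe_sort F]
    exact Finset.sum_congr rfl fun u _ => by rw [coeff_smul, smul_eq_mul]
  let e' : F → ℤ := fun u => ∑ m, L u m * t m
  have he' : ∀ u : F, (D : ℚ) * a u = e' u := by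
    intro u
    rw [leftInverse_apply hLv (fun u : F => a u) u]
    push_cast [e']
    refine Finset.sum_congr rfl fun m _ => ?_
    rw [← ht, hca]
    simp only [hv]
  refine ⟨D, fun u => if hu : u ∈ F then e' ⟨u, hu⟩ else 0, hD, ?_, ?_⟩
  · intro u hu
    simp only [hu, dif_pos]
    calc |e' ⟨u, hu⟩| ≤ ∑ m, |L ⟨u, hu⟩ m * t m| := Finset.abs_sum_le_sum_abs _ _
      _ ≤ ∑ _m : monomials n k, 2 ^ inverseBits N N b * 2 ^ b := Finset.sum_le_sum fun m _ => by
          rw [abs_mul]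
          exact mul_le_mul (hL _ _) (htb _) (abs_nonneg _) (by positivity)
      _ = Fintype.card (monomials n k) * (2 ^ inverseBits N N b * 2 ^ b) := by simp
      _ ≤ 2 ^ N * (2 ^ inverseBits N N b * 2 ^ b) := by
          gcongr
          exact_mod_cast hcardY.trans Nat.lt_two_pow_self.le
      _ = 2 ^ (N + inverseBits N N b + b) := by rw [pow_add, pow_add, mul_assoc]
  · rw [← ha.2, Finset.mul_sum]
    refine Finset.sum_congr rfl fun u hu => ?_
    simp only [hu, dif_pos]
    rw [← he' ⟨u, hu⟩, smul_eq_C_mul, ← mul_assoc, ← C_mul]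

/-- Cramer's rule writes `D * c` as an integer combination of `F`. The partial sums are the lines,
so all of them are integral and bounded, and a single division by `D` ends the derivation. -/
theorem exists_derivation_of_mem_span {H : Set (MvPolynomial (Fin n) ℚ)}
    {F : Finset (MvPolynomial (Fin n) ℚ)} (hFH : ∀ u ∈ F, u ∈ H)
    (hli : LinearIndependent ℚ ((↑) : F → MvPolynomial (Fin n) ℚ))
    (hF : ∀ u ∈ F, u ∈ boundedIntegral n k b) {c : MvPolynomial (Fin n) ℚ}
    (hc : c ∈ Submodule.span ℚ (F : Set (MvPolynomial (Fin n) ℚ)))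
    (hcb : c ∈ boundedIntegral n k b) (hc0 : c ≠ 0) :
    ∃ L, IsBoundedDerivation P k (lineBits n k b) H L ∧ c ∈ L ∧ L.length ≤ (n + 1) ^ k + 2 := by
  classical
  obtain ⟨D, e, hD, he, hsum⟩ := exists_integer_combination hli hF hc hcb
  set N := (n + 1) ^ k with hN
  set q := N + inverseBits N N b + b with hq
  have hcard : F.card ≤ N := by
    simpa using card_le_of_linearIndependent (k := k) hli fun u => (hF u u.2).2.2
  have hqc : q ≤ combinationBits n k b := by rw [combinationBits, ← hN]; omega
  have hql : q ≤ lineBits n k b := hqc.trans combinationBits_le_lineBits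
  have hline : ∀ s ⊆ F, IsBoundedLine k (lineBits n k b) (∑ u ∈ s, C (e u : ℚ) * u) := by
    intro s hs
    refine isBoundedLine_of_mem ⟨?_, ?_, ?_⟩
    · exact sum_mem fun u hu => mul_mem (intCast_mem_integralPolys _) (hF u (hs hu)).1
    · rw [toReal_sum]
      refine (l1_sum_le _ _).trans ?_
      calc ∑ u ∈ s, l1 (toReal (C (e u : ℚ) * u)) ≤ ∑ _u ∈ s, (2 : ℝ) ^ q * 2 ^ b :=
            Finset.sum_le_sum fun u hu => by
              rw [toReal_mul, toReal_C, l1_C_mul]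
              refine mul_le_mul ?_ (hF u (hs hu)).2.1 (l1_nonneg _) (by positivity)
              rw [Rat.cast_intCast]
              exact_mod_cast he u (hs hu)
        _ = s.card * ((2 : ℝ) ^ q * 2 ^ b) := by simp
        _ ≤ 2 ^ N * ((2 : ℝ) ^ q * 2 ^ b) := by
            gcongr
            exact_mod_cast ((Finset.card_le_card hs).trans hcard).trans Nat.lt_two_pow_self.le
        _ = 2 ^ combinationBits n k b := by
            rw [← pow_add, ← pow_add, combinationBits, ← hN]
            congr 1
            omega
    · refine totalDegree_finsetSum_le fun u hu => ?_
      refine (totalDegree_mul _ _).trans ?_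
      rw [totalDegree_C, zero_add]
      exact (hF u (hs hu)).2.2
  have hpart : ∀ s ⊆ F, ∃ L, IsBoundedDerivation P k (lineBits n k b) H L ∧
      (∑ u ∈ s, C (e u : ℚ) * u) ∈ L ∧ L.length ≤ s.card + 1 := by
    intro s
    induction s using Finset.induction_on with
    | empty =>
      intro hs
      -- The empty sum has to be a line too, namely `0 * u + 0 * u`. Some `u` is available since `c
      -- ≠ 0` excludes an empty `F`.
      have hne : F.Nonempty := by
        by_contra h
        rw [Finset.not_nonempty_iff_eq_empty.1 h] at hc
        simp only [Finset.coe_empty, Submodule.span_empty, Submodule.mem_bot] at hc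
        exact hc0 hc
      obtain ⟨u, hu⟩ := hne
      refine ⟨[0], .step .nil ?_ (Or.inr (Or.inl ⟨u, Or.inl (hFH u hu), u, Or.inl (hFH u hu),
        0, 0, by simp, by simp, by simp⟩)), by simp, by simp⟩
      simpa using hline ∅ (by simp)
    | insert u s hu ih =>
      intro hs
      obtain ⟨L, h1, h2, h3⟩ := ih fun v hv => hs (Finset.mem_insert_of_mem hv)
      have huF : u ∈ F := hs (Finset.mem_insert_self _ _)
      refine ⟨_ :: L, h1.step (hline _ hs) (Or.inr (Or.inl ⟨_, Or.inr h2, u, Or.inl (hFH u huF),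
        1, e u, ?_, ?_, ?_⟩)), List.mem_cons_self, ?_⟩
      · simpa using one_le_pow₀ (by norm_num)
      · have h4 := (he u huF).trans (pow_le_pow_right₀ (by norm_num) hql)
        exact_mod_cast h4
      · rw [Finset.sum_insert hu, C_1, one_mul, add_comm]
      · rw [List.length_cons, Finset.card_insert_of_notMem hu]
        omega
  obtain ⟨L, h1, h2, h3⟩ := hpart F subset_rfl
  refine ⟨c :: L, h1.step ?_ (Or.inr (Or.inl ⟨_, Or.inr h2, _, Or.inr h2, (D : ℚ)⁻¹, 0, ?_, by simp,
    ?_⟩)), List.mem_cons_self, ?_⟩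
  · exact isBoundedLine_of_mem (boundedIntegral_mono le_combinationBits hcb)
  · have h4 : (1 : ℚ) ≤ |(D : ℚ)| := by exact_mod_cast Int.one_le_abs hD
    rw [abs_inv]
    exact (inv_le_one_of_one_le₀ h4).trans (one_le_pow₀ (by norm_num))
  · rw [← hsum, C_0, zero_mul, add_zero, ← mul_assoc, ← C_mul,
      inv_mul_cancel₀ (Int.cast_ne_zero.2 hD), C_1, one_mul]
  · rw [List.length_cons]
    omega

theorem exists_derivation_monomial_mul {H : Set (MvPolynomial (Fin n) ℚ)}
    {c : MvPolynomial (Fin n) ℚ} (hcH : c ∈ H) (hcb : c ∈ boundedIntegral n k b)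
    (m : Fin n →₀ ℕ) (hm : m.degree + c.totalDegree ≤ k) :
    ∃ L, IsBoundedDerivation P k (lineBits n k b) H L ∧ monomial m 1 * c ∈ L ∧
      L.length ≤ m.degree + 1 := by
  obtain ⟨e, he⟩ : ∃ e, m.degree = e := ⟨_, rfl⟩
  induction e generalizing m with
  | zero =>
    obtain rfl := (Finsupp.degree_eq_zero_iff m).1 he
    refine ⟨[c], .step .nil ?_ (Or.inr (Or.inl ⟨c, Or.inl hcH, c, Or.inl hcH, 1, 0, ?_,
      by simp, by simp⟩)), by simp, by simp⟩
    · exact isBoundedLine_of_mem (boundedIntegral_mono le_combinationBits hcb)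
    · simpa using one_le_pow₀ (by norm_num)
  | succ e ih =>
    have h0 : m ≠ 0 := by
      rintro rfl
      simp at he
    obtain ⟨i, hi⟩ := Finsupp.ne_iff.1 h0
    have hle : Finsupp.single i 1 ≤ m := by
      rw [Finsupp.single_le_iff]
      simp at hi
      omega
    obtain ⟨m', rfl⟩ := exists_add_of_le hle
    have hdeg : (Finsupp.single i 1 + m').degree = m'.degree + 1 := by simp [add_comm]
    obtain ⟨L, h1, h2, h3⟩ := ih m' (by omega) (by omega)
    have hstep : monomial (Finsupp.single i 1 + m') 1 * c = X i * (monomial m' 1 * c) := by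
      rw [← mul_assoc, X, monomial_mul, mul_one]
    refine ⟨_ :: L, h1.step ?_ (Or.inr (Or.inr ⟨_, Or.inr h2, i, hstep⟩)),
      List.mem_cons_self, ?_⟩
    · exact isBoundedLine_of_mem (boundedIntegral_mono le_combinationBits
        (monomial_mul_mem_boundedIntegral hcb hm))
    · rw [List.length_cons, hdeg]
      omega

/-- The number of lines that one round of derivations costs. -/
def roundCost (n k : ℕ) : ℕ := (n + 1) ^ k * ((n + 1) ^ k + k + 4)

/-- The invariant is a basis of the level consisting of derived polynomials from `boundedIntegral n
k b'`. For the next level, each multiplicand is first recovered from the current basis by Cramer's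
rule and then multiplied by a monomial. The products are again in `boundedIntegral n k b'`, so the
bit bound does not depend on `i`, and only the number of lines grows, linearly. The slack `2 * β ≤
b'` makes room for clearing the denominators of the axioms. -/
theorem exists_level_derivation {β : ℕ} (hPβ : ∀ j, bitSize (P j) ≤ β)
    (hβ : 2 * β ≤ b') (hb : b ≤ b') (i : ℕ) :
    ∃ (F : Finset (MvPolynomial (Fin n) ℚ)) (L : List (MvPolynomial (Fin n) ℚ)),
      IsBoundedDerivation P k (lineBits n k b') ∅ L ∧ (∀ u ∈ F, u ∈ L) ∧
      LinearIndependent ℚ ((↑) : F → MvPolynomial (Fin n) ℚ) ∧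
      (∀ u ∈ F, u ∈ boundedIntegral n k b') ∧
      Submodule.span ℚ (F : Set (MvPolynomial (Fin n) ℚ)) = level P k b i ∧
      L.length ≤ (i + 1) * roundCost n k := by
  have hbl : b' ≤ lineBits n k b' := le_combinationBits.trans combinationBits_le_lineBits
  induction i with
  | zero =>
    choose Z hZ0 hZb hZi using fun j => exists_integral_multiple (P j)
    have hw : ∀ j, (P j).totalDegree ≤ k → C (Z j : ℚ) * P j ∈ boundedIntegral n k b' := by
      intro j hj
      refine ⟨hZi j, ?_, ?_⟩
      · rw [toReal_mul, toReal_C, l1_C_mul]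
        have h1 : |((Z j : ℚ) : ℝ)| ≤ 2 ^ β := by
          rw [Rat.cast_natCast, Nat.abs_cast]
          exact_mod_cast (hZb j).trans (Nat.pow_le_pow_right (by norm_num) (hPβ j))
        have h2 : l1 (toReal (P j)) ≤ 2 ^ β :=
          (l1_toReal_le_two_pow_bitSize _).trans (pow_le_pow_right₀ (by norm_num) (hPβ j))
        calc _ ≤ (2 : ℝ) ^ β * 2 ^ β := mul_le_mul h1 h2 (l1_nonneg _) (by positivity)
          _ = 2 ^ (2 * β) := by rw [two_mul, pow_add]
          _ ≤ 2 ^ b' := pow_le_pow_right₀ (by norm_num) hβ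
      · refine (totalDegree_mul _ _).trans ?_
        rwa [totalDegree_C, zero_add]
    have hdegw : ∀ j, (C (Z j : ℚ) * P j).totalDegree ≤ (P j).totalDegree := by
      intro j
      refine (totalDegree_mul _ _).trans ?_
      rw [totalDegree_C, zero_add]
    let S : Set (MvPolynomial (Fin n) ℚ) :=
      {q | ∃ j m, m.degree + (P j).totalDegree ≤ k ∧ q = monomial m 1 * (C (Z j : ℚ) * P j)}
    have hS : ∀ p ∈ S, p ∈ boundedIntegral n k b' := by
      rintro p ⟨j, m, hm, rfl⟩
      refine monomial_mul_mem_boundedIntegral (hw j (by omega)) ?_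
      have := hdegw j
      omega
    obtain ⟨F, hFS, hspan, hli, hcard⟩ := exists_finset_basis S fun p hp => (hS p hp).2.2
    have hder : ∀ p ∈ F, ∃ L, IsBoundedDerivation P k (lineBits n k b') ∅ L ∧ p ∈ L ∧
        L.length ≤ k + 3 := by
      intro p hp
      obtain ⟨j, m, hm, rfl⟩ := hFS hp
      have h1 : IsBoundedLine k (lineBits n k b') (P j) := by
        refine ⟨by omega, (hPβ j).trans (by omega), ?_⟩
        exact (l1_toReal_le_two_pow_bitSize _).trans
          (pow_le_pow_right₀ (by norm_num) ((hPβ j).trans (by omega)))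
      have h2 : IsBoundedDerivation P k (lineBits n k b') ∅ [P j] :=
        .step .nil h1 (Or.inl ⟨j, rfl⟩)
      have h3 : IsBoundedDerivation P k (lineBits n k b') ∅ [C (Z j : ℚ) * P j, P j] := by
        refine h2.step (isBoundedLine_of_mem (boundedIntegral_mono le_combinationBits
          (hw j (by omega)))) (Or.inr (Or.inl ⟨P j, by simp, P j, by simp, Z j, 0, ?_, by simp,
            by simp⟩))
        have h4 : Z j ≤ 2 ^ lineBits n k b' := (hZb j).trans
          (Nat.pow_le_pow_right (by norm_num) ((hPβ j).trans (by omega)))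
        rw [Nat.abs_cast]
        exact_mod_cast h4
      obtain ⟨L, h5, h6, h7⟩ := exists_derivation_monomial_mul (P := P) (k := k) (b := b')
        (H := {p | p ∈ [C (Z j : ℚ) * P j, P j]}) (c := C (Z j : ℚ) * P j) (by simp)
        (hw j (by omega)) m (by have := hdegw j; omega)
      refine ⟨L ++ _, h5.append h3 Set.subset_union_right, List.mem_append_left _ h6, ?_⟩
      simp only [List.length_append, List.length_cons, List.length_nil]
      omega
    obtain ⟨L, hL1, hL2, hL3⟩ := exists_derivation_of_forall F hder
    refine ⟨F, L, hL1, hL2, hli, fun u hu => hS u (hFS hu), ?_, ?_⟩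
    · rw [hspan, level]
      apply le_antisymm
      · rw [Submodule.span_le]
        rintro _ ⟨j, m, hm, rfl⟩
        have : monomial m 1 * (C (Z j : ℚ) * P j) = (Z j : ℚ) • (monomial m 1 * P j) := by
          rw [smul_eq_C_mul]; ring
        rw [this]
        exact Submodule.smul_mem _ _ (Submodule.subset_span ⟨j, m, hm, rfl⟩)
      · rw [Submodule.span_le]
        rintro _ ⟨j, m, hm, rfl⟩
        have : monomial m 1 * P j = (Z j : ℚ)⁻¹ • (monomial m 1 * (C (Z j : ℚ) * P j)) := by
          have h0 : (Z j : ℚ) ≠ 0 := Nat.cast_ne_zero.2 (hZ0 j)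
          rw [smul_eq_C_mul, mul_left_comm, ← mul_assoc (C _) (C _), ← C_mul, inv_mul_cancel₀ h0,
            C_1, one_mul]
        rw [this]
        exact Submodule.smul_mem _ _ (Submodule.subset_span ⟨j, m, hm, rfl⟩)
    · rw [zero_add, one_mul, roundCost]
      refine hL3.trans (Nat.mul_le_mul hcard (by omega))
  | succ i ih =>
    obtain ⟨F₀, L₀, hd, hFL, hli₀, hF₀, hspan₀, hlen₀⟩ := ih
    let S : Set (MvPolynomial (Fin n) ℚ) := {q | ∃ c ∈ level P k b i,
      c ∈ boundedIntegral n k b ∧ ∃ m, m.degree + c.totalDegree ≤ k ∧ q = monomial m 1 * c}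
    have hS : ∀ p ∈ S, p ∈ boundedIntegral n k b' := by
      rintro p ⟨c, -, hcb, m, hm, rfl⟩
      exact monomial_mul_mem_boundedIntegral (boundedIntegral_mono hb hcb) hm
    have hU : ∀ p ∈ (F₀ : Set (MvPolynomial (Fin n) ℚ)) ∪ S, p ∈ boundedIntegral n k b' := by
      rintro p (hp | hp)
      · exact hF₀ p hp
      · exact hS p hp
    obtain ⟨F, hFS, hspan, hli, hcard⟩ := exists_finset_basis _ fun p hp => (hU p hp).2.2
    have hder : ∀ p ∈ F, ∃ L, IsBoundedDerivation P k (lineBits n k b') {p | p ∈ L₀} L ∧ p ∈ L ∧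
        L.length ≤ (n + 1) ^ k + k + 4 := by
      intro p hp
      have hp0 : p ≠ 0 := hli.ne_zero ⟨p, hp⟩
      have hmul : ∀ c ∈ level P k b i, c ∈ boundedIntegral n k b' → ∀ m : Fin n →₀ ℕ,
          m.degree + c.totalDegree ≤ k → p = monomial m 1 * c →
          ∃ L, IsBoundedDerivation P k (lineBits n k b') {p | p ∈ L₀} L ∧ p ∈ L ∧
            L.length ≤ (n + 1) ^ k + k + 4 := by
        intro c hc hcb m hm hpm
        have hc0 : c ≠ 0 := by
          rintro rfl
          exact hp0 (by rw [hpm, mul_zero])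
        rw [← hspan₀] at hc
        obtain ⟨L, h1, h2, h3⟩ := exists_derivation_of_mem_span (P := P)
          (H := {p | p ∈ L₀}) hFL hli₀ hF₀ hc hcb hc0
        obtain ⟨L', h1', h2', h3'⟩ := exists_derivation_monomial_mul (P := P) (k := k) (b := b')
          (H := {p | p ∈ L}) h2 hcb m hm
        refine ⟨L' ++ L, h1'.append h1 Set.subset_union_right,
          List.mem_append_left _ (hpm ▸ h2'), ?_⟩
        rw [List.length_append]
        omega
      rcases hFS hp with hp' | ⟨c, hc, hcb, m, hm, hpm⟩
      · refine hmul p ?_ (hF₀ p hp') 0 ?_ (by simp)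
        · rw [← hspan₀]
          exact Submodule.subset_span hp'
        · simpa using (hF₀ p hp').2.2
      · exact hmul c hc (boundedIntegral_mono hb hcb) m hm hpm
    obtain ⟨L, hL1, hL2, hL3⟩ := exists_derivation_of_forall F hder
    refine ⟨F, L ++ L₀, hL1.append hd Set.subset_union_right,
      fun u hu => List.mem_append_left _ (hL2 u hu), hli, fun u hu => hU u (hFS hu), ?_, ?_⟩
    · rw [hspan, Submodule.span_union, hspan₀, level]
    · rw [List.length_append, add_mul (i + 1), one_mul, add_comm]
      refine Nat.add_le_add hlen₀ (hL3.trans ?_)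
      rw [roundCost]
      exact Nat.mul_le_mul_right _ hcard

/-- Bounded integral polynomials at a given level have bounded derivations. -/
theorem exists_derivation_of_mem_level {β : ℕ} (hPβ : ∀ j, bitSize (P j) ≤ β)
    (hβ : 2 * β ≤ b') (hb : b ≤ b') {i : ℕ} {g : MvPolynomial (Fin n) ℚ} (hg : g ∈ level P k b i)
    (hgb : g ∈ boundedIntegral n k b') (hg0 : g ≠ 0) :
    ∃ L, IsBoundedDerivation P k (lineBits n k b') ∅ L ∧ g ∈ L ∧
      L.length ≤ (i + 2) * roundCost n k := by
  obtain ⟨F₀, L₀, hd, hFL, hli₀, hF₀, hspan₀, hlen₀⟩ := exists_level_derivation hPβ hβ hb i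
  rw [← hspan₀] at hg
  obtain ⟨L, h1, h2, h3⟩ := exists_derivation_of_mem_span (P := P)
    (H := {p | p ∈ L₀}) hFL hli₀ hF₀ hg hgb hg0
  refine ⟨L ++ L₀, h1.append hd Set.subset_union_right, List.mem_append_left _ h2, ?_⟩
  rw [List.length_append, show i + 2 = (i + 1) + 1 by omega, add_mul (i + 1), one_mul, add_comm]
  refine Nat.add_le_add hlen₀ (h3.trans ?_)
  rw [roundCost]
  have : 1 ≤ (n + 1) ^ k := Nat.one_le_pow _ _ (by omega)
  nlinarith

end Levels

end PCSoS

end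

noncomputable section

namespace PCSoS

open MvPolynomial

/-! ### Bounded sum-of-squares proofs -/

section SoS

variable {n : ℕ} {ι : Type} [Fintype ι]

/-- `r ≥ 0` has a sum-of-squares proof of degree at most `k` in which the coefficients of every
polynomial sum up to at most `B` in absolute value. -/
def HasSoS (P : ι → MvPolynomial (Fin n) ℚ) (k : ℕ) (B : ℝ) (r : MvPolynomial (Fin n) ℝ) : Prop :=
  ∃ π : SoSProof P r, π.DegreeLE k ∧ (∀ i, l1 (π.s i) ≤ B) ∧ ∀ j, l1 (π.h j) ≤ B

variable {P : ι → MvPolynomial (Fin n) ℚ} {k k' : ℕ} {B B' : ℝ} {r r' : MvPolynomial (Fin n) ℝ}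

theorem HasSoS.exists_coeffLE (h : HasSoS P k B r) :
    ∃ π : SoSProof P r, π.DegreeLE k ∧ π.CoeffLE B := by
  obtain ⟨π, h1, h2, h3⟩ := h
  exact ⟨π, h1, fun i => (coeffNorm_le_l1 _).trans (h2 i), fun j => (coeffNorm_le_l1 _).trans (h3 j)⟩

theorem HasSoS.mono (h : HasSoS P k B r) (hk : k ≤ k') (hB : B ≤ B') : HasSoS P k' B' r := by
  obtain ⟨π, h1, h2, h3⟩ := h
  exact ⟨π, ⟨fun i => (h1.1 i).trans hk, fun j => (h1.2 j).trans hk⟩, fun i => (h2 i).trans hB,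
    fun j => (h3 j).trans hB⟩

theorem HasSoS.zero (hB : 0 ≤ B) : HasSoS P k B 0 :=
  ⟨⟨0, Fin.elim0, fun _ => 0, by simp⟩, ⟨fun i => i.elim0, by simp⟩, fun i => i.elim0,
    fun _ => by simpa using hB⟩

theorem HasSoS.add (hB : 0 ≤ B) (hB' : 0 ≤ B') (h : HasSoS P k B r) (h' : HasSoS P k B' r') :
    HasSoS P k (B + B') (r + r') := by
  obtain ⟨⟨t, s, g, e⟩, h1, h2, h3⟩ := h
  obtain ⟨⟨t', s', g', e'⟩, h1', h2', h3'⟩ := h'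
  refine ⟨⟨t + t', Fin.append s s', fun j => g j + g' j, ?_⟩, ⟨?_, ?_⟩, ?_, ?_⟩
  · rw [Fin.sum_univ_add]
    simp only [Fin.append_left, Fin.append_right, add_mul, Finset.sum_add_distrib]
    rw [e, e']
    ring
  · intro i
    refine Fin.addCases (fun i => ?_) (fun i => ?_) i
    · simpa using h1.1 i
    · simpa using h1'.1 i
  · intro j
    simp only [add_mul]
    exact (totalDegree_add _ _).trans (max_le (h1.2 j) (h1'.2 j))
  · intro i
    refine Fin.addCases (fun i => ?_) (fun i => ?_) i
    · simpa using (h2 i).trans (le_add_of_nonneg_right hB')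
    · simpa using (h2' i).trans (le_add_of_nonneg_left hB)
  · intro j
    exact (l1_add_le _ _).trans (add_le_add (h3 j) (h3' j))

theorem HasSoS.sum {κ : Type*} (s : Finset κ) (hB : 0 ≤ B) (q : κ → MvPolynomial (Fin n) ℝ)
    (h : ∀ i ∈ s, HasSoS P k B (q i)) : HasSoS P k (s.card * B) (∑ i ∈ s, q i) := by
  classical
  induction s using Finset.induction_on with
  | empty => simpa using HasSoS.zero le_rfl
  | insert a s ha ih =>
    rw [Finset.sum_insert ha, Finset.card_insert_of_notMem ha]
    refine (HasSoS.add hB (by positivity) (h a (Finset.mem_insert_self _ _))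
      (ih fun i hi => h i (Finset.mem_insert_of_mem hi))).mono le_rfl ?_
    push_cast
    linarith

theorem HasSoS.smul {c M : ℝ} (hc : 0 ≤ c) (hcM : c ≤ M) (hM : 1 ≤ M)
    (h : HasSoS P k B r) : HasSoS P k (M * B) (C c * r) := by
  obtain ⟨⟨t, s, g, e⟩, h1, h2, h3⟩ := h
  have hsq : √c ≤ M := by
    rw [Real.sqrt_le_left (by linarith)]
    nlinarith
  refine ⟨⟨t, fun i => C (√c) * s i, fun j => C c * g j, ?_⟩, ⟨?_, ?_⟩, ?_, ?_⟩
  · simp only [mul_pow, ← C_pow, Real.sq_sqrt hc, mul_assoc]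
    rw [← Finset.mul_sum, ← Finset.mul_sum, ← mul_add, ← e]
  · intro i
    simp only [mul_pow, ← C_pow]
    refine (totalDegree_mul _ _).trans ?_
    rw [totalDegree_C, zero_add]
    exact h1.1 i
  · intro j
    simp only [mul_assoc]
    refine (totalDegree_mul _ _).trans ?_
    rw [totalDegree_C, zero_add]
    exact h1.2 j
  · intro i
    rw [l1_C_mul, abs_of_nonneg (Real.sqrt_nonneg _)]
    exact mul_le_mul hsq (h2 i) (l1_nonneg _) (by linarith)
  · intro j
    rw [l1_C_mul, abs_of_nonneg hc]
    exact mul_le_mul hcM (h3 j) (l1_nonneg _) (by linarith)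

theorem HasSoS.sq {s : MvPolynomial (Fin n) ℝ} (hs : 2 * s.totalDegree ≤ k) (hB : l1 s ≤ B) :
    HasSoS P k B (s ^ 2) := by
  refine ⟨⟨1, fun _ => s, fun _ => 0, by simp⟩, ⟨fun _ => (totalDegree_pow _ _).trans hs, by simp⟩,
    fun _ => hB, fun _ => ?_⟩
  rw [l1_zero]
  exact (l1_nonneg s).trans hB

theorem HasSoS.mul_input (j : ι) {g : MvPolynomial (Fin n) ℝ}
    (hg : (g * toReal (P j)).totalDegree ≤ k) (hB : l1 g ≤ B) :
    HasSoS P k B (g * toReal (P j)) := by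
  classical
  have hB0 : 0 ≤ B := (l1_nonneg g).trans hB
  refine ⟨⟨0, Fin.elim0, Pi.single j g, ?_⟩, ⟨fun i => i.elim0, fun i => ?_⟩, fun i => i.elim0,
    fun i => ?_⟩
  · rw [Finset.sum_eq_single j]
    · simp
    · intro i _ hi
      simp [Pi.single_eq_of_ne hi]
    · simp
  · rcases eq_or_ne i j with rfl | hi
    · simpa using hg
    · simp [Pi.single_eq_of_ne hi]
  · rcases eq_or_ne i j with rfl | hi
    · simpa using hB
    · simpa [Pi.single_eq_of_ne hi] using hB0

theorem HasSoS.const {c : ℝ} (hc : 0 ≤ c) (hcB : 1 + c ≤ B) : HasSoS P k B (C c) := by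
  have : C c = (C (√c) : MvPolynomial (Fin n) ℝ) ^ 2 := by rw [← C_pow, Real.sq_sqrt hc]
  rw [this]
  refine HasSoS.sq (by simp) ?_
  rw [l1_C, abs_of_nonneg (Real.sqrt_nonneg _)]
  refine le_trans ?_ hcB
  rw [Real.sqrt_le_left (by linarith)]
  nlinarith

end SoS

/-! ### Indicator polynomials of one variable -/

section Indicator

/-- The univariate polynomial that is `1` on `A` and `0` on the rest of `D`. -/
def indicatorPoly (D A : Finset ℚ) : Polynomial ℚ :=
  Lagrange.interpolate D id fun ρ => if ρ ∈ A then 1 else 0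

theorem eval_indicatorPoly {D : Finset ℚ} (A : Finset ℚ) {ρ : ℚ} (hρ : ρ ∈ D) :
    (indicatorPoly D A).eval ρ = if ρ ∈ A then 1 else 0 :=
  Lagrange.eval_interpolate_at_node (v := id) _ (Set.injOn_id _) hρ

theorem natDegree_indicatorPoly_le (D A : Finset ℚ) : (indicatorPoly D A).natDegree ≤ D.card := by
  have := Lagrange.degree_interpolate_lt (F := ℚ) (s := D) (v := id)
    (fun ρ => if ρ ∈ A then 1 else 0) (Set.injOn_id _)
  exact Polynomial.natDegree_le_of_degree_le this.le

variable {n : ℕ}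

/-- The indicator of `x_i ∈ A`, for points in `D`. -/
def indicator (D A : Finset ℚ) (i : Fin n) : MvPolynomial (Fin n) ℚ :=
  Polynomial.aeval (X i) (indicatorPoly D A)

theorem eval_aeval_X (q : Polynomial ℚ) (i : Fin n) (x : Fin n → ℚ) :
    eval x (Polynomial.aeval (X i : MvPolynomial (Fin n) ℚ) q) = q.eval (x i) := by
  rw [Polynomial.aeval_eq_sum_range, map_sum, Polynomial.eval_eq_sum_range]
  exact Finset.sum_congr rfl fun e _ => by simp [smul_eval]

theorem totalDegree_aeval_X_le (q : Polynomial ℚ) (i : Fin n) :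
    (Polynomial.aeval (X i : MvPolynomial (Fin n) ℚ) q).totalDegree ≤ q.natDegree := by
  rw [Polynomial.aeval_eq_sum_range]
  refine totalDegree_finsetSum_le fun e he => (totalDegree_smul_le _ _).trans ?_
  rw [totalDegree_X_pow]
  exact Nat.lt_succ_iff.1 (Finset.mem_range.1 he)

/-- The sum of the absolute values of the coefficients of a univariate polynomial. -/
def polyNorm (q : Polynomial ℚ) : ℚ := ∑ e ∈ Finset.range (q.natDegree + 1), |q.coeff e|

theorem l1_aeval_X_le (q : Polynomial ℚ) (i : Fin n) :
    l1 (toReal (Polynomial.aeval (X i : MvPolynomial (Fin n) ℚ) q)) ≤ polyNorm q := by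
  rw [Polynomial.aeval_eq_sum_range, toReal_sum, polyNorm, Rat.cast_sum]
  refine (l1_sum_le _ _).trans (Finset.sum_le_sum fun e _ => ?_)
  rw [smul_eq_C_mul, toReal_mul, toReal_C, l1_C_mul, Rat.cast_abs]
  refine mul_le_of_le_one_right (abs_nonneg _) ?_
  rw [toReal, map_pow, map_X]
  exact (l1_pow_le _ _).trans (by simp)

theorem eval_indicator {D : Finset ℚ} (A : Finset ℚ) (i : Fin n) {x : Fin n → ℚ} (hx : x i ∈ D) :
    eval x (indicator D A i) = if x i ∈ A then 1 else 0 := by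
  rw [indicator, eval_aeval_X, eval_indicatorPoly A hx]

theorem totalDegree_indicator_le (D A : Finset ℚ) (i : Fin n) :
    (indicator D A i).totalDegree ≤ D.card :=
  (totalDegree_aeval_X_le _ _).trans (natDegree_indicatorPoly_le D A)

theorem domainPoly_eq_aeval (D : Finset ℚ) (i : Fin n) :
    domainPoly D i = Polynomial.aeval (X i) (∏ ρ ∈ D, (Polynomial.X - Polynomial.C ρ)) := by
  rw [domainPoly, map_prod]
  exact Finset.prod_congr rfl fun ρ _ => by simp [algebraMap_eq]

theorem totalDegree_domainPoly_le (D : Finset ℚ) (i : Fin n) :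
    (domainPoly D i).totalDegree ≤ D.card := by
  rw [domainPoly_eq_aeval]
  refine (totalDegree_aeval_X_le _ _).trans ?_
  rw [Polynomial.natDegree_prod_of_monic _ _ fun ρ _ => Polynomial.monic_X_sub_C ρ]
  simp

theorem eval_domainPoly_eq_zero {D : Finset ℚ} (i : Fin n) {x : Fin n → ℚ} :
    eval x (domainPoly D i) = 0 ↔ x i ∈ D := by
  rw [domainPoly, map_prod, Finset.prod_eq_zero_iff]
  constructor
  · rintro ⟨ρ, hρ, h⟩
    have : x i = ρ := by simpa [sub_eq_zero] using h
    rwa [this]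
  · intro h
    exact ⟨x i, h, by simp⟩

end Indicator

/-! ### Squares of derivable polynomials -/

section NegSq

variable {n : ℕ} {ι : Type} [Fintype ι]

/-- An upper bound for `1` and the squares of the elements of `D`. -/
def domainSq (D : Finset ℚ) : ℚ := 1 + ∑ ρ ∈ D, ρ ^ 2

theorem sq_le_domainSq {D : Finset ℚ} {ρ : ℚ} (hρ : ρ ∈ D) : ρ ^ 2 ≤ domainSq D := by
  have := Finset.single_le_sum (f := fun ρ : ℚ => ρ ^ 2) (fun _ _ => sq_nonneg _) hρ
  rw [domainSq]
  linarith

theorem one_le_domainSq (D : Finset ℚ) : 1 ≤ domainSq D := by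
  rw [domainSq]
  have := Finset.sum_nonneg (s := D) (f := fun ρ : ℚ => ρ ^ 2) fun _ _ => sq_nonneg _
  linarith

/-- On the domain, `c - x ^ 2` is a sum of squares up to a multiple of the domain polynomial. -/
theorem exists_univariate_sos (D : Finset ℚ) : ∃ q : Polynomial ℚ,
    Polynomial.C (domainSq D) - Polynomial.X ^ 2 =
      ∑ ρ ∈ D, Polynomial.C (domainSq D - ρ ^ 2) * indicatorPoly D {ρ} ^ 2 +
        q * ∏ ρ ∈ D, (Polynomial.X - Polynomial.C ρ) := by
  -- At each `ρ` in `D` both `c - X ^ 2` and the sum take the value `c - ρ ^ 2`, so the pairwise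
  -- coprime linear factors all divide the difference.
  have hdvd : ∏ ρ ∈ D, (Polynomial.X - Polynomial.C ρ) ∣
      Polynomial.C (domainSq D) - Polynomial.X ^ 2 -
        ∑ ρ ∈ D, Polynomial.C (domainSq D - ρ ^ 2) * indicatorPoly D {ρ} ^ 2 := by
    refine Finset.prod_dvd_of_coprime ?_ ?_
    · intro a _ b _ hab
      exact Polynomial.isCoprime_X_sub_C_of_isUnit_sub (sub_ne_zero.2 hab).isUnit
    · intro ρ hρ
      rw [Polynomial.dvd_iff_isRoot, Polynomial.IsRoot]
      rw [Polynomial.eval_sub, Polynomial.eval_finsetSum, Finset.sum_eq_single ρ]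
      · simp [eval_indicatorPoly _ hρ]
      · intro σ _ hσ
        simp [eval_indicatorPoly _ hρ, hσ.symm]
      · exact fun h => absurd hρ h
  obtain ⟨q, hq⟩ := hdvd
  exact ⟨q, by rw [mul_comm q, ← hq]; ring⟩

/-- The constant in the bound for the multiplication rule. -/
theorem exists_mul_rule_constants (D : Finset ℚ) : ∃ K : ℕ, ∀ (n : ℕ) (ι : Type) [Fintype ι]
    (f : ι → MvPolynomial (Fin n) ℚ) (i : Fin n) (k : ℕ) (B : ℝ) (p : MvPolynomial (Fin n) ℝ),
    p.totalDegree ≤ k → l1 p ≤ B → 1 ≤ B →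
      HasSoS (domainSystem D f) (2 * k + K) (2 ^ K * B ^ 2)
        (p ^ 2 * (C (domainSq D : ℝ) - X i ^ 2)) := by
  obtain ⟨q, hq⟩ := exists_univariate_sos D
  set c := domainSq D with hc
  obtain ⟨M, hM⟩ := exists_nat_ge (max (polyNorm q) (∑ ρ ∈ D,
    c * (1 + polyNorm (indicatorPoly D {ρ}))))
  have hM1 := (le_max_left _ _).trans hM
  have hM2 := (le_max_right _ _).trans hM
  have hnn : ∀ q, 0 ≤ polyNorm q := fun q => Finset.sum_nonneg fun _ _ => abs_nonneg _
  refine ⟨2 * D.card + q.natDegree + 2 * M + D.card + 1, ?_⟩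
  intro n ι _ f i k B p hpk hpB hB
  set K := 2 * D.card + q.natDegree + 2 * M + D.card + 1 with hK
  have hid : (C (c : ℝ) - X i ^ 2 : MvPolynomial (Fin n) ℝ) =
      ∑ ρ ∈ D, C ((c - ρ ^ 2 : ℚ) : ℝ) * toReal (indicator D {ρ} i) ^ 2 +
        toReal (Polynomial.aeval (X i) q) * toReal (domainPoly D i) := by
    have := congrArg (fun g => toReal (Polynomial.aeval (X i : MvPolynomial (Fin n) ℚ) g)) hq
    simp only [map_add, map_sub, map_mul, map_sum, map_pow, Polynomial.aeval_C, Polynomial.aeval_X,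
      algebraMap_eq, ← domainPoly_eq_aeval] at this
    simpa [toReal, indicator] using this
  have hpow : (M : ℝ) ≤ 2 ^ M := by exact_mod_cast Nat.lt_two_pow_self.le
  have hpowD : (D.card : ℝ) ≤ 2 ^ D.card := by exact_mod_cast Nat.lt_two_pow_self.le
  have hc1 : (1 : ℝ) ≤ c := by exact_mod_cast one_le_domainSq D
  have hB2 : B ≤ B ^ 2 := by nlinarith
  have hterm : ∀ ρ ∈ D, HasSoS (domainSystem D f) (2 * k + K) (2 ^ (2 * M) * B ^ 2)
      (p ^ 2 * (C ((c - ρ ^ 2 : ℚ) : ℝ) * toReal (indicator D {ρ} i) ^ 2)) := by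
    intro ρ hρ
    have h0 : (0 : ℝ) ≤ ((c - ρ ^ 2 : ℚ) : ℝ) := by
      exact_mod_cast sub_nonneg.2 (sq_le_domainSq hρ)
    have h1 : ((c - ρ ^ 2 : ℚ) : ℝ) ≤ c := by
      exact_mod_cast sub_le_self _ (sq_nonneg _)
    have hsum : c * (1 + polyNorm (indicatorPoly D {ρ})) ≤ M := by
      refine le_trans ?_ hM2
      exact Finset.single_le_sum (f := fun ρ => c * (1 + polyNorm (indicatorPoly D {ρ})))
        (fun σ _ => mul_nonneg (zero_le_one.trans (one_le_domainSq D)) (by have := hnn (indicatorPoly D {σ}); linarith)) hρ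
    have hsum' : (c : ℝ) * (1 + (polyNorm (indicatorPoly D {ρ}) : ℝ)) ≤ M := by exact_mod_cast hsum
    have hnn' : (0 : ℝ) ≤ (polyNorm (indicatorPoly D {ρ}) : ℝ) := by exact_mod_cast hnn _
    have hcM : (c : ℝ) ≤ 2 ^ M := by nlinarith
    have hNM : (polyNorm (indicatorPoly D {ρ}) : ℝ) ≤ 2 ^ M := by nlinarith
    have hsq : HasSoS (domainSystem D f) (2 * k + K) (2 ^ M * B ^ 2)
        ((p * toReal (indicator D {ρ} i)) ^ 2) := by
      refine HasSoS.sq ?_ ?_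
      · have h2 := totalDegree_mul p (toReal (indicator D {ρ} i))
        have h3 := totalDegree_indicator_le D {ρ} i
        rw [totalDegree_toReal] at h2
        omega
      · refine (l1_mul_le _ _).trans ?_
        rw [mul_comm]
        refine mul_le_mul ((l1_aeval_X_le _ _).trans hNM) (hpB.trans hB2) (l1_nonneg _)
          (by positivity)
    have := hsq.smul h0 (h1.trans hcM) (one_le_pow₀ (by norm_num))
    rw [show p ^ 2 * (C ((c - ρ ^ 2 : ℚ) : ℝ) * toReal (indicator D {ρ} i) ^ 2) =
      C ((c - ρ ^ 2 : ℚ) : ℝ) * (p * toReal (indicator D {ρ} i)) ^ 2 by ring]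
    refine this.mono le_rfl ?_
    rw [← mul_assoc, ← pow_add, two_mul]
  have hdom : HasSoS (domainSystem D f) (2 * k + K) (2 ^ (2 * M) * B ^ 2)
      (p ^ 2 * toReal (Polynomial.aeval (X i) q) * toReal (domainPoly D i)) := by
    refine HasSoS.mul_input (P := domainSystem D f) (Sum.inr i) ?_ ?_
    · refine (totalDegree_mul _ _).trans ?_
      have h1 := totalDegree_mul (p ^ 2) (toReal (Polynomial.aeval (X i) q))
      have h2 := totalDegree_pow p 2
      have h3 := totalDegree_aeval_X_le q i
      have h4 := totalDegree_domainPoly_le D i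
      have h5 : (toReal (domainSystem D f (Sum.inr i))).totalDegree ≤ D.card := by
        rw [totalDegree_toReal]; exact h4
      rw [totalDegree_toReal] at h1
      omega
    · refine (l1_mul_le _ _).trans ?_
      have h1 : l1 (p ^ 2) ≤ B ^ 2 := (l1_pow_le _ _).trans (pow_le_pow_left₀ (l1_nonneg _) hpB 2)
      have h2 : l1 (toReal (Polynomial.aeval (X i) q)) ≤ 2 ^ (2 * M) := by
        refine (l1_aeval_X_le q i).trans ?_
        have : (polyNorm q : ℝ) ≤ M := by exact_mod_cast hM1
        refine this.trans (hpow.trans (pow_le_pow_right₀ (by norm_num) (by omega)))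
      rw [mul_comm]
      exact mul_le_mul h2 h1 (l1_nonneg _) (by positivity)
  have hall := (HasSoS.sum D (by positivity) _ hterm).add (by positivity) (by positivity) hdom
  have hfin : p ^ 2 * (C (c : ℝ) - X i ^ 2) =
      ∑ ρ ∈ D, p ^ 2 * (C ((c - ρ ^ 2 : ℚ) : ℝ) * toReal (indicator D {ρ} i) ^ 2) +
        p ^ 2 * toReal (Polynomial.aeval (X i) q) * toReal (domainPoly D i) := by
    rw [hid, mul_add, Finset.mul_sum, mul_assoc]
  rw [hfin]
  refine hall.mono le_rfl ?_
  have h1 : (D.card : ℝ) * (2 ^ (2 * M) * B ^ 2) + 2 ^ (2 * M) * B ^ 2 =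
      ((D.card : ℝ) + 1) * 2 ^ (2 * M) * B ^ 2 := by ring
  rw [h1]
  have h2 : ((D.card : ℝ) + 1) ≤ 2 ^ (D.card + 1) := by
    rw [pow_succ]
    have : (1 : ℝ) ≤ 2 ^ D.card := one_le_pow₀ (by norm_num)
    linarith
  calc ((D.card : ℝ) + 1) * 2 ^ (2 * M) * B ^ 2 ≤ 2 ^ (D.card + 1) * 2 ^ (2 * M) * B ^ 2 := by
        gcongr
    _ = 2 ^ (D.card + 1 + 2 * M) * B ^ 2 := by rw [← pow_add]
    _ ≤ 2 ^ K * B ^ 2 := by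
        gcongr
        · norm_num
        · omega

/-- A bound, per line, for sum-of-squares proofs of `-p ^ 2 ≥ 0` for the lines `p` of a bounded
derivation. -/
theorem exists_negSq_constant (D : Finset ℚ) : ∃ K : ℕ, ∀ (n : ℕ) (ι : Type) [Fintype ι]
    (f : ι → MvPolynomial (Fin n) ℚ) (k h : ℕ) (L : List (MvPolynomial (Fin n) ℚ)),
    IsBoundedDerivation (domainSystem D f) k h ∅ L → ∀ p ∈ L,
      HasSoS (domainSystem D f) (2 * k + K) (2 ^ ((K + 2 * h) * L.length)) (-(toReal p) ^ 2) := by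
  obtain ⟨K₀, hK₀⟩ := exists_mul_rule_constants D
  obtain ⟨M, hM⟩ := exists_nat_ge (domainSq D)
  refine ⟨K₀ + M + 5, ?_⟩
  intro n ι _ f k h L hL
  set K := K₀ + M + 5 with hK
  induction hL with
  | nil => simp
  | @step L r hL hr hs ih =>
    -- Each line costs a factor `2 ^ (K + 2 * h)`. The bound concerns single polynomials in the
    -- proof, not the number of squares, so using a line repeatedly does no harm and the exponent
    -- stays linear in the length.
    set e := (K + 2 * h) * L.length with he
    have hlen : (K + 2 * h) * (r :: L).length = e + (K + 2 * h) := by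
      rw [List.length_cons, mul_add, mul_one]
    have hone : (1 : ℝ) ≤ 2 ^ e := one_le_pow₀ (by norm_num)
    intro p hp
    rw [hlen]
    rcases List.mem_cons.1 hp with rfl | hp
    swap
    · exact (ih p hp).mono le_rfl (pow_le_pow_right₀ (by norm_num) (by omega))
    rcases hs with ⟨j, hj⟩ | ⟨p₁, hp₁, p₂, hp₂, a, b, ha, hb, rfl⟩ | ⟨p₁, hp₁, i, rfl⟩
    · have : -(toReal p) ^ 2 = (-toReal p) * toReal (domainSystem D f j) := by rw [← hj]; ring
      rw [this]
      refine HasSoS.mul_input j ?_ ?_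
      · refine (totalDegree_mul _ _).trans ?_
        rw [totalDegree_neg, ← hj, totalDegree_toReal]
        have := hr.1
        omega
      · rw [l1_neg]
        exact hr.2.2.trans (pow_le_pow_right₀ (by norm_num) (by omega))
    · replace hp₁ : p₁ ∈ L := by simpa using hp₁
      replace hp₂ : p₂ ∈ L := by simpa using hp₂
      have ha' : |(a : ℝ)| ≤ 2 ^ h := by exact_mod_cast ha
      have hb' : |(b : ℝ)| ≤ 2 ^ h := by exact_mod_cast hb
      have hsc : ∀ c : ℝ, |c| ≤ 2 ^ h → 2 * c ^ 2 ≤ 2 ^ (2 * h + 1) := by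
        intro c hc
        have : c ^ 2 ≤ (2 ^ h) ^ 2 := by
          rw [← sq_abs]
          exact pow_le_pow_left₀ (abs_nonneg _) hc 2
        rw [pow_succ _ (2 * h), mul_comm 2 h, pow_mul]
        linarith
      have h1 := (ih p₁ hp₁).smul (c := 2 * (a : ℝ) ^ 2) (by positivity) (hsc _ ha')
        (one_le_pow₀ (by norm_num))
      have h2 := (ih p₂ hp₂).smul (c := 2 * (b : ℝ) ^ 2) (by positivity) (hsc _ hb')
        (one_le_pow₀ (by norm_num))
      have h3 : HasSoS (domainSystem D f) (2 * k + K) (2 ^ (2 * h + 1))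
          ((C (a : ℝ) * toReal p₁ - C (b : ℝ) * toReal p₂) ^ 2) := by
        refine HasSoS.sq ?_ ?_
        · have h4 := totalDegree_sub (C (a : ℝ) * toReal p₁) (C (b : ℝ) * toReal p₂)
          have h5 := totalDegree_mul (C (a : ℝ)) (toReal p₁)
          have h6 := totalDegree_mul (C (b : ℝ)) (toReal p₂)
          have h7 := (hL.line _ hp₁).1
          have h8 := (hL.line _ hp₂).1
          rw [totalDegree_C, totalDegree_toReal] at h5 h6
          have : (C (a : ℝ) * toReal p₁ - C (b : ℝ) * toReal p₂).totalDegree ≤ k :=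
            h4.trans (max_le (by omega) (by omega))
          omega
        · refine (l1_sub_le _ _).trans ?_
          rw [l1_C_mul, l1_C_mul]
          have h7 := (hL.line _ hp₁).2.2
          have h8 := (hL.line _ hp₂).2.2
          have h9 := mul_le_mul ha' h7 (l1_nonneg _) (by positivity)
          have h10 := mul_le_mul hb' h8 (l1_nonneg _) (by positivity)
          rw [pow_succ, two_mul, pow_add]
          linarith
      have h4 := (h1.add (by positivity) (by positivity) h2).add (by positivity) (by positivity) h3
      -- This is the parallelogram law for `a p₁` and `b p₂`.
      have hid : -(toReal (C a * p₁ + C b * p₂)) ^ 2 =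
          C (2 * (a : ℝ) ^ 2) * -(toReal p₁) ^ 2 + C (2 * (b : ℝ) ^ 2) * -(toReal p₂) ^ 2 +
            (C (a : ℝ) * toReal p₁ - C (b : ℝ) * toReal p₂) ^ 2 := by
        simp only [toReal_add, toReal_mul, toReal_C, C_mul, C_pow]
        rw [show (C (2 : ℝ) : MvPolynomial (Fin n) ℝ) = 2 from map_ofNat C 2]
        ring
      rw [hid]
      refine h4.mono le_rfl ?_
      have h5 : (2 : ℝ) ^ (2 * h + 1) ≤ 2 ^ (2 * h + 1) * 2 ^ e :=
        le_mul_of_one_le_right (by positivity) hone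
      calc _ ≤ (4 : ℝ) * (2 ^ (2 * h + 1) * 2 ^ e) := by
            have : (0 : ℝ) < 2 ^ (2 * h + 1) * 2 ^ e := by positivity
            linarith
        _ = 2 ^ (2 + (2 * h + 1) + e) := by rw [pow_add, pow_add]; norm_num; ring
        _ ≤ 2 ^ (e + (K + 2 * h)) := pow_le_pow_right₀ (by norm_num) (by omega)
    · replace hp₁ : p₁ ∈ L := by simpa using hp₁
      have hl := hL.line _ hp₁
      have hc0 : (1 : ℝ) ≤ (domainSq D : ℝ) := by exact_mod_cast one_le_domainSq D
      have hcM : (domainSq D : ℝ) ≤ 2 ^ M := by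
        have h1 : (domainSq D : ℝ) ≤ M := by exact_mod_cast hM
        exact h1.trans (by exact_mod_cast Nat.lt_two_pow_self.le)
      have h1 := (ih p₁ hp₁).smul (zero_le_one.trans hc0) hcM (one_le_pow₀ (by norm_num))
      have h2 := (hK₀ n ι f i k (2 ^ h) (toReal p₁) (by rw [totalDegree_toReal]; exact hl.1)
        hl.2.2 (one_le_pow₀ (by norm_num))).mono (k' := 2 * k + K) (by omega) le_rfl
      have h3 := h1.add (by positivity) (by positivity) h2
      -- On the domain `x_i ^ 2` is at most `domainSq D`, and the multiplication rule supplies the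
      -- proof that `p₁ ^ 2` times the difference is nonnegative.
      have hid : -(toReal (X i * p₁)) ^ 2 = C (domainSq D : ℝ) * -(toReal p₁) ^ 2 +
          toReal p₁ ^ 2 * (C (domainSq D : ℝ) - X i ^ 2) := by
        simp only [toReal_mul, toReal_X]
        ring
      rw [hid]
      refine h3.mono le_rfl ?_
      have h4 : (2 : ℝ) ^ M * 2 ^ e ≤ 2 ^ (K₀ + M + 2 * h + e) := by
        rw [← pow_add]
        exact pow_le_pow_right₀ (by norm_num) (by omega)
      have h5 : (2 : ℝ) ^ K₀ * (2 ^ h) ^ 2 ≤ 2 ^ (K₀ + M + 2 * h + e) := by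
        rw [← pow_mul, ← pow_add]
        exact pow_le_pow_right₀ (by norm_num) (by omega)
      calc _ ≤ (2 : ℝ) * 2 ^ (K₀ + M + 2 * h + e) := by linarith
        _ = 2 ^ (K₀ + M + 2 * h + e + 1) := by rw [pow_succ, mul_comm]
        _ ≤ 2 ^ (e + (K + 2 * h)) := pow_le_pow_right₀ (by norm_num) (by omega)

end NegSq

end PCSoS

end

noncomputable section

namespace PCSoS

open MvPolynomial

/-! ### Membership in levels -/

section LevelMembership

variable {n : ℕ} {ι : Type} {D : Finset ℚ} {k b : ℕ}

theorem mul_input_mem_level {P : ι → MvPolynomial (Fin n) ℚ} (j : ι) {q : MvPolynomial (Fin n) ℚ}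
    (hq : q.totalDegree + (P j).totalDegree ≤ k) (i : ℕ) : q * P j ∈ level P k b i := by
  refine level_mono (Nat.zero_le i) ?_
  rw [q.as_sum, Finset.sum_mul]
  refine sum_mem fun m hm => ?_
  have : monomial m (q.coeff m) * P j = q.coeff m • (monomial m 1 * P j) := by
    rw [← smul_mul_assoc, smul_monomial, smul_eq_mul, mul_one]
  rw [this]
  refine Submodule.smul_mem _ _ (Submodule.subset_span ⟨j, m, ?_, rfl⟩)
  have := degree_le_totalDegree hm
  omega

/-- A round multiplies only bounded integral polynomials, and only by monomials. One scalar multiple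
of `c` of that kind is enough: by linearity every multiplier `q` of suitable degree becomes
available. -/
theorem mul_mem_level {P : ι → MvPolynomial (Fin n) ℚ} {i : ℕ} {c q : MvPolynomial (Fin n) ℚ}
    (hc : c ∈ level P k b i) {z : ℚ} (hz : z ≠ 0) (hzc : C z * c ∈ boundedIntegral n k b)
    (hq : q.totalDegree + c.totalDegree ≤ k) : q * c ∈ level P k b (i + 1) := by
  have hdeg : (C z * c).totalDegree ≤ c.totalDegree := by
    refine (totalDegree_mul _ _).trans ?_
    rw [totalDegree_C, zero_add]
  rw [q.as_sum, Finset.sum_mul]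
  refine sum_mem fun m hm => ?_
  have : monomial m (q.coeff m) * c = (q.coeff m * z⁻¹) • (monomial m 1 * (C z * c)) := by
    have h1 : monomial m (q.coeff m) = C (q.coeff m) * monomial m 1 := by
      rw [C_mul_monomial, mul_one]
    rw [smul_eq_C_mul, h1, C_mul]
    have h2 : (C z⁻¹ * C z : MvPolynomial (Fin n) ℚ) = 1 := by
      rw [← C_mul, inv_mul_cancel₀ hz, C_1]
    linear_combination (-(C (q.coeff m) * monomial m 1 * c)) * h2
  rw [this, level]
  refine Submodule.smul_mem _ _ (Submodule.mem_sup_right (Submodule.subset_span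
    ⟨C z * c, ?_, hzc, m, ?_, rfl⟩))
  · rw [← smul_eq_C_mul]
    exact Submodule.smul_mem _ _ hc
  · have := degree_le_totalDegree hm
    omega

/-- By the Combinatorial Nullstellensatz such a polynomial is a combination of domain polynomials in
which no product exceeds its degree. -/
theorem mem_level_of_vanishes {f : ι → MvPolynomial (Fin n) ℚ} (hD : D.Nonempty)
    {p : MvPolynomial (Fin n) ℚ} (hk : p.totalDegree ≤ k)
    (hp : ∀ x : Fin n → ℚ, (∀ i, x i ∈ D) → eval x p = 0) (i : ℕ) :
    p ∈ level (domainSystem D f) k b i := by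
  obtain ⟨g, hg, hpg⟩ := combinatorial_nullstellensatz_exists_linearCombination
    (fun _ => D) (fun _ => hD) p hp
  rw [hpg, Finsupp.linearCombination_apply, Finsupp.sum]
  refine sum_mem fun l _ => ?_
  rw [smul_eq_mul]
  by_cases h0 : g l = 0
  · rw [h0, zero_mul]
    exact zero_mem _
  refine mul_input_mem_level (P := domainSystem D f) (Sum.inr l) ?_ i
  have h1 : domainPoly D l ≠ 0 := by
    rw [domainPoly, Finset.prod_ne_zero_iff]
    intro ρ _ h
    have := congrArg (eval fun _ => ρ + 1) h
    simp at this
  have h2 := hg l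
  change (domainPoly D l * g l).totalDegree ≤ _ at h2
  rw [totalDegree_mul_of_isDomain h1 h0] at h2
  change (g l).totalDegree + (domainPoly D l).totalDegree ≤ k
  omega

/-- Within the degree bound, derivability depends only on the function on `D ^ n`. The later
arguments therefore check identities pointwise. -/
theorem mem_level_congr {f : ι → MvPolynomial (Fin n) ℚ} (hD : D.Nonempty) {i : ℕ}
    {p q : MvPolynomial (Fin n) ℚ} (hp : p.totalDegree ≤ k) (hq : q.totalDegree ≤ k)
    (h : ∀ x : Fin n → ℚ, (∀ i, x i ∈ D) → eval x p = eval x q)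
    (hmem : p ∈ level (domainSystem D f) k b i) : q ∈ level (domainSystem D f) k b i := by
  have : q - p ∈ level (domainSystem D f) k b i := by
    refine mem_level_of_vanishes hD ((totalDegree_sub _ _).trans (max_le hq hp)) ?_ i
    intro x hx
    rw [map_sub, h x hx, sub_self]
  simpa using add_mem this hmem

theorem eval_eq_of_forall_vars {p : MvPolynomial (Fin n) ℚ} {x y : Fin n → ℚ}
    (h : ∀ i ∈ p.vars, x i = y i) : eval x p = eval y p :=
  eval₂Hom_congr' rfl (fun i hi _ => h i hi) rfl

/-- A polynomial in few variables has a low-degree inverse on the domain. -/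
theorem exists_inverse (D : Finset ℚ) (p : MvPolynomial (Fin n) ℚ) :
    ∃ e : MvPolynomial (Fin n) ℚ, e.totalDegree ≤ p.vars.card * D.card ∧
      ∀ x : Fin n → ℚ, (∀ i, x i ∈ D) → eval x e = (eval x p)⁻¹ := by
  classical
  let ext : (p.vars → ℚ) → Fin n → ℚ := fun t i => if h : i ∈ p.vars then t ⟨i, h⟩ else 0
  refine ⟨∑ t ∈ Fintype.piFinset fun _ : p.vars => D,
    C (eval (ext t) p)⁻¹ * ∏ i : p.vars, indicator D {t i} (i : Fin n), ?_, ?_⟩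
  · refine totalDegree_finsetSum_le fun t _ => (totalDegree_mul _ _).trans ?_
    rw [totalDegree_C, zero_add]
    refine (totalDegree_finsetProd _ _).trans ?_
    refine (Finset.sum_le_card_nsmul _ _ D.card fun i _ => totalDegree_indicator_le D _ _).trans ?_
    simp
  · intro x hx
    have hev : ∀ t : p.vars → ℚ, eval x (∏ i : p.vars, indicator D {t i} (i : Fin n)) =
        if (fun i : p.vars => x i) = t then 1 else 0 := by
      intro t
      rw [map_prod]
      simp only [eval_indicator _ _ (hx _), Finset.mem_singleton]
      rw [Finset.prod_ite_zero]
      simp [funext_iff]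
    simp only [map_sum, map_mul, eval_C, hev, mul_ite, mul_one, mul_zero]
    rw [Finset.sum_ite_eq, if_pos (Fintype.mem_piFinset.2 fun i : p.vars => hx i)]
    congr 1
    refine eval_eq_of_forall_vars fun i hi => ?_
    simp [ext, hi]

/-- With `e` inverse to `f j` where `f j` does not vanish, `q` and `q * e * f j` agree on `D ^ n`:
where `f j` vanishes, so does `q`. The degree of `e` is bounded because `f j` has few variables. -/
theorem mem_level_of_input {f : ι → MvPolynomial (Fin n) ℚ} (hD : D.Nonempty) (j : ι) {r Δ : ℕ}
    (hr : (f j).vars.card ≤ r) (hΔ : (f j).totalDegree ≤ Δ) {q : MvPolynomial (Fin n) ℚ}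
    (hk : q.totalDegree + r * D.card + Δ ≤ k)
    (hq : ∀ x : Fin n → ℚ, (∀ i, x i ∈ D) → eval x (f j) = 0 → eval x q = 0) (i : ℕ) :
    q ∈ level (domainSystem D f) k b i := by
  obtain ⟨e, he, hev⟩ := exists_inverse D (f j)
  have hed : e.totalDegree ≤ r * D.card := he.trans (Nat.mul_le_mul_right _ hr)
  have h1 := totalDegree_mul q e
  have h2 := totalDegree_mul (q * e) (f j)
  refine mem_level_congr hD (p := q * e * f j) (by omega) (by omega) ?_
    (mul_input_mem_level (P := domainSystem D f) (Sum.inl j) ?_ i)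
  · intro x hx
    rw [map_mul, map_mul, hev x hx]
    by_cases h0 : eval x (f j) = 0
    · rw [hq x hx h0]
      simp
    · rw [mul_assoc, inv_mul_cancel₀ h0, mul_one]
  · change (q * e).totalDegree + (f j).totalDegree ≤ k
    omega

theorem level_comp_le {κ : Type} {P : ι → MvPolynomial (Fin n) ℚ} {P' : κ → MvPolynomial (Fin n) ℚ}
    (h : ∀ j, ∃ j', P' j = P j') (i : ℕ) : level P' k b i ≤ level P k b i := by
  induction i with
  | zero =>
    rw [level, level]
    refine Submodule.span_mono ?_
    rintro q ⟨j, m, hm, rfl⟩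
    obtain ⟨j', hj'⟩ := h j
    exact ⟨j', m, hj' ▸ hm, by rw [hj']⟩
  | succ i ih =>
    rw [level, level]
    refine sup_le_sup ih (Submodule.span_mono ?_)
    rintro q ⟨c, hc, hcb, m, hm, rfl⟩
    exact ⟨c, ih hc, hcb, m, hm, rfl⟩

end LevelMembership

/-! ### Clearing the denominators of indicators -/

theorem exists_natCast_mul_integral (q : Polynomial ℚ) :
    ∃ Z : ℕ, Z ≠ 0 ∧ ∀ e, ∃ z : ℤ, (Z : ℚ) * q.coeff e = z := by
  refine ⟨∏ e ∈ q.support, (q.coeff e).den, Finset.prod_ne_zero_iff.2 fun e _ => (q.coeff e).den_nz,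
    fun e => ?_⟩
  by_cases he : e ∈ q.support
  · refine ⟨(∏ e' ∈ q.support.erase e, ((q.coeff e').den : ℤ)) * (q.coeff e).num, ?_⟩
    rw [← Finset.mul_prod_erase _ _ he]
    push_cast
    have := Rat.den_mul_eq_num (q.coeff e)
    rw [mul_right_comm, this, mul_comm]
  · exact ⟨0, by rw [Polynomial.notMem_support_iff.1 he]; simp⟩

/-- A common denominator `Z` and a bound `2 ^ M` for the integer multiples of indicators. -/
def IndicatorBound (D : Finset ℚ) (Z M : ℕ) : Prop :=
  Z ≠ 0 ∧ ∀ A ⊆ D, ∀ (n : ℕ) (i : Fin n), C (Z : ℚ) * indicator D A i ∈ integralPolys n ∧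
    l1 (toReal (C (Z : ℚ) * indicator D A i)) ≤ 2 ^ M

/-- There are only finitely many subsets of `D`, so one denominator and one norm bound serve all
indicators, whatever the number of variables. -/
theorem exists_indicatorBound (D : Finset ℚ) : ∃ Z M, IndicatorBound D Z M := by
  classical
  choose Z hZ0 hZ using exists_natCast_mul_integral
  let W : ℕ := ∏ A ∈ D.powerset, Z (indicatorPoly D A)
  have hW : W ≠ 0 := Finset.prod_ne_zero_iff.2 fun A _ => hZ0 _
  obtain ⟨M, hM⟩ := exists_nat_ge (∑ A ∈ D.powerset, (W : ℚ) * polyNorm (indicatorPoly D A))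
  refine ⟨W, M, hW, fun A hA n i => ⟨?_, ?_⟩⟩
  · rw [indicator, Polynomial.aeval_eq_sum_range, Finset.mul_sum]
    refine sum_mem fun e _ => ?_
    obtain ⟨z, hz⟩ := hZ (indicatorPoly D A) e
    have hAm : A ∈ D.powerset := Finset.mem_powerset.2 hA
    have : C (W : ℚ) * (indicatorPoly D A).coeff e • (X i : MvPolynomial (Fin n) ℚ) ^ e =
        monomial (Finsupp.single i e)
          (((∏ A' ∈ D.powerset.erase A, (Z (indicatorPoly D A') : ℤ)) * z : ℤ) : ℚ) := by
      have hW' : (W : ℚ) = Z (indicatorPoly D A) *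
          ∏ A' ∈ D.powerset.erase A, (Z (indicatorPoly D A') : ℚ) := by
        have : W = Z (indicatorPoly D A) * ∏ A' ∈ D.powerset.erase A, Z (indicatorPoly D A') :=
          (Finset.mul_prod_erase _ _ hAm).symm
        rw [this]
        push_cast
        rfl
      rw [smul_eq_C_mul, ← mul_assoc, ← C_mul, X_pow_eq_monomial, C_mul_monomial, mul_one, hW']
      push_cast
      rw [← hz]
      congr 1
      ring
    rw [this]
    exact monomial_mem_integralPolys _ _
  · rw [toReal_mul, toReal_C, l1_C_mul]
    have h1 : (W : ℚ) * polyNorm (indicatorPoly D A) ≤ M := by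
      refine le_trans ?_ hM
      refine Finset.single_le_sum (f := fun A => (W : ℚ) * polyNorm (indicatorPoly D A))
        (fun B _ => mul_nonneg (Nat.cast_nonneg _) (Finset.sum_nonneg fun _ _ => abs_nonneg _))
        (Finset.mem_powerset.2 hA)
    have h2 : (W : ℝ) * (polyNorm (indicatorPoly D A) : ℝ) ≤ M := by exact_mod_cast h1
    rw [Rat.cast_natCast, Nat.abs_cast]
    calc _ ≤ (W : ℝ) * (polyNorm (indicatorPoly D A) : ℝ) := by
          gcongr
          exact l1_aeval_X_le _ _
      _ ≤ M := h2
      _ ≤ 2 ^ M := by exact_mod_cast Nat.lt_two_pow_self.le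

/-! ### Indicators of upper sets in a finite partial order -/

-- The matrix is unitriangular for the order: at the point `s` only the indicators of elements `w ≤
-- s` contribute, and the coefficients of those below `s` vanish by induction.
open Classical in
theorem linearIndependent_le_indicator (α : Type*) [Fintype α] [PartialOrder α] :
    LinearIndependent ℚ fun w s : α => if w ≤ s then (1 : ℚ) else 0 := by
  rw [Fintype.linearIndependent_iff]
  intro g hg w
  induction w using WellFoundedLT.induction with
  | ind s ih =>
    have := congrFun hg s
    simp only [Finset.sum_apply, Pi.smul_apply, smul_eq_mul, mul_ite, mul_one, mul_zero,
      Pi.zero_apply] at this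
    rw [Finset.sum_eq_single s] at this
    · simpa using this
    · intro w _ hw
      split_ifs with h
      · exact ih w (lt_of_le_of_ne h hw)
      · rfl
    · simp

open Classical in
/-- The basis of the functions on a finite partial order that consists of the indicators of
principal upper sets. -/
def upperBasis (α : Type*) [Fintype α] [PartialOrder α] : Module.Basis α ℚ (α → ℚ) :=
  basisOfLinearIndependentOfCardEqFinrank' _ (linearIndependent_le_indicator α)
    (by simp)

open Classical in
theorem upperBasis_apply {α : Type*} [Fintype α] [PartialOrder α] (w s : α) :
    upperBasis α w s = if w ≤ s then 1 else 0 := by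
  simp [upperBasis]

end PCSoS

end

noncomputable section

namespace PCSoS

open MvPolynomial

/-! ### Systems closed under coordinatewise semilattice operations -/

/-- A semilattice structure on the domain `D` for each of `n` variables. -/
structure DomainOrder (D : Finset ℚ) (n : ℕ) where
  E : Fin n → Type
  semilattice : ∀ i, SemilatticeInf (E i)
  fintype : ∀ i, Fintype (E i)
  val : ∀ i, E i → ℚ
  val_injective : ∀ i, Function.Injective (val i)
  mem_iff : ∀ i ρ, ρ ∈ D ↔ ∃ a, val i a = ρ

attribute [instance] DomainOrder.semilattice DomainOrder.fintype

namespace DomainOrder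

open Classical

variable {D : Finset ℚ} {n : ℕ} (O : DomainOrder D n)

/-- The point of `D ^ n` that is given by an assignment. -/
def pt (a : ∀ i, O.E i) : Fin n → ℚ := fun i => O.val i (a i)

theorem pt_mem (a : ∀ i, O.E i) (i : Fin n) : O.pt a i ∈ D := (O.mem_iff i _).2 ⟨a i, rfl⟩

theorem exists_pt {x : Fin n → ℚ} (hx : ∀ i, x i ∈ D) : ∃ a, O.pt a = x := by
  choose a ha using fun i => (O.mem_iff i _).1 (hx i)
  exact ⟨a, funext ha⟩

theorem card_eq (i : Fin n) : Fintype.card (O.E i) = D.card := by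
  have : D = Finset.univ.image (O.val i) := by
    ext ρ
    rw [O.mem_iff i]
    simp
  rw [congrArg Finset.card this, Finset.card_image_of_injective _ (O.val_injective i),
    Finset.card_univ]

/-- The values of the principal upper set of `b`. -/
def up (i : Fin n) (b : O.E i) : Finset ℚ := (Finset.univ.filter (b ≤ ·)).image (O.val i)

theorem val_mem_up {i : Fin n} {b a : O.E i} : O.val i a ∈ O.up i b ↔ b ≤ a := by
  rw [up, (O.val_injective i).mem_finset_image]
  simp

theorem up_subset (i : Fin n) (b : O.E i) : O.up i b ⊆ D := by
  intro ρ hρ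
  obtain ⟨a, -, rfl⟩ := Finset.mem_image.1 hρ
  exact (O.mem_iff i _).2 ⟨a, rfl⟩

/-- The indicator of `x_i ≥ b`. -/
def ge (i : Fin n) (b : O.E i) : MvPolynomial (Fin n) ℚ := indicator D (O.up i b) i

/-- The indicator of `x_i ≱ b`. -/
def notGe (i : Fin n) (b : O.E i) : MvPolynomial (Fin n) ℚ := indicator D (D \ O.up i b) i

theorem eval_ge (i : Fin n) (b : O.E i) (a : ∀ i, O.E i) :
    eval (O.pt a) (O.ge i b) = if b ≤ a i then 1 else 0 := by
  rw [ge, eval_indicator _ _ (O.pt_mem a i)]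
  exact if_congr O.val_mem_up rfl rfl

theorem eval_notGe (i : Fin n) (b : O.E i) (a : ∀ i, O.E i) :
    eval (O.pt a) (O.notGe i b) = if b ≤ a i then 0 else 1 := by
  rw [notGe, eval_indicator _ _ (O.pt_mem a i)]
  have h1 : O.pt a i ∈ O.up i b ↔ b ≤ a i := O.val_mem_up
  by_cases h : b ≤ a i
  · simp [Finset.mem_sdiff, h1, h]
  · simp [Finset.mem_sdiff, h1, h, O.pt_mem a i]

theorem totalDegree_ge (i : Fin n) (b : O.E i) : (O.ge i b).totalDegree ≤ D.card :=
  totalDegree_indicator_le _ _ _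

theorem totalDegree_notGe (i : Fin n) (b : O.E i) : (O.notGe i b).totalDegree ≤ D.card :=
  totalDegree_indicator_le _ _ _

/-- The indicator of `x_i ≥ τ_i` for all `i ∈ U`. -/
def term (U : Finset (Fin n)) (τ : ∀ i, O.E i) : MvPolynomial (Fin n) ℚ :=
  ∏ i ∈ U, O.ge i (τ i)

theorem eval_term (U : Finset (Fin n)) (τ a : ∀ i, O.E i) :
    eval (O.pt a) (O.term U τ) = if ∀ i ∈ U, τ i ≤ a i then 1 else 0 := by
  rw [term, map_prod]
  simp only [eval_ge]
  rw [Finset.prod_ite_zero]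
  simp

theorem totalDegree_term (U : Finset (Fin n)) (τ : ∀ i, O.E i) :
    (O.term U τ).totalDegree ≤ U.card * D.card := by
  refine (totalDegree_finsetProd _ _).trans ?_
  exact (Finset.sum_le_card_nsmul _ _ D.card fun i _ => O.totalDegree_ge i _).trans (by simp)

variable {Z M : ℕ}

/-- Propagation derives polynomials of this shape, and being bounded integral up to a scalar
entitles them to be multiplied in the next round. A product of at most `e + 1` indicators needs `M *
(e + 1)` bits. -/
theorem term_mul_notGe_mem (hZ : IndicatorBound D Z M) {e k b : ℕ} {U : Finset (Fin n)}
    (hU : U.card ≤ e) (hk : (e + 1) * D.card ≤ k) (hb : M * (e + 1) ≤ b) (τ : ∀ i, O.E i)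
    (i : Fin n) (y : O.E i) :
    C ((Z : ℚ) ^ (U.card + 1)) * (O.term U τ * O.notGe i y) ∈ boundedIntegral n k b := by
  have hsplit : C ((Z : ℚ) ^ (U.card + 1)) * (O.term U τ * O.notGe i y) =
      (∏ l ∈ U, (C (Z : ℚ) * O.ge l (τ l))) * (C (Z : ℚ) * O.notGe i y) := by
    rw [Finset.prod_mul_distrib, Finset.prod_const, term, pow_succ, C_mul, C_pow]
    ring
  have h1 : ∀ l (c : O.E l), C (Z : ℚ) * O.ge l c ∈ integralPolys n ∧
      l1 (toReal (C (Z : ℚ) * O.ge l c)) ≤ 2 ^ M := fun l c => hZ.2 _ (O.up_subset l c) n l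
  have h2 : C (Z : ℚ) * O.notGe i y ∈ integralPolys n ∧
      l1 (toReal (C (Z : ℚ) * O.notGe i y)) ≤ 2 ^ M := hZ.2 _ Finset.sdiff_subset n i
  refine ⟨?_, ?_, ?_⟩
  · rw [hsplit]
    exact mul_mem (prod_mem fun l _ => (h1 l _).1) h2.1
  · rw [hsplit, toReal_mul, toReal_prod]
    refine (l1_mul_le _ _).trans ?_
    calc _ ≤ ((2 : ℝ) ^ M) ^ U.card * 2 ^ M := by
          refine mul_le_mul ((l1_prod_le _ _).trans ?_) h2.2 (l1_nonneg _) (by positivity)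
          rw [← Finset.prod_const]
          exact Finset.prod_le_prod (fun _ _ => l1_nonneg _) fun l _ => (h1 l _).2
      _ = 2 ^ (M * (U.card + 1)) := by rw [← pow_mul, ← pow_add, mul_add, mul_one]
      _ ≤ 2 ^ b := pow_le_pow_right₀ (by norm_num)
          (le_trans (Nat.mul_le_mul_left _ (by omega)) hb)
  · refine (totalDegree_mul _ _).trans ?_
    rw [totalDegree_C, zero_add]
    refine (totalDegree_mul _ _).trans ?_
    have h3 := O.totalDegree_term U τ
    have h4 := O.totalDegree_notGe i y
    have h5 : U.card * D.card ≤ e * D.card := Nat.mul_le_mul_right _ hU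
    rw [add_mul, one_mul] at hk
    omega

/-- Parameters for which the derivations below stay within degree `k` and bit length `b`. -/
structure Admissible (D : Finset ℚ) (Z M r Δ e k b : ℕ) : Prop where
  nonempty : D.Nonempty
  bound : IndicatorBound D Z M
  degree : (2 * e + 2 * r + 2) * D.card + Δ ≤ k
  bits : M * (e + 1) ≤ b

variable {r Δ e k b : ℕ} {ι : Type} {f : ι → MvPolynomial (Fin n) ℚ}

/-- Under the term the bounds `x_i ≥ y_i` are already derived, hence so is the conjunction of the
weaker bounds `x_i ≥ t_i`. The product is telescoped one variable at a time. Each summand has a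
factor `1 - [x_i ≥ t_i]`, and since `t_i ≤ y_i` it agrees on the domain with a multiple of the
derived polynomial for `x_i ≱ y_i`. -/
theorem mul_term_mul_one_sub_mem (hA : Admissible D Z M r Δ e k b) {l : ℕ} {U : Finset (Fin n)}
    (hU : U.card ≤ e) {τ y t : ∀ i, O.E i} {V : Finset (Fin n)} (ht : ∀ i ∈ V, t i ≤ y i)
    (hy : ∀ i ∈ V, O.term U τ * O.notGe i (y i) ∈ level (domainSystem D f) k b l)
    {q : MvPolynomial (Fin n) ℚ} (hq : q.totalDegree + (e + 1 + V.card) * D.card ≤ k) :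
    q * O.term U τ * (1 - ∏ i ∈ V, O.ge i (t i)) ∈ level (domainSystem D f) k b (l + 1) := by
  have hterm := O.totalDegree_term U τ
  have hUe : U.card * D.card ≤ e * D.card := Nat.mul_le_mul_right _ hU
  induction V using Finset.induction_on generalizing q with
  | empty => simp
  | insert i V hi ih =>
    rw [Finset.card_insert_of_notMem hi] at hq
    have hge := O.totalDegree_ge i (t i)
    have hexp : (e + 1 + (V.card + 1)) * D.card = e * D.card + D.card + V.card * D.card + D.card := by
      ring
    have hexp' : (e + 1 + V.card) * D.card = e * D.card + D.card + V.card * D.card := by ring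
    have hsplit : q * O.term U τ * (1 - ∏ l ∈ insert i V, O.ge l (t l)) =
        q * O.term U τ * (1 - O.ge i (t i)) +
          (q * O.ge i (t i)) * O.term U τ * (1 - ∏ l ∈ V, O.ge l (t l)) := by
      rw [Finset.prod_insert hi]
      ring
    rw [hsplit]
    refine add_mem ?_ (ih (fun l hl => ht l (Finset.mem_insert_of_mem hl))
      (fun l hl => hy l (Finset.mem_insert_of_mem hl)) ?_)
    · have hng := O.totalDegree_notGe i (t i)
      have hng' := O.totalDegree_notGe i (y i)
      have d1 := totalDegree_mul q (O.notGe i (t i))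
      have d2 := totalDegree_mul (O.term U τ) (O.notGe i (y i))
      have d3 := totalDegree_mul (q * O.notGe i (t i)) (O.term U τ * O.notGe i (y i))
      have d4 := totalDegree_mul q (O.term U τ)
      have d5 := totalDegree_mul (q * O.term U τ) (1 - O.ge i (t i))
      have d6 : (1 - O.ge i (t i)).totalDegree ≤ D.card := by
        refine (totalDegree_sub _ _).trans (max_le ?_ hge)
        simp
      refine mem_level_congr hA.nonempty
        (p := (q * O.notGe i (t i)) * (O.term U τ * O.notGe i (y i))) (by omega) (by omega) ?_
        (mul_mem_level (hy i (Finset.mem_insert_self _ _)) (z := (Z : ℚ) ^ (U.card + 1))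
          (pow_ne_zero _ (Nat.cast_ne_zero.2 hA.bound.1))
          (O.term_mul_notGe_mem hA.bound hU (by rw [add_mul, one_mul]; omega) hA.bits τ i (y i))
          (by omega))
      intro x hx
      obtain ⟨a, rfl⟩ := O.exists_pt hx
      simp only [map_mul, map_sub, map_one, eval_ge, eval_notGe, eval_term]
      have h1 := ht i (Finset.mem_insert_self _ _)
      by_cases h2 : t i ≤ a i
      · simp [h2]
      · have h3 : ¬ y i ≤ a i := fun h => h2 (h1.trans h)
        simp [h2, h3]
    · have d1 := totalDegree_mul q (O.ge i (t i))
      omega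

/-- One propagation step. -/
theorem mul_term_mem (hA : Admissible D Z M r Δ e k b) {l : ℕ} {U : Finset (Fin n)}
    (hU : U.card ≤ e) {τ y : ∀ i, O.E i}
    (hy : ∀ i, O.term U τ * O.notGe i (y i) ∈ level (domainSystem D f) k b l) (j : ι)
    (hr : (f j).vars.card ≤ r) (hΔ : (f j).totalDegree ≤ Δ) {q : MvPolynomial (Fin n) ℚ}
    (hq : q.totalDegree ≤ D.card)
    (hj : ∀ a, eval (O.pt a) (f j) = 0 → (∀ i ∈ (f j).vars, y i ≤ a i) → eval (O.pt a) q = 0) :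
    q * O.term U τ ∈ level (domainSystem D f) k b (l + 1) := by
  have hk := hA.degree
  have hexp : (2 * e + 2 * r + 2) * D.card =
      2 * (e * D.card) + 2 * (r * D.card) + 2 * D.card := by ring
  have hterm := O.totalDegree_term U τ
  have hUe : U.card * D.card ≤ e * D.card := Nat.mul_le_mul_right _ hU
  have hVr : (f j).vars.card * D.card ≤ r * D.card := Nat.mul_le_mul_right _ hr
  -- Case distinction on whether the bounds `y` hold on the variables of `f j`. If not, the bounds
  -- derived under the term apply; if so, `q` vanishes wherever `f j` does.
  have hsplit : q * O.term U τ = q * O.term U τ * (1 - ∏ i ∈ (f j).vars, O.ge i (y i)) +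
      q * O.term U τ * O.term (f j).vars y := by
    rw [term, term]
    ring
  rw [hsplit]
  refine add_mem (O.mul_term_mul_one_sub_mem hA hU (fun _ _ => le_rfl) (fun i _ => hy i) ?_)
    (mem_level_of_input hA.nonempty j hr hΔ ?_ ?_ _)
  · have : (e + 1 + (f j).vars.card) * D.card =
        e * D.card + D.card + (f j).vars.card * D.card := by ring
    omega
  · have d1 := totalDegree_mul q (O.term U τ)
    have d2 := totalDegree_mul (q * O.term U τ) (O.term (f j).vars y)
    have d3 := O.totalDegree_term (f j).vars y
    omega
  · intro x hx hx0
    obtain ⟨a, rfl⟩ := O.exists_pt hx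
    rw [map_mul, map_mul, eval_term _ (f j).vars]
    split_ifs with h
    · rw [hj a hx0 h]
      simp
    · simp

/-- The number of pairs `(i, b)` with `b ≤ y_i`. -/
def height (y : ∀ i, O.E i) : ℕ := ∑ i, (Finset.univ.filter (· ≤ y i)).card

theorem height_le (y : ∀ i, O.E i) : O.height y ≤ n * D.card := by
  refine (Finset.sum_le_card_nsmul _ _ D.card fun i _ => ?_).trans (by simp)
  rw [← O.card_eq i]
  exact Finset.card_le_univ _

theorem height_lt_height_update {y : ∀ i, O.E i} {i : Fin n} {c : O.E i} (h : y i < c) :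
    O.height y < O.height (Function.update y i c) := by
  refine Finset.sum_lt_sum (fun l _ => Finset.card_le_card ?_) ⟨i, Finset.mem_univ _,
    Finset.card_lt_card ?_⟩
  · intro a ha
    simp only [Finset.mem_filter, Finset.mem_univ, true_and] at ha ⊢
    rcases eq_or_ne l i with rfl | hl
    · rw [Function.update_self]
      exact ha.trans h.le
    · rwa [Function.update_of_ne hl]
  · rw [Finset.ssubset_iff_of_subset]
    · refine ⟨c, by simp, ?_⟩
      simp only [Finset.mem_filter, Finset.mem_univ, true_and]
      exact h.not_ge
    · intro a ha
      simp only [Finset.mem_filter, Finset.mem_univ, true_and, Function.update_self] at ha ⊢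
      exact ha.trans h.le

/-- Propagation ends in a refutation of the term or in a solution. -/
theorem propagate (hA : Admissible D Z M r Δ e k b) (hr : ∀ j, (f j).vars.card ≤ r)
    (hΔ : ∀ j, (f j).totalDegree ≤ Δ)
    (hclosed : ∀ j a a', eval (O.pt a) (f j) = 0 → eval (O.pt a') (f j) = 0 →
      eval (O.pt (a ⊓ a')) (f j) = 0)
    {U : Finset (Fin n)} (hU : U.card ≤ e) {τ : ∀ i, O.E i} (t : ℕ) (l : ℕ) (y : ∀ i, O.E i)
    (ht : n * D.card ≤ O.height y + t)
    (hy : ∀ i, O.term U τ * O.notGe i (y i) ∈ level (domainSystem D f) k b l) :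
    O.term U τ ∈ level (domainSystem D f) k b (l + t + 1) ∨
      ∃ y', y ≤ y' ∧ (∀ j, eval (O.pt y') (f j) = 0) ∧
        ∀ i, O.term U τ * O.notGe i (y' i) ∈ level (domainSystem D f) k b (l + t + 1) := by
  induction t generalizing l y with
  | zero | succ t ih =>
    by_cases hsat : ∀ j, eval (O.pt y) (f j) = 0
    · exact Or.inr ⟨y, le_rfl, hsat, fun i => level_mono (by omega) (hy i)⟩
    push Not at hsat
    obtain ⟨j, hj⟩ := hsat
    -- The constraint `j` is violated at `y`. If no assignment satisfying it lies above `y` on its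
    -- variables, the term is refuted. Otherwise these assignments are closed under meets, and their
    -- minimum `m` gives bounds that the constraint enforces.
    let A : Finset (∀ i, O.E i) := Finset.univ.filter fun a =>
      eval (O.pt a) (f j) = 0 ∧ ∀ i ∈ (f j).vars, y i ≤ a i
    by_cases hne : A.Nonempty
    swap
    · refine Or.inl (level_mono (show l + 1 ≤ _ by omega) ?_)
      have := O.mul_term_mem hA hU hy j (hr j) (hΔ j) (q := 1) (by simp) (by
        intro a h1 h2
        exact absurd ⟨a, Finset.mem_filter.2 ⟨Finset.mem_univ _, h1, h2⟩⟩ hne)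
      rwa [one_mul] at this
    have hmA : A.inf' hne id ∈ A := by
      refine Finset.inf'_mem (A : Set (∀ i, O.E i)) ?_ A hne id fun a ha => ha
      intro a ha a' ha'
      simp only [A, Finset.coe_filter, Set.mem_ofPred_eq, Finset.mem_univ, true_and] at ha ha' ⊢
      exact ⟨hclosed j a a' ha.1 ha'.1, fun i hi => le_inf (ha.2 i hi) (ha'.2 i hi)⟩
    obtain ⟨m, hm⟩ : ∃ m, m = A.inf' hne id := ⟨_, rfl⟩
    rw [← hm] at hmA
    obtain ⟨-, hm0, hmy⟩ := Finset.mem_filter.1 hmA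
    -- If `m` agreed with `y` on the variables of `f j`, then `y` would satisfy the constraint.
    obtain ⟨i, hi, hne'⟩ : ∃ i ∈ (f j).vars, y i ≠ m i := by
      by_contra hcon
      push Not at hcon
      refine hj ?_
      rw [← hm0]
      exact eval_eq_of_forall_vars fun i hi => by rw [pt, pt, hcon i hi]
    have hlt : y i < m i := lt_of_le_of_ne (hmy i hi) hne'
    have hh := O.height_lt_height_update hlt
    have hh' := O.height_le (Function.update y i (m i))
    have hnew : ∀ i', O.term U τ * O.notGe i' (Function.update y i (m i) i') ∈
        level (domainSystem D f) k b (l + 1) := by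
      intro i'
      rcases eq_or_ne i' i with rfl | hi'
      · rw [Function.update_self, mul_comm]
        refine O.mul_term_mem hA hU hy j (hr j) (hΔ j) (O.totalDegree_notGe _ _) ?_
        intro a h1 h2
        have : m i' ≤ a i' := by
          rw [hm]
          exact (Finset.inf'_le (f := id) (Finset.mem_filter.2 ⟨Finset.mem_univ a, h1, h2⟩)) i'
        rw [eval_notGe, if_pos this]
      · rw [Function.update_of_ne hi']
        exact level_mono (by omega) (hy i')
    -- Raising one bound strictly increases the height, which is at most `n * D.card`. With no fuel
    -- left this is a contradiction, closed by `omega`; otherwise the induction hypothesis applies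
    -- to the raised bounds.
    first
    | omega
    | rcases ih (l + 1) (Function.update y i (m i)) (by omega) hnew with h | ⟨y', h1, h2, h3⟩
      · exact Or.inl (level_mono (by omega) h)
      · refine Or.inr ⟨y', le_trans ?_ h1, h2, fun i => level_mono (by omega) (h3 i)⟩
        exact le_update_iff.2 ⟨hlt.le, fun _ _ => le_rfl⟩

/-- The level at which all terms are closed under propagation. -/
def closureLevel (D : Finset ℚ) (n : ℕ) : ℕ := n * D.card + 1

/-- The solution `y` is the least one above the term. -/
def IsClosure (O : DomainOrder D n) (f : ι → MvPolynomial (Fin n) ℚ) (k b : ℕ)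
    (U : Finset (Fin n)) (τ y : ∀ i, O.E i) : Prop :=
  (∀ i ∈ U, τ i ≤ y i) ∧
    ∀ i, O.term U τ * O.notGe i (y i) ∈ level (domainSystem D f) k b (closureLevel D n)

/-- Propagation starts from the term's own bounds on `U` and the least element elsewhere, which hold
trivially under the term, with the maximal height as fuel. -/
theorem exists_closure (hA : Admissible D Z M r Δ e k b) (hr : ∀ j, (f j).vars.card ≤ r)
    (hΔ : ∀ j, (f j).totalDegree ≤ Δ)
    (hclosed : ∀ j a a', eval (O.pt a) (f j) = 0 → eval (O.pt a') (f j) = 0 →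
      eval (O.pt (a ⊓ a')) (f j) = 0)
    {U : Finset (Fin n)} (hU : U.card ≤ e) (τ : ∀ i, O.E i) :
    O.term U τ ∈ level (domainSystem D f) k b (closureLevel D n) ∨
      ∃ y, (∀ j, eval (O.pt y) (f j) = 0) ∧ O.IsClosure f k b U τ y := by
  let bot : ∀ i, O.E i := fun i => Finset.univ.inf' ⟨τ i, Finset.mem_univ _⟩ id
  have hbot : ∀ i (c : O.E i), bot i ≤ c := fun i c => Finset.inf'_le (f := id) (Finset.mem_univ c)
  let y : ∀ i, O.E i := fun i => if i ∈ U then τ i else bot i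
  have hy : ∀ i, O.term U τ * O.notGe i (y i) ∈ level (domainSystem D f) k b 0 := by
    intro i
    refine mem_level_of_vanishes hA.nonempty ?_ ?_ 0
    · have h1 := totalDegree_mul (O.term U τ) (O.notGe i (y i))
      have h2 := O.totalDegree_term U τ
      have h3 := O.totalDegree_notGe i (y i)
      have h4 : U.card * D.card ≤ e * D.card := Nat.mul_le_mul_right _ hU
      have h5 := hA.degree
      have h6 : (2 * e + 2 * r + 2) * D.card =
        2 * (e * D.card) + 2 * (r * D.card) + 2 * D.card := by ring
      omega
    · intro x hx
      obtain ⟨a, rfl⟩ := O.exists_pt hx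
      rw [map_mul, eval_term, eval_notGe]
      by_cases h : ∀ i ∈ U, τ i ≤ a i
      · have : y i ≤ a i := by
          by_cases hi : i ∈ U
          · simpa [y, hi] using h i hi
          · simpa [y, hi] using hbot i (a i)
        simp [this]
      · simp [h]
  rcases O.propagate hA hr hΔ hclosed hU (n * D.card) 0 y (Nat.le_add_left _ _) hy with h | h
  · rw [zero_add] at h
    exact Or.inl h
  · obtain ⟨y', h1, h2, h3⟩ := h
    rw [zero_add] at h3
    refine Or.inr ⟨y', h2, fun i hi => ?_, h3⟩
    have := h1 i
    simpa [y, hi] using this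

theorem vanishes_of_mem_level {l : ℕ} {p : MvPolynomial (Fin n) ℚ}
    (hp : p ∈ level (domainSystem D f) k b l) {x : Fin n → ℚ} (hx : ∀ i, x i ∈ D)
    (hf : ∀ j, eval x (f j) = 0) : eval x p = 0 := by
  have key : level (domainSystem D f) k b l ≤ LinearMap.ker (aeval x).toLinearMap := by
    have hP : ∀ j, eval x (domainSystem D f j) = 0 := by
      rintro (j | i)
      · exact hf j
      · exact (eval_domainPoly_eq_zero i).2 (hx i)
    induction l generalizing p with
    | zero =>
      rw [level, Submodule.span_le]
      rintro _ ⟨j, m, -, rfl⟩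
      simp [aeval_eq_eval, hP j]
    | succ l ih =>
      rw [level]
      refine sup_le (ih (p := 0) (zero_mem _)) (Submodule.span_le.2 ?_)
      rintro _ ⟨c, hc, -, m, -, rfl⟩
      have h0 : eval x c = 0 := by
        simpa [aeval_eq_eval] using ih (p := 0) (zero_mem _) hc
      simp [h0]
  have := key hp
  simpa [aeval_eq_eval] using this

/-- Derivable polynomials vanish at solutions, so a solution above the term is above `y`. Conversely
`y` itself is above the term. -/
theorem eval_term_of_isClosure {U : Finset (Fin n)} {τ y : ∀ i, O.E i}
    (h : O.IsClosure f k b U τ y) {s : ∀ i, O.E i} (hs : ∀ j, eval (O.pt s) (f j) = 0) :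
    eval (O.pt s) (O.term U τ) = if y ≤ s then 1 else 0 := by
  rw [eval_term]
  refine if_congr ⟨fun h1 i => ?_, fun h1 i hi => (h.1 i hi).trans (h1 i)⟩ rfl rfl
  have := vanishes_of_mem_level (h.2 i) (O.pt_mem s) hs
  rw [map_mul, eval_term, if_pos h1, eval_notGe, one_mul] at this
  by_contra hcon
  simp [hcon] at this

/-- Each term implies its closure `y`, and `y` implies the bounds of the other term. So both terms
agree, up to derivable polynomials, with their product. -/
theorem term_sub_term_mem (hA : Admissible D Z M r Δ e k b) {U U' : Finset (Fin n)}
    (hU : U.card ≤ e) (hU' : U'.card ≤ e) {τ τ' y : ∀ i, O.E i}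
    (h : O.IsClosure f k b U τ y) (h' : O.IsClosure f k b U' τ' y) :
    O.term U τ - O.term U' τ' ∈ level (domainSystem D f) k b (closureLevel D n + 1) := by
  have hdeg : ∀ V : Finset (Fin n), V.card ≤ e →
      (1 : MvPolynomial (Fin n) ℚ).totalDegree + (e + 1 + V.card) * D.card ≤ k := by
    intro V hV
    have h1 := hA.degree
    have h2 : (e + 1 + V.card) * D.card ≤ (2 * e + 2 * r + 2) * D.card :=
      Nat.mul_le_mul_right _ (by omega)
    rw [totalDegree_one]
    omega
  have h1 := O.mul_term_mul_one_sub_mem hA hU h'.1 (fun i _ => h.2 i) (hdeg U' hU')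
  have h2 := O.mul_term_mul_one_sub_mem hA hU' h.1 (fun i _ => h'.2 i) (hdeg U hU)
  have h3 := sub_mem h1 h2
  have h4 : 1 * O.term U τ * (1 - ∏ i ∈ U', O.ge i (τ' i)) -
      1 * O.term U' τ' * (1 - ∏ i ∈ U, O.ge i (τ i)) = O.term U τ - O.term U' τ' := by
    rw [term, term]
    ring
  rwa [h4] at h3

/-- The span of the terms in at most `e` variables. -/
def termSpan (e : ℕ) : Submodule ℚ (MvPolynomial (Fin n) ℚ) :=
  Submodule.span ℚ {q | ∃ U τ, U.card ≤ e ∧ q = O.term U τ}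

/-- Each factor is a function of one variable and is expanded in the basis of upper set indicators;
products of these indicators are terms on the same variables. -/
theorem exists_term_combination (U : Finset (Fin n)) (g : ∀ i, O.E i → ℚ) :
    ∃ q ∈ Submodule.span ℚ (Set.range (O.term U)),
      ∀ a, eval (O.pt a) q = ∏ i ∈ U, g i (a i) := by
  by_cases hne : Nonempty (∀ i, O.E i)
  swap
  · exact ⟨0, zero_mem _, fun a => absurd ⟨a⟩ hne⟩
  obtain ⟨a₀⟩ := hne
  induction U using Finset.induction_on with
  | empty =>
    refine ⟨1, Submodule.subset_span ⟨a₀, by simp [term]⟩, fun a => by simp⟩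
  | insert i U hi ih =>
    obtain ⟨q, hq, hqe⟩ := ih
    refine ⟨∑ c : O.E i, (upperBasis (O.E i)).repr (g i) c • (O.ge i c * q), ?_, ?_⟩
    · have hmul : ∀ c, ∀ q ∈ Submodule.span ℚ (Set.range (O.term U)),
          O.ge i c * q ∈ Submodule.span ℚ (Set.range (O.term (insert i U))) := by
        intro c q hq
        induction hq using Submodule.span_induction with
        | mem q hq =>
          obtain ⟨τ, rfl⟩ := hq
          refine Submodule.subset_span ⟨Function.update τ i c, ?_⟩
          rw [term, term, Finset.prod_insert hi, Function.update_self]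
          congr 1
          refine Finset.prod_congr rfl fun l hl => ?_
          have hli : l ≠ i := by
            rintro rfl
            exact hi hl
          rw [Function.update_of_ne hli]
        | zero => simp
        | add p q _ _ h1 h2 =>
          rw [mul_add]
          exact add_mem h1 h2
        | smul c q _ h1 =>
          rw [mul_smul_comm]
          exact Submodule.smul_mem _ _ h1
      exact sum_mem fun c _ => Submodule.smul_mem _ _ (hmul c q hq)
    · intro a
      have := congrFun ((upperBasis (O.E i)).sum_repr (g i)) (a i)
      simp only [Finset.sum_apply, Pi.smul_apply, upperBasis_apply, smul_eq_mul] at this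
      rw [Finset.prod_insert hi, ← this, map_sum, Finset.sum_mul]
      refine Finset.sum_congr rfl fun c _ => ?_
      rw [smul_eval, map_mul, eval_ge, hqe]
      ring

theorem exists_mem_termSpan {p : MvPolynomial (Fin n) ℚ} (hp : p.totalDegree ≤ e) :
    ∃ q ∈ O.termSpan e, ∀ a, eval (O.pt a) q = eval (O.pt a) p := by
  choose q hq hqe using fun m : Fin n →₀ ℕ =>
    O.exists_term_combination m.support fun i a => O.val i a ^ m i
  refine ⟨∑ m ∈ p.support, p.coeff m • q m, sum_mem fun m hm => Submodule.smul_mem _ _ ?_, ?_⟩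
  · refine Submodule.span_mono ?_ (hq m)
    rintro _ ⟨τ, rfl⟩
    refine ⟨m.support, τ, ?_, rfl⟩
    refine le_trans ?_ ((degree_le_totalDegree hm).trans hp)
    rw [Finsupp.degree_apply, Finset.card_eq_sum_ones]
    refine Finset.sum_le_sum fun i hi => ?_
    have := Finsupp.mem_support_iff.1 hi
    omega
  · intro a
    rw [map_sum, eval_eq]
    refine Finset.sum_congr rfl fun m _ => ?_
    rw [smul_eval, hqe]
    rfl

/-- Low-degree polynomials that vanish on the solutions are derivable. -/
theorem mem_level_of_vanishes_on_solutions (hA : Admissible D Z M r Δ e k b)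
    (hr : ∀ j, (f j).vars.card ≤ r) (hΔ : ∀ j, (f j).totalDegree ≤ Δ)
    (hclosed : ∀ j a a', eval (O.pt a) (f j) = 0 → eval (O.pt a') (f j) = 0 →
      eval (O.pt (a ⊓ a')) (f j) = 0)
    {p : MvPolynomial (Fin n) ℚ} (hp : p.totalDegree ≤ e)
    (hp0 : ∀ a, (∀ j, eval (O.pt a) (f j) = 0) → eval (O.pt a) p = 0) :
    p ∈ level (domainSystem D f) k b (closureLevel D n + 1) := by
  set W := level (domainSystem D f) k b (closureLevel D n + 1) with hW
  let S := {a : ∀ i, O.E i // ∀ j, eval (O.pt a) (f j) = 0}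
  let res : MvPolynomial (Fin n) ℚ →ₗ[ℚ] S → ℚ :=
    LinearMap.pi fun s => (aeval (O.pt s.1)).toLinearMap
  have hres : ∀ q s, res q s = eval (O.pt s.1) q := fun q s => by simp [res, aeval_eq_eval]
  let R : Finset (Fin n) × (∀ i, O.E i) → S → Prop := fun t w =>
    t.1.card ≤ e ∧ O.IsClosure f k b t.1 t.2 w.1
  -- A solution is sent to the class of any term whose closure it is. By `hF` the choice is
  -- irrelevant modulo `W`; the value at solutions that are no closure does not matter.
  let F : S → MvPolynomial (Fin n) ℚ ⧸ W := fun w =>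
    if h : ∃ t, R t w then W.mkQ (O.term h.choose.1 h.choose.2) else 0
  have hF : ∀ t w, R t w → F w = W.mkQ (O.term t.1 t.2) := by
    intro t w h
    have hex : ∃ t, R t w := ⟨t, h⟩
    simp only [F, dif_pos hex]
    rw [← sub_eq_zero, ← map_sub, Submodule.mkQ_apply, Submodule.Quotient.mk_eq_zero]
    exact O.term_sub_term_mem hA hex.choose_spec.1 h.1 hex.choose_spec.2 h.2
  -- Here linear independence of the upper set indicators of `S` enters: it permits a linear
  -- extension of `F`. The factorization `hΛ` of the quotient map through restriction to `S` then
  -- shows that a combination of terms vanishing on `S` lies in `W`.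
  let Λ : (S → ℚ) →ₗ[ℚ] MvPolynomial (Fin n) ℚ ⧸ W := (upperBasis S).constr ℚ F
  have hΛ : ∀ q ∈ O.termSpan e, W.mkQ q = Λ (res q) := by
    intro q hq
    induction hq using Submodule.span_induction with
    | mem q hq =>
      obtain ⟨U, τ, hU, rfl⟩ := hq
      rcases O.exists_closure hA hr hΔ hclosed hU τ with h | ⟨y, hy, h⟩
      · have h1 : res (O.term U τ) = 0 := by
          funext s
          rw [hres]
          exact vanishes_of_mem_level h (O.pt_mem s.1) s.2
        rw [h1, map_zero, Submodule.mkQ_apply, Submodule.Quotient.mk_eq_zero]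
        exact level_mono (Nat.le_succ _) h
      · have h1 : res (O.term U τ) = upperBasis S ⟨y, hy⟩ := by
          funext s
          rw [hres, O.eval_term_of_isClosure h s.2, upperBasis_apply]
          exact if_congr Iff.rfl rfl rfl
        rw [h1, Module.Basis.constr_basis, hF (U, τ) ⟨y, hy⟩ ⟨hU, h⟩]
    | zero => simp
    | add q q' _ _ h h' => rw [map_add, map_add, map_add, h, h']
    | smul c q _ h => rw [map_smul, map_smul, map_smul, h]
  obtain ⟨q, hq, hqe⟩ := O.exists_mem_termSpan hp
  have hdegq : q.totalDegree ≤ k := by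
    have h1 : O.termSpan e ≤ restrictTotalDegree (Fin n) ℚ k := by
      refine Submodule.span_le.2 ?_
      rintro _ ⟨U, τ, hU, rfl⟩
      rw [SetLike.mem_coe, mem_restrictTotalDegree]
      have h2 : U.card * D.card ≤ (2 * e + 2 * r + 2) * D.card :=
        Nat.mul_le_mul_right _ (by omega)
      have h3 := hA.degree
      exact (O.totalDegree_term U τ).trans (by omega)
    exact (mem_restrictTotalDegree _ _ _).1 (h1 hq)
  have hDpos := hA.nonempty.card_pos
  have hpk : p.totalDegree ≤ k := by
    have h1 := hA.degree
    have h2 : (2 * e + 2 * r + 2) * 1 ≤ (2 * e + 2 * r + 2) * D.card :=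
      Nat.mul_le_mul_left _ hDpos
    omega
  have hqW : q ∈ W := by
    rw [← Submodule.Quotient.mk_eq_zero, ← Submodule.mkQ_apply, hΛ q hq]
    have : res q = 0 := by
      funext s
      rw [hres, hqe, hp0 s.1 s.2]
      rfl
    rw [this, map_zero]
  refine mem_level_congr hA.nonempty hdegq hpk ?_ hqW
  intro x hx
  obtain ⟨a, rfl⟩ := O.exists_pt hx
  exact hqe a

end DomainOrder

end PCSoS

end

noncomputable section

namespace PCSoS

open MvPolynomial

/-! ### From polymorphisms to coordinatewise semilattices -/

/-- The order on the domain given by a semilattice operation for each variable. -/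
def DomainOrder.ofOps {D : Finset ℚ} {n : ℕ} (op : Fin n → D → D → D)
    (comm : ∀ i a b, op i a b = op i b a)
    (assoc : ∀ i a b c, op i (op i a b) c = op i a (op i b c)) (idem : ∀ i a, op i a a = a) :
    DomainOrder D n where
  E _ := D
  semilattice i := @SemilatticeInf.mk' D ⟨op i⟩ (comm i) (assoc i) (idem i)
  fintype _ := inferInstance
  val _ := Subtype.val
  val_injective _ := Subtype.val_injective
  mem_iff _ ρ := by simp

/-- A point of the domain satisfies a constraint. -/
def Constraint.Sat {D : Finset ℚ} {Γ : Set (DomRelation D)} {n : ℕ} (c : Constraint Γ n)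
    (a : Fin n → D) : Prop :=
  (fun k => a (c.scope k)) ∈ c.rel.tuples

/-- For the dual discriminator, fixing the first argument to `s i` gives the operation with value
`a` if `a = b` and `s i` otherwise, which is the meet of the flat order with least element `s i`. It
preserves every constraint because `s` satisfies all of them. Since it depends on `i`, the order on
the domain varies with the variable. -/
theorem exists_semilattice_ops {D : Finset ℚ} {Γ : Set (DomRelation D)}
    (hΓ : SemilatticeClosed Γ ∨ DualDiscriminatorClosed Γ) {n : ℕ} {κ : Type}
    (c : κ → Constraint Γ n) (s : Fin n → D) (hs : ∀ j, (c j).Sat s) :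
    ∃ op : Fin n → D → D → D, (∀ i a b, op i a b = op i b a) ∧
      (∀ i a b c, op i (op i a b) c = op i a (op i b c)) ∧ (∀ i a, op i a a = a) ∧
      ∀ j a a', (c j).Sat a → (c j).Sat a' → (c j).Sat fun i => op i (a i) (a' i) := by
  rcases hΓ with ⟨g, ⟨h1, h2, h3⟩, hpol⟩ | ⟨g, ⟨h1, h2⟩, hpol⟩
  · refine ⟨fun _ a b => g ![a, b], fun _ => h2, fun _ => h3, fun _ => h1, ?_⟩
    intro j a a' ha ha'
    have := hpol _ (c j).mem ![fun k => a ((c j).scope k), fun k => a' ((c j).scope k)] (by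
      intro l
      fin_cases l
      · exact ha
      · exact ha')
    have heq : (fun i => g fun l => (![fun k => a ((c j).scope k),
        fun k => a' ((c j).scope k)] : Fin 2 → Fin (c j).rel.arity → D) l i) =
        fun k => g ![a ((c j).scope k), a' ((c j).scope k)] := by
      funext i
      congr 1
      funext l
      fin_cases l <;> rfl
    rwa [heq] at this
  · have hg : ∀ a b c : D, g ![a, b, c] = if b = c then b else a := by
      intro a b c
      split_ifs with hbc
      · subst hbc
        exact (h1 b a).2.2
      · by_cases hab : a = b
        · subst hab
          exact (h1 a c).1
        · by_cases hac : a = c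
          · subst hac
            exact (h1 a b).2.1
          · exact h2 a b c hab hac hbc
    refine ⟨fun i a b => g ![s i, a, b], ?_, ?_, ?_, ?_⟩
    · intro i a b
      simp only [hg]
      split_ifs <;> simp_all
    · intro i a b c
      simp only [hg]
      split_ifs <;> simp_all
    · intro i a
      simp [hg]
    · intro j a a' ha ha'
      have := hpol _ (c j).mem ![fun k => s ((c j).scope k), fun k => a ((c j).scope k),
        fun k => a' ((c j).scope k)] (by
        intro l
        fin_cases l
        · exact hs j
        · exact ha
        · exact ha')
      have heq : (fun i => g fun l => (![fun k => s ((c j).scope k), fun k => a ((c j).scope k),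
          fun k => a' ((c j).scope k)] : Fin 3 → Fin (c j).rel.arity → D) l i) =
          fun k => g ![s ((c j).scope k), a ((c j).scope k), a' ((c j).scope k)] := by
        funext i
        congr 1
        funext l
        fin_cases l <;> rfl
      rwa [heq] at this

theorem card_vars_le {D : Finset ℚ} {Γ : Set (DomRelation D)} {n : ℕ}
    {p : MvPolynomial (Fin n) ℚ} {c : Constraint Γ n} (h : Represents p c) :
    p.vars.card ≤ c.rel.arity := by
  classical
  have : p.vars ⊆ Finset.univ.image c.scope := by
    intro i hi
    obtain ⟨k, hk⟩ := h.1 i hi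
    exact Finset.mem_image.2 ⟨k, Finset.mem_univ _, hk⟩
  refine (Finset.card_le_card this).trans (Finset.card_image_le.trans ?_)
  simp

/-! ### Derivability of low-degree consequences for a constraint language -/

section Language

variable {D : Finset ℚ} {Γ : Set (DomRelation D)} {n : ℕ} {ι : Type}
  {f : ι → MvPolynomial (Fin n) ℚ} {Z M r Δ e k b : ℕ}

theorem mem_level_of_satisfiable (hΓ : SemilatticeClosed Γ ∨ DualDiscriminatorClosed Γ)
    (hΓr : ∀ R ∈ Γ, R.arity ≤ r) {c : ι → Constraint Γ n} (hfc : ∀ j, Represents (f j) (c j))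
    (hΔ : ∀ j, (f j).totalDegree ≤ Δ) (hA : DomainOrder.Admissible D Z M r Δ e k b)
    (s : Fin n → D) (hs : ∀ j, eval (fun i => (s i : ℚ)) (f j) = 0)
    {p : MvPolynomial (Fin n) ℚ} (hp : p.totalDegree ≤ e)
    (hp0 : ∀ a : Fin n → D, (∀ j, eval (fun i => (a i : ℚ)) (f j) = 0) →
      eval (fun i => (a i : ℚ)) p = 0) :
    p ∈ level (domainSystem D f) k b (DomainOrder.closureLevel D n + 1) := by
  obtain ⟨op, h1, h2, h3, h4⟩ := exists_semilattice_ops hΓ c s fun j => ((hfc j).2 s).1 (hs j)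
  let O := DomainOrder.ofOps op h1 h2 h3
  refine O.mem_level_of_vanishes_on_solutions hA
    (fun j => (card_vars_le (hfc j)).trans (hΓr _ (c j).mem)) hΔ ?_ hp ?_
  · intro j a a' ha ha'
    exact ((hfc j).2 _).2 (h4 j a a' (((hfc j).2 a).1 ha) (((hfc j).2 a').1 ha'))
  · intro a ha
    exact hp0 a ha

/-- Satisfiability can be dropped: a maximal satisfiable subsystem already implies that some
remaining `f j` is nonzero, and the inverse of `f j` on the domain turns this into a derivation of
any `p`. The enlarged parameter `e + r * D.card + Δ` covers the degree of `p * (1 - g * f j)`. -/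
theorem mem_level_of_language [Fintype ι] (hΓ : SemilatticeClosed Γ ∨ DualDiscriminatorClosed Γ)
    (hΓr : ∀ R ∈ Γ, R.arity ≤ r) {c : ι → Constraint Γ n} (hfc : ∀ j, Represents (f j) (c j))
    (hΔ : ∀ j, (f j).totalDegree ≤ Δ)
    (hA : DomainOrder.Admissible D Z M r Δ (e + r * D.card + Δ) k b)
    {p : MvPolynomial (Fin n) ℚ} (hp : p.totalDegree ≤ e)
    (hp0 : ∀ a : Fin n → D, (∀ j, eval (fun i => (a i : ℚ)) (f j) = 0) →
      eval (fun i => (a i : ℚ)) p = 0) :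
    p ∈ level (domainSystem D f) k b (DomainOrder.closureLevel D n + 1) := by
  classical
  by_cases hsat : ∃ s : Fin n → D, ∀ j, eval (fun i => (s i : ℚ)) (f j) = 0
  · obtain ⟨s, hs⟩ := hsat
    exact mem_level_of_satisfiable hΓ hΓr hfc hΔ hA s hs (by omega) hp0
  push Not at hsat
  let sat : Finset ι → Prop := fun J => ∃ s : Fin n → D, ∀ j ∈ J, eval (fun i => (s i : ℚ)) (f j) = 0
  obtain ⟨ρ, hρ⟩ := hA.nonempty
  -- The empty subsystem is satisfied by a constant assignment, so a satisfiable subsystem of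
  -- maximal cardinality exists.
  obtain ⟨J, hJ, hmax⟩ := Finset.exists_max_image (Finset.univ.filter sat) Finset.card
    ⟨∅, Finset.mem_filter.2 ⟨Finset.mem_univ _, fun _ => ⟨ρ, hρ⟩, by simp⟩⟩
  obtain ⟨-, s, hs⟩ := Finset.mem_filter.1 hJ
  obtain ⟨j, hj⟩ := hsat s
  have hjJ : j ∉ J := fun h => hj (hs j h)
  have hunsat : ∀ a : Fin n → D, (∀ j' ∈ J, eval (fun i => (a i : ℚ)) (f j') = 0) →
      eval (fun i => (a i : ℚ)) (f j) ≠ 0 := by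
    intro a ha h0
    have h1 : insert j J ∈ Finset.univ.filter sat := by
      refine Finset.mem_filter.2 ⟨Finset.mem_univ _, a, ?_⟩
      intro j' hj'
      rcases Finset.mem_insert.1 hj' with rfl | hj'
      · exact h0
      · exact ha j' hj'
    have h2 := hmax _ h1
    rw [Finset.card_insert_of_notMem hjJ] at h2
    omega
  have hrj : (f j).vars.card ≤ r := (card_vars_le (hfc j)).trans (hΓr _ (c j).mem)
  obtain ⟨g, hgd, hg⟩ := exists_inverse D (f j)
  have hgr : g.totalDegree ≤ r * D.card := hgd.trans (Nat.mul_le_mul_right _ hrj)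
  have hDpos : 1 ≤ D.card := Finset.card_pos.2 hA.nonempty
  have hk := hA.degree
  have hk2 : (2 * (e + r * D.card + Δ) + 2 * r + 2) * D.card = 2 * (e * D.card) +
    2 * (r * D.card * D.card) + 2 * (Δ * D.card) + 2 * (r * D.card) + 2 * D.card := by ring
  have he : e ≤ e * D.card := Nat.le_mul_of_pos_right _ hDpos
  have hrr : r * D.card ≤ r * D.card * D.card := Nat.le_mul_of_pos_right _ hDpos
  have d1 := totalDegree_mul p g
  have d2 := totalDegree_mul (p * g) (f j)
  have d3 := hΔ j
  -- On the solutions of the subsystem `J` the constraint `j` fails, so `g * f j = 1` there and the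
  -- first summand vanishes. The second is a multiple of an axiom.
  have hsplit : p = p * (1 - g * f j) + p * g * f j := by ring
  rw [hsplit]
  refine add_mem ?_ (mul_input_mem_level (P := domainSystem D f) (Sum.inl j) ?_ _)
  swap
  · change (p * g).totalDegree + (f j).totalDegree ≤ k
    omega
  let f' : J → MvPolynomial (Fin n) ℚ := fun j' => f j'
  have hsub : ∀ j', ∃ l, domainSystem D f' j' = domainSystem D f l := by
    rintro (j' | i)
    · exact ⟨Sum.inl j', rfl⟩
    · exact ⟨Sum.inr i, rfl⟩
  refine level_comp_le hsub _ (mem_level_of_satisfiable hΓ hΓr (c := fun j' : J => c j')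
    (fun j' => hfc j') (fun j' => hΔ j') hA s (fun j' => hs j' j'.2) ?_ ?_)
  · have d4 := totalDegree_mul p (1 - g * f j)
    have d5 := totalDegree_sub 1 (g * f j)
    have d6 := totalDegree_mul g (f j)
    rw [totalDegree_one] at d5
    have d7 : (1 - g * f j).totalDegree ≤ r * D.card + Δ := d5.trans (max_le (by omega) (by omega))
    omega
  · intro a ha
    have h0 := hunsat a fun j' hj' => ha ⟨j', hj'⟩
    rw [map_mul, map_sub, map_one, map_mul, hg _ fun i => (a i).2, inv_mul_cancel₀ h0, sub_self,
      mul_zero]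

end Language

end PCSoS

end

noncomputable section

namespace PCSoS

open MvPolynomial Classical

/-! ### Standard monomials of a finite set of points -/

section Standard

variable {n : ℕ} {Y : Type} (pt : Y → Fin n → ℚ)

/-- The order of exponent vectors in the graded lexicographic order. -/
def MonLT (m m' : Fin n →₀ ℕ) : Prop :=
  (MonomialOrder.degLex (σ := Fin n)).toSyn m < (MonomialOrder.degLex (σ := Fin n)).toSyn m'

theorem wellFounded_monLT : WellFounded (MonLT (n := n)) :=
  InvImage.wf _ wellFounded_lt

theorem monLT_trans {m m' m'' : Fin n →₀ ℕ} (h : MonLT m m') (h' : MonLT m' m'') : MonLT m m'' :=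
  lt_trans (α := (MonomialOrder.degLex (σ := Fin n)).syn) h h'

theorem degree_le_of_monLT {m m' : Fin n →₀ ℕ} (h : MonLT m m') : m.degree ≤ m'.degree :=
  Finsupp.DegLex.monotone_degree (MonomialOrder.degLex_lt_iff.1 h).le

/-- The values of a monomial at the points. -/
def monVal (m : Fin n →₀ ℕ) (y : Y) : ℚ := eval (pt y) (monomial m 1)

/-- A monomial is standard if on the points it is not a combination of smaller monomials. -/
def IsStandard (m : Fin n →₀ ℕ) : Prop :=
  monVal pt m ∉ Submodule.span ℚ (monVal pt '' {m' | MonLT m' m})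

theorem monVal_mem_span (m : Fin n →₀ ℕ) : monVal pt m ∈
    Submodule.span ℚ (monVal pt '' {m' | IsStandard pt m' ∧ (m' = m ∨ MonLT m' m)}) := by
  induction m using wellFounded_monLT.induction with
  | _ m ih =>
    by_cases hm : IsStandard pt m
    · exact Submodule.subset_span ⟨m, ⟨hm, Or.inl rfl⟩, rfl⟩
    · rw [IsStandard, not_not] at hm
      refine Submodule.span_le.2 ?_ hm
      rintro _ ⟨m', hlt, rfl⟩
      refine Submodule.span_mono (Set.image_mono ?_) (ih m' hlt)
      rintro m'' ⟨h1, rfl | h2⟩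
      · exact ⟨h1, Or.inr hlt⟩
      · exact ⟨h1, Or.inr (monLT_trans h2 hlt)⟩

/-- The standard monomials of degree at most `k`. -/
def standardMonomials (k : ℕ) : Finset (Fin n →₀ ℕ) := (monomials n k).filter (IsStandard pt)

theorem mem_standardMonomials {k : ℕ} {m : Fin n →₀ ℕ} :
    m ∈ standardMonomials pt k ↔ m.degree ≤ k ∧ IsStandard pt m := by
  rw [standardMonomials, Finset.mem_filter, mem_monomials]

/-- The largest monomial with a nonzero coefficient in a relation would be a combination of smaller
ones, hence not standard. -/
theorem linearIndependent_standard (s : Finset (Fin n →₀ ℕ)) (hs : ∀ m ∈ s, IsStandard pt m) :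
    LinearIndependent ℚ fun m : s => monVal pt m := by
  rw [Fintype.linearIndependent_iff]
  intro g hg
  by_contra hcon
  push Not at hcon
  obtain ⟨m₀, hm₀⟩ := hcon
  obtain ⟨m, hm, hmax⟩ := Finset.exists_max_image (Finset.univ.filter fun m : s => g m ≠ 0)
    (fun m => (MonomialOrder.degLex (σ := Fin n)).toSyn m)
    ⟨m₀, Finset.mem_filter.2 ⟨Finset.mem_univ _, hm₀⟩⟩
  have hgm := (Finset.mem_filter.1 hm).2
  refine hs m m.2 ?_
  have hsum : monVal pt m = ∑ m' ∈ Finset.univ.erase m, (-(g m)⁻¹ * g m') • monVal pt m' := by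
    rw [← Finset.add_sum_erase _ _ (Finset.mem_univ m)] at hg
    simp only [mul_smul, ← Finset.smul_sum]
    rw [← eq_neg_iff_add_eq_zero, ← neg_eq_iff_eq_neg] at hg
    rw [← hg, neg_smul, smul_neg, neg_neg, smul_smul, inv_mul_cancel₀ hgm, one_smul]
  rw [hsum]
  refine sum_mem fun m' hm' => ?_
  by_cases h0 : g m' = 0
  · rw [h0, mul_zero, zero_smul]
    exact zero_mem _
  refine Submodule.smul_mem _ _ (Submodule.subset_span ⟨m', ?_, rfl⟩)
  refine lt_of_le_of_ne (hmax m' (Finset.mem_filter.2 ⟨Finset.mem_univ _, h0⟩)) fun h => ?_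
  exact (Finset.mem_erase.1 hm').1 (Subtype.ext ((MonomialOrder.degLex (σ := Fin n)).toSyn.injective h))

/-- `z` is a common denominator of the coordinates, and `2 ^ c` a bound for it and for the
resulting integers. -/
structure PointBound (z c : ℕ) : Prop where
  ne_zero : z ≠ 0
  le : z ≤ 2 ^ c
  coord : ∀ y i, ∃ t : ℤ, (z : ℚ) * pt y i = t ∧ |t| ≤ 2 ^ c

variable {pt} {z c : ℕ}

theorem PointBound.exists_int (h : PointBound pt z c) {k : ℕ} {m : Fin n →₀ ℕ}
    (hm : m.degree ≤ k) (y : Y) :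
    ∃ t : ℤ, (z : ℚ) ^ k * monVal pt m y = t ∧ |t| ≤ 2 ^ (c * k) := by
  choose t ht htc using h.coord y
  refine ⟨z ^ (k - m.degree) * ∏ i, t i ^ m i, ?_, ?_⟩
  · push_cast
    simp only [← ht, mul_pow]
    rw [Finset.prod_mul_distrib, Finset.prod_pow_eq_pow_sum, ← Finsupp.degree_eq_sum, ← mul_assoc,
      ← pow_add, Nat.sub_add_cancel hm, monVal, eval_monomial, one_mul,
      Finsupp.prod_fintype _ _ fun _ => pow_zero _]
  · rw [abs_mul, abs_pow, Finset.abs_prod, Nat.abs_cast]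
    have h1 : ((z : ℤ)) ^ (k - m.degree) ≤ (2 ^ c) ^ (k - m.degree) :=
      pow_le_pow_left₀ (by positivity) (by exact_mod_cast h.le) _
    have h2 : ∏ i, |t i ^ m i| ≤ (2 ^ c) ^ m.degree := by
      rw [Finsupp.degree_eq_sum, ← Finset.prod_pow_eq_pow_sum]
      refine Finset.prod_le_prod (fun _ _ => abs_nonneg _) fun i _ => ?_
      rw [abs_pow]
      exact pow_le_pow_left₀ (abs_nonneg _) (htc i) _
    calc _ ≤ ((2 : ℤ) ^ c) ^ (k - m.degree) * (2 ^ c) ^ m.degree :=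
          mul_le_mul h1 h2 (Finset.prod_nonneg fun _ _ => abs_nonneg _) (by positivity)
      _ = 2 ^ (c * k) := by rw [← pow_add, Nat.sub_add_cancel hm, pow_mul]

/-- A bound for the bit length of inverses of the evaluation matrix of standard monomials. -/
def standardBits (n k x c : ℕ) : ℕ := inverseBits ((n + 1) ^ k) x (c * k)

/-- Interpolation at the points by standard monomials. -/
theorem PointBound.exists_leftInverse [Fintype Y] (h : PointBound pt z c) {x : ℕ}
    (hx : Fintype.card Y ≤ 2 ^ x) (k : ℕ) :
    ∃ (d : ℤ) (L : (Fin n →₀ ℕ) → Y → ℤ), d ≠ 0 ∧ |d| ≤ 2 ^ standardBits n k x c ∧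
      (∀ m y, |L m y| ≤ 2 ^ standardBits n k x c) ∧
      ∀ (K : Type) [Field K] [CharZero K] (a : (Fin n →₀ ℕ) → K), ∀ m ∈ standardMonomials pt k,
        (d : K) * a m = ∑ y, (L m y : K) *
          ((z : K) ^ k * ∑ m' ∈ standardMonomials pt k, a m' * (monVal pt m' y : ℚ)) := by
  set s := standardMonomials pt k with hs
  choose v hv hvb using fun (m : s) (y : Y) =>
    h.exists_int (mem_standardMonomials pt |>.1 m.2).1 y
  have hli : LinearIndependent ℚ fun (m : s) (y : Y) => (v m y : ℚ) := by
    have h1 := linearIndependent_standard pt s fun m hm => ((mem_standardMonomials pt).1 hm).2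
    have hz : IsUnit ((z : ℚ) ^ k) := (pow_ne_zero k (Nat.cast_ne_zero.2 h.ne_zero)).isUnit
    have h2 := h1.units_smul fun _ => hz.unit
    convert h2 using 1
    funext m y
    rw [← hv]
    rfl
  have hcard : Fintype.card s ≤ (n + 1) ^ k := by
    rw [Fintype.card_coe]
    exact (Finset.card_filter_le _ _).trans (card_monomials_le n k)
  obtain ⟨d, L, hd, hdb, hLb, hL⟩ := exists_integer_leftInverse v hcard hx hvb hli
  refine ⟨d, fun m y => if hm : m ∈ s then L ⟨m, hm⟩ y else 0, hd, hdb, ?_, ?_⟩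
  · intro m y
    dsimp only
    split_ifs
    · exact hLb _ _
    · simp
  · intro K _ _ a m hm
    have := leftInverse_apply hL (fun m : s => a m) ⟨m, hm⟩
    rw [this]
    refine Finset.sum_congr rfl fun y _ => ?_
    simp only [hm, dif_pos]
    rw [← Finset.sum_coe_sort s]
    congr 1
    rw [Finset.mul_sum]
    refine Finset.sum_congr rfl fun m' _ => ?_
    have h3 := congrArg (Rat.cast : ℚ → K) (hv m' y)
    push_cast at h3
    rw [← h3]
    ring

/-- A bound for the bit length of the coefficients of reduced polynomials. -/
def reducedBits (n k x c : ℕ) : ℕ := standardBits n k x c + (n + 1) ^ k + x + c * k + 1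

/-- The properties of a reduced integral polynomial with leading monomial `m`. -/
structure IsReduced (pt : Y → Fin n → ℚ) (m : Fin n →₀ ℕ) (g : MvPolynomial (Fin n) ℚ) : Prop where
  integral : g ∈ integralPolys n
  vanishes : ∀ y, eval (pt y) g = 0
  coeff_ne_zero : g.coeff m ≠ 0
  support : ∀ m' ∈ g.support, m' = m ∨ IsStandard pt m' ∧ MonLT m' m

/-- On the points, a nonstandard monomial is a combination of smaller standard ones. Its
coefficients are determined by values at the points, so the left inverse shows that the factor `d`
makes them integers and bounds them. The polynomial is `d` times the monomial minus this
combination. -/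
theorem PointBound.exists_reduced [Fintype Y] (h : PointBound pt z c) {x : ℕ} (hx : Fintype.card Y ≤ 2 ^ x)
    {k : ℕ} {m : Fin n →₀ ℕ} (hm : ¬ IsStandard pt m) (hk : m.degree ≤ k) :
    ∃ g, IsReduced pt m g ∧ l1 (toReal g) ≤ 2 ^ reducedBits n k x c := by
  obtain ⟨d, L, hd, hdb, hLb, hL⟩ := h.exists_leftInverse hx k
  set s := standardMonomials pt k with hs
  have hspan := monVal_mem_span pt m
  rw [Finsupp.mem_span_image_iff_linearCombination] at hspan
  obtain ⟨a, ha, hsum⟩ := hspan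
  have hasupp : ∀ m', a m' ≠ 0 → IsStandard pt m' ∧ MonLT m' m := by
    intro m' h0
    have h1 := (Finsupp.mem_supported _ _).1 ha (Finsupp.mem_support_iff.2 h0)
    refine ⟨h1.1, h1.2.resolve_left ?_⟩
    rintro rfl
    exact hm h1.1
  have hasub : a.support ⊆ s := by
    intro m' hm'
    obtain ⟨h1, h2⟩ := hasupp m' (Finsupp.mem_support_iff.1 hm')
    exact (mem_standardMonomials pt).2 ⟨(degree_le_of_monLT h2).trans hk, h1⟩
  have hval : ∀ y, monVal pt m y = ∑ m' ∈ s, a m' * monVal pt m' y := by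
    intro y
    rw [← hsum, Finsupp.linearCombination_apply, Finsupp.sum_of_support_subset _ hasub _ (by simp),
      Finset.sum_apply]
    rfl
  have hms : m ∉ s := fun hms => hm ((mem_standardMonomials pt).1 hms).2
  choose t ht htb using h.exists_int hk
  have hintegral : ∀ m' ∈ s, (d : ℚ) * a m' = ((∑ y, L m' y * t y : ℤ) : ℚ) := by
    intro m' hm'
    rw [hL ℚ a m' hm']
    push_cast
    refine Finset.sum_congr rfl fun y _ => ?_
    rw [← ht, hval]
  have hcardY : (Fintype.card Y : ℝ) ≤ 2 ^ x := by exact_mod_cast hx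
  have hbd : ∀ m' ∈ s, |((d : ℚ) * a m' : ℝ)| ≤ 2 ^ (x + standardBits n k x c + c * k) := by
    intro m' hm'
    have h1 : ((d : ℝ) * (a m' : ℝ)) = ((∑ y, L m' y * t y : ℤ) : ℝ) := by
      exact_mod_cast congrArg (Rat.cast : ℚ → ℝ) (hintegral m' hm')
    rw [Rat.cast_intCast, h1]
    push_cast
    calc |∑ y, (L m' y : ℝ) * t y| ≤ ∑ y, |(L m' y : ℝ) * t y| := Finset.abs_sum_le_sum_abs _ _
      _ ≤ ∑ _y : Y, (2 : ℝ) ^ standardBits n k x c * 2 ^ (c * k) :=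
          Finset.sum_le_sum fun y _ => by
            rw [abs_mul]
            exact mul_le_mul (by exact_mod_cast hLb m' y) (by exact_mod_cast htb y) (abs_nonneg _)
              (by positivity)
      _ = Fintype.card Y * ((2 : ℝ) ^ standardBits n k x c * 2 ^ (c * k)) := by simp
      _ ≤ 2 ^ x * ((2 : ℝ) ^ standardBits n k x c * 2 ^ (c * k)) := by gcongr
      _ = _ := by rw [pow_add, pow_add]; ring
  let g : MvPolynomial (Fin n) ℚ := monomial m (d : ℚ) - ∑ m' ∈ s, monomial m' ((d : ℚ) * a m')
  have hcoeff : ∀ m', g.coeff m' = (if m = m' then (d : ℚ) else 0) -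
      if m' ∈ s then (d : ℚ) * a m' else 0 := by
    intro m'
    simp only [g, coeff_sub, coeff_monomial, coeff_sum, Finset.sum_ite_eq']
  refine ⟨g, ⟨?_, ?_, ?_, ?_⟩, ?_⟩
  · refine sub_mem (monomial_mem_integralPolys _ _) (sum_mem fun m' hm' => ?_)
    rw [hintegral m' hm']
    exact monomial_mem_integralPolys _ _
  · intro y
    have hmon : ∀ (m' : Fin n →₀ ℕ) (q : ℚ), eval (pt y) (monomial m' q) = q * monVal pt m' y := by
      intro m' q
      rw [monVal, eval_monomial, eval_monomial, one_mul]
    rw [map_sub, map_sum, hmon, hval]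
    simp only [hmon]
    rw [Finset.mul_sum, sub_eq_zero]
    exact Finset.sum_congr rfl fun m' _ => by ring
  · rw [hcoeff, if_pos rfl, if_neg hms, sub_zero]
    exact_mod_cast hd
  · intro m' hm'
    rw [mem_support_iff, hcoeff] at hm'
    by_cases heq : m = m'
    · exact Or.inl heq.symm
    · right
      rw [if_neg heq, zero_sub, neg_ne_zero] at hm'
      split_ifs at hm' with h1
      · exact hasupp m' (right_ne_zero_of_mul hm')
      · exact absurd rfl hm'
  · have hcards : (s.card : ℝ) ≤ 2 ^ ((n + 1) ^ k) := by
      have : s.card ≤ (n + 1) ^ k := (Finset.card_filter_le _ _).trans (card_monomials_le n k)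
      exact_mod_cast this.trans Nat.lt_two_pow_self.le
    have hd1 : |(d : ℝ)| ≤ 2 ^ standardBits n k x c := by exact_mod_cast hdb
    simp only [g, toReal_sub, toReal_sum, toReal_monomial]
    refine (l1_sub_le _ _).trans ?_
    rw [l1_monomial]
    have h1 : l1 (∑ m' ∈ s, monomial m' (((d : ℚ) * a m' : ℚ) : ℝ)) ≤
        2 ^ ((n + 1) ^ k) * 2 ^ (x + standardBits n k x c + c * k) := by
      refine (l1_sum_le _ _).trans ?_
      calc _ ≤ ∑ _m' ∈ s, (2 : ℝ) ^ (x + standardBits n k x c + c * k) :=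
            Finset.sum_le_sum fun m' hm' => by
              rw [l1_monomial, Rat.cast_mul]
              exact hbd m' hm'
        _ = s.card * (2 : ℝ) ^ (x + standardBits n k x c + c * k) := by simp
        _ ≤ _ := by gcongr
    have h2 : |(((d : ℤ) : ℚ) : ℝ)| ≤ 2 ^ (standardBits n k x c + (n + 1) ^ k + x + c * k) := by
      rw [Rat.cast_intCast]
      exact hd1.trans (pow_le_pow_right₀ (by norm_num) (by omega))
    rw [← pow_add] at h1
    rw [reducedBits, pow_succ]
    have h3 : (n + 1) ^ k + (x + standardBits n k x c + c * k) =
      standardBits n k x c + (n + 1) ^ k + x + c * k := by ring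
    rw [h3] at h1
    linarith

/-- A real polynomial all of whose monomials are standard is determined by its values. -/
theorem PointBound.coeff_eq [Fintype Y] (h : PointBound pt z c) {x : ℕ} (hx : Fintype.card Y ≤ 2 ^ x)
    (k : ℕ) : ∃ (d : ℤ) (L : (Fin n →₀ ℕ) → Y → ℤ), d ≠ 0 ∧ |d| ≤ 2 ^ standardBits n k x c ∧
      (∀ m y, |L m y| ≤ 2 ^ standardBits n k x c) ∧
      ∀ p : MvPolynomial (Fin n) ℝ, (∀ m ∈ p.support, IsStandard pt m) → p.totalDegree ≤ k →
        ∀ m ∈ standardMonomials pt k, (d : ℝ) * p.coeff m =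
          ∑ y, (L m y : ℝ) * ((z : ℝ) ^ k * eval (fun i => (pt y i : ℝ)) p) := by
  obtain ⟨d, L, hd, hdb, hLb, hL⟩ := h.exists_leftInverse hx k
  refine ⟨d, L, hd, hdb, hLb, fun p hp hk m hm => ?_⟩
  rw [hL ℝ (fun m => p.coeff m) m hm]
  refine Finset.sum_congr rfl fun y _ => ?_
  congr 2
  have hsub : p.support ⊆ standardMonomials pt k := fun m hm =>
    (mem_standardMonomials pt).2 ⟨(degree_le_totalDegree hm).trans hk, hp m hm⟩
  conv_rhs => rw [p.as_sum, map_sum]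
  rw [← Finset.sum_subset hsub]
  · refine Finset.sum_congr rfl fun m' _ => ?_
    rw [eval_monomial, monVal, eval_monomial, one_mul, Finsupp.prod_fintype _ _ fun _ => pow_zero _,
      Finsupp.prod_fintype _ _ fun _ => pow_zero _]
    push_cast
    rfl
  · intro m' _ hm'
    rw [notMem_support_iff.1 hm', zero_mul]

theorem PointBound.eq_zero [Fintype Y] (h : PointBound pt z c) {p : MvPolynomial (Fin n) ℝ}
    (hp : ∀ m ∈ p.support, IsStandard pt m) (h0 : ∀ y, eval (fun i => (pt y i : ℝ)) p = 0) :
    p = 0 := by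
  obtain ⟨d, L, hd, -, -, hL⟩ := h.coeff_eq (x := Fintype.card Y) Nat.lt_two_pow_self.le
    p.totalDegree
  ext m
  by_cases hm : m ∈ p.support
  · have := hL p hp le_rfl m ((mem_standardMonomials pt).2 ⟨degree_le_totalDegree hm, hp m hm⟩)
    simp only [h0, mul_zero, Finset.sum_const_zero] at this
    rw [coeff_zero]
    exact (mul_eq_zero.1 this).resolve_left (by exact_mod_cast hd)
  · rw [notMem_support_iff.1 hm, coeff_zero]

/-- A family of reduced polynomials for all nonstandard monomials. -/
def IsReducedFamily (pt : Y → Fin n → ℚ) (G : (Fin n →₀ ℕ) → MvPolynomial (Fin n) ℚ) : Prop :=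
  ∀ m, ¬ IsStandard pt m → IsReduced pt m (G m)

/-- The nonstandard monomials of degree at most `k`. -/
def nonstandardMonomials (pt : Y → Fin n → ℚ) (k : ℕ) : Finset (Fin n →₀ ℕ) :=
  (monomials n k).filter fun m => ¬ IsStandard pt m

/-- The part of `p` in the span of the reduced polynomials. -/
def reduction (pt : Y → Fin n → ℚ) (G : (Fin n →₀ ℕ) → MvPolynomial (Fin n) ℚ) (k : ℕ)
    (p : MvPolynomial (Fin n) ℝ) : MvPolynomial (Fin n) ℝ :=
  ∑ m ∈ nonstandardMonomials pt k, C (p.coeff m / ((G m).coeff m : ℚ)) * toReal (G m)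

variable {G : (Fin n →₀ ℕ) → MvPolynomial (Fin n) ℚ}

theorem mem_nonstandardMonomials {k : ℕ} {m : Fin n →₀ ℕ} :
    m ∈ nonstandardMonomials pt k ↔ m.degree ≤ k ∧ ¬ IsStandard pt m := by
  rw [nonstandardMonomials, Finset.mem_filter, mem_monomials]

theorem IsReduced.totalDegree_le {m : Fin n →₀ ℕ} {g : MvPolynomial (Fin n) ℚ}
    (h : IsReduced pt m g) : g.totalDegree ≤ m.degree := by
  refine totalDegree_le_of_support fun m' hm' => ?_
  rcases h.support m' hm' with rfl | h'
  · exact le_rfl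
  · exact degree_le_of_monLT h'.2

theorem totalDegree_reduction_le (hG : IsReducedFamily pt G) (k : ℕ)
    (p : MvPolynomial (Fin n) ℝ) : (reduction pt G k p).totalDegree ≤ k := by
  refine totalDegree_finsetSum_le fun m hm => (totalDegree_mul _ _).trans ?_
  rw [totalDegree_C, zero_add, totalDegree_toReal]
  obtain ⟨h1, h2⟩ := mem_nonstandardMonomials.1 hm
  exact (hG m h2).totalDegree_le.trans h1

theorem eval_reduction (hG : IsReducedFamily pt G) (k : ℕ) (p : MvPolynomial (Fin n) ℝ) (y : Y) :
    eval (fun i => (pt y i : ℝ)) (reduction pt G k p) = 0 := by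
  rw [reduction, map_sum]
  refine Finset.sum_eq_zero fun m hm => ?_
  rw [map_mul, eval_toReal, (hG m (mem_nonstandardMonomials.1 hm).2).vanishes y]
  simp

theorem isStandard_of_mem_support_sub_reduction (hG : IsReducedFamily pt G) {k : ℕ}
    {p : MvPolynomial (Fin n) ℝ} (hp : p.totalDegree ≤ k) {m : Fin n →₀ ℕ}
    (hm : m ∈ (p - reduction pt G k p).support) : IsStandard pt m := by
  by_contra hcon
  have hdeg : m.degree ≤ k := (degree_le_totalDegree hm).trans
    ((totalDegree_sub _ _).trans (max_le hp (totalDegree_reduction_le hG k p)))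
  refine mem_support_iff.1 hm ?_
  rw [coeff_sub, reduction, coeff_sum, Finset.sum_eq_single m]
  · rw [coeff_C_mul, coeff_toReal, div_mul_cancel₀, sub_self]
    exact_mod_cast (hG m hcon).coeff_ne_zero
  · intro m' hm' hne
    rw [coeff_C_mul, coeff_toReal]
    have : (G m').coeff m = 0 := by
      by_contra h0
      rcases (hG m' (mem_nonstandardMonomials.1 hm').2).support m (mem_support_iff.2 h0) with h | h
      · exact hne h.symm
      · exact hcon h.1
    simp [this]
  · intro h
    exact absurd (mem_nonstandardMonomials.2 ⟨hdeg, hcon⟩) h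

/-- The difference has only standard monomials and vanishes at all points, so it is zero. -/
theorem PointBound.eq_reduction [Fintype Y] (h : PointBound pt z c) (hG : IsReducedFamily pt G) {k : ℕ}
    {p : MvPolynomial (Fin n) ℝ} (hp : p.totalDegree ≤ k)
    (h0 : ∀ y, eval (fun i => (pt y i : ℝ)) p = 0) : p = reduction pt G k p := by
  rw [← sub_eq_zero]
  refine h.eq_zero (fun m hm => isStandard_of_mem_support_sub_reduction hG hp hm) fun y => ?_
  rw [map_sub, h0, eval_reduction hG, sub_zero]

/-- Expand `p` by `reduction`. A standard monomial occurs in `G m'` only strictly below `m'`, and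
`m'` contributes only if it occurs in `p`. A standard leading monomial would therefore have
coefficient zero. -/
theorem PointBound.not_isStandard_degree [Fintype Y] (h : PointBound pt z c) (hG : IsReducedFamily pt G)
    {p : MvPolynomial (Fin n) ℝ} (hp : p ≠ 0) (h0 : ∀ y, eval (fun i => (pt y i : ℝ)) p = 0) :
    ¬ IsStandard pt ((MonomialOrder.degLex (σ := Fin n)).degree p) := by
  set m := (MonomialOrder.degLex (σ := Fin n)).degree p with hm
  intro hstd
  have hcoeff : p.coeff m ≠ 0 := MonomialOrder.coeff_degree_ne_zero_iff.2 hp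
  apply hcoeff
  rw [h.eq_reduction hG le_rfl h0, reduction, coeff_sum]
  refine Finset.sum_eq_zero fun m' hm' => ?_
  rw [coeff_C_mul, coeff_toReal]
  by_cases hpm : p.coeff m' = 0
  · rw [hpm, zero_div, zero_mul]
  · have : (G m').coeff m = 0 := by
      by_contra hne
      have hnot := (mem_nonstandardMonomials.1 hm').2
      rcases (hG m' hnot).support m (mem_support_iff.2 hne) with h1 | h1
      · exact hnot (h1 ▸ hstd)
      · have h2 := (MonomialOrder.degLex (σ := Fin n)).le_degree (mem_support_iff.2 hpm)
        exact absurd h1.2 (not_lt.2 h2)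
    simp [this]

theorem IsReduced.degree_eq {m : Fin n →₀ ℕ} {g : MvPolynomial (Fin n) ℚ}
    (h : IsReduced pt m g) : (MonomialOrder.degLex (σ := Fin n)).degree (toReal g) = m := by
  apply (MonomialOrder.degLex (σ := Fin n)).toSyn.injective
  apply le_antisymm
  · rw [MonomialOrder.degree_le_iff]
    intro m' hm'
    rw [support_toReal] at hm'
    rcases h.support m' hm' with rfl | h'
    · exact le_rfl
    · exact h'.2.le
  · refine MonomialOrder.le_degree ?_
    rw [support_toReal]
    exact mem_support_iff.2 h.coeff_ne_zero

theorem IsReduced.ne_zero {m : Fin n →₀ ℕ} {g : MvPolynomial (Fin n) ℚ}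
    (h : IsReduced pt m g) : g ≠ 0 := by
  rintro rfl
  exact h.coeff_ne_zero (by simp)

theorem IsReduced.totalDegree_eq {m : Fin n →₀ ℕ} {g : MvPolynomial (Fin n) ℚ}
    (h : IsReduced pt m g) : g.totalDegree = m.degree :=
  le_antisymm h.totalDegree_le (degree_le_totalDegree (mem_support_iff.2 h.coeff_ne_zero))

/-- The reduced polynomials of sufficiently large degree form a Gröbner basis. -/
theorem PointBound.isGroebnerBasis [Fintype Y] (h : PointBound pt z c) (hG : IsReducedFamily pt G)
    {D : Finset ℚ} (hD : ∀ y i, pt y i ∈ D) {K : ℕ} (hK : n * D.card ≤ K)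
    {I : Ideal (MvPolynomial (Fin n) ℝ)}
    (hI : ∀ p, p ∈ I ↔ ∀ y, eval (fun i => (pt y i : ℝ)) p = 0) :
    IsGroebnerBasis (toReal '' ((nonstandardMonomials pt K).image G : Finset _)) I := by
  set B := toReal '' (((nonstandardMonomials pt K).image G : Finset _) :
    Set (MvPolynomial (Fin n) ℚ)) with hB
  have hBmem : ∀ m, m.degree ≤ K → ¬ IsStandard pt m → toReal (G m) ∈ B := fun m h1 h2 =>
    ⟨G m, Finset.mem_coe.2 (Finset.mem_image_of_mem _ (mem_nonstandardMonomials.2 ⟨h1, h2⟩)), rfl⟩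
  have hBI : B ⊆ I := by
    rintro _ ⟨g, hg, rfl⟩
    obtain ⟨m, hm, rfl⟩ := Finset.mem_image.1 (Finset.mem_coe.1 hg)
    rw [SetLike.mem_coe, hI]
    intro y
    rw [eval_toReal, (hG m (mem_nonstandardMonomials.1 hm).2).vanishes y, Rat.cast_zero]
  have hB0 : ∀ g ∈ B, g ≠ 0 := by
    rintro _ ⟨g, hg, rfl⟩ h0
    obtain ⟨m, hm, rfl⟩ := Finset.mem_image.1 (Finset.mem_coe.1 hg)
    refine (hG m (mem_nonstandardMonomials.1 hm).2).ne_zero (toReal_injective ?_)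
    rw [h0, toReal_zero]
  have hlead : ∀ p ∈ I, p ≠ 0 → ∃ g ∈ B, g ≠ 0 ∧
      (MonomialOrder.degLex (σ := Fin n)).degree g ≤
        (MonomialOrder.degLex (σ := Fin n)).degree p := by
    intro p hp hp0
    have hns := h.not_isStandard_degree hG hp0 ((hI p).1 hp)
    set m := (MonomialOrder.degLex (σ := Fin n)).degree p with hm
    by_cases hdeg : m.degree ≤ K
    · refine ⟨_, hBmem m hdeg hns, hB0 _ (hBmem m hdeg hns), ?_⟩
      rw [(hG m hns).degree_eq]
    -- Beyond degree `n * D.card` some exponent reaches `D.card`. Then the leading monomial of the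
    -- domain polynomial of `x_i` divides `m`; it is nonstandard and its own degree is within the
    -- truncation.
    · obtain ⟨i, hi⟩ : ∃ i, D.card ≤ m i := by
        by_contra hcon
        push Not at hcon
        apply hdeg
        rw [Finsupp.degree_eq_sum]
        refine le_trans (Finset.sum_le_card_nsmul _ _ D.card fun i _ => (hcon i).le) ?_
        simpa using hK
      have hdom0 : ∀ y, eval (fun i => (pt y i : ℝ)) (toReal (domainPoly D i)) = 0 := by
        intro y
        rw [eval_toReal, (eval_domainPoly_eq_zero i).2 (hD y i), Rat.cast_zero]
      have hdomeq : toReal (domainPoly D i) = ∏ ρ ∈ D, (X i - C (ρ : ℝ)) := by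
        rw [domainPoly, toReal_prod]
        exact Finset.prod_congr rfl fun ρ _ => by simp
      have hmonic : (MonomialOrder.degLex (σ := Fin n)).Monic (toReal (domainPoly D i)) := by
        rw [hdomeq]
        exact MonomialOrder.Monic.prod fun ρ _ => MonomialOrder.monic_X_sub_C _ i (ρ : ℝ)
      have hdegdom : (MonomialOrder.degLex (σ := Fin n)).degree (toReal (domainPoly D i)) =
          Finsupp.single i D.card := by
        rw [hdomeq, MonomialOrder.degree_prod_of_regular]
        · simp [Finset.sum_congr rfl (fun (ρ : ℚ) _ =>
            MonomialOrder.degree_X_sub_C (MonomialOrder.degLex (σ := Fin n)) i (ρ : ℝ))]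
        · intro ρ _
          rw [MonomialOrder.monic_X_sub_C]
          exact isRegular_one
      have hns' := h.not_isStandard_degree hG hmonic.ne_zero hdom0
      rw [hdegdom] at hns'
      have hle : (Finsupp.single i D.card).degree ≤ K := by
        rw [Finsupp.degree_single]
        refine le_trans ?_ hK
        exact Nat.le_mul_of_pos_left _ (Fin.pos i)
      refine ⟨_, hBmem _ hle hns', hB0 _ (hBmem _ hle hns'), ?_⟩
      rw [(hG _ hns').degree_eq]
      exact Finsupp.single_le_iff.2 hi
  refine ⟨le_antisymm (Ideal.span_le.2 hBI) fun p hp => ?_, hlead⟩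
  -- The remainder of division by the basis lies in the ideal, but none of its monomials is
  -- divisible by a leading monomial of the basis, so it is zero.
  obtain ⟨q, r, hqr, -, hr⟩ := (MonomialOrder.degLex (σ := Fin n)).div_set (B := B)
    (fun g hg => (MonomialOrder.leadingCoeff_ne_zero_iff.2 (hB0 g hg)).isUnit) p
  have hq : Finsupp.linearCombination _ (fun b : B => (b : MvPolynomial (Fin n) ℝ)) q ∈
      Ideal.span B := by
    rw [Finsupp.linearCombination_apply]
    exact Submodule.sum_mem _ fun g _ => Ideal.mul_mem_left _ _ (Ideal.subset_span g.2)
  have hrI : r ∈ I := by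
    have : r = p - Finsupp.linearCombination _ (fun b : B => (b : MvPolynomial (Fin n) ℝ)) q := by
      rw [hqr]; ring
    rw [this]
    exact sub_mem hp (Ideal.span_le.2 hBI hq)
  have hr0 : r = 0 := by
    by_contra h0
    obtain ⟨g, hg, -, hle⟩ := hlead r hrI h0
    exact hr _ (MonomialOrder.degree_mem_support h0) g hg hle
  rw [hqr, hr0, add_zero]
  exact hq

/-- A bound for the bit length of the interpolation polynomials. -/
def interpolationBits (n k x c : ℕ) : ℕ := standardBits n k x c + (n + 1) ^ k + c * k

/-- Interpolation on the points by polynomials with bounded coefficients. -/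
theorem PointBound.exists_interpolation [Fintype Y] (h : PointBound pt z c) (hG : IsReducedFamily pt G) {x : ℕ}
    (hx : Fintype.card Y ≤ 2 ^ x) (k : ℕ) :
    ∃ ℓ : Y → MvPolynomial (Fin n) ℝ, (∀ y, (ℓ y).totalDegree ≤ k) ∧
      (∀ y, l1 (ℓ y) ≤ 2 ^ interpolationBits n k x c) ∧
      ∀ s : MvPolynomial (Fin n) ℝ, s.totalDegree ≤ k → ∀ y,
        eval (fun i => (pt y i : ℝ)) (∑ y', C (eval (fun i => (pt y' i : ℝ)) s) * ℓ y') =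
          eval (fun i => (pt y i : ℝ)) s := by
  obtain ⟨d, L, hd, hdb, hLb, hL⟩ := h.coeff_eq hx k
  have hd0 : (d : ℝ) ≠ 0 := by exact_mod_cast hd
  have hd1 : (1 : ℝ) ≤ |(d : ℝ)| := by exact_mod_cast Int.one_le_abs hd
  -- The coefficients of the polynomial for `y` are the entries at `y` of the left inverse. Summing
  -- with the values of `s` as weights yields the normal form of `s`, which has the values of `s` on
  -- the points.
  refine ⟨fun y => ∑ m ∈ standardMonomials pt k, monomial m ((L m y : ℝ) * (z : ℝ) ^ k / d),
    ?_, ?_, ?_⟩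
  · intro y
    refine totalDegree_finsetSum_le fun m hm => (totalDegree_monomial_le _ _).trans ?_
    exact ((mem_standardMonomials pt).1 hm).1
  · intro y
    refine (l1_sum_le _ _).trans ?_
    have hcard : ((standardMonomials pt k).card : ℝ) ≤ 2 ^ ((n + 1) ^ k) := by
      have : (standardMonomials pt k).card ≤ (n + 1) ^ k :=
        (Finset.card_filter_le _ _).trans (card_monomials_le n k)
      exact_mod_cast this.trans Nat.lt_two_pow_self.le
    calc _ ≤ ∑ _m ∈ standardMonomials pt k, (2 : ℝ) ^ standardBits n k x c * 2 ^ (c * k) := by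
          refine Finset.sum_le_sum fun m _ => ?_
          rw [l1_monomial, abs_div]
          refine (div_le_self (abs_nonneg _) hd1).trans ?_
          rw [abs_mul, abs_pow, Nat.abs_cast, pow_mul]
          refine mul_le_mul (by exact_mod_cast hLb m y) ?_ (by positivity) (by positivity)
          exact pow_le_pow_left₀ (by positivity) (by exact_mod_cast h.le) _
      _ = (standardMonomials pt k).card * ((2 : ℝ) ^ standardBits n k x c * 2 ^ (c * k)) := by simp
      _ ≤ 2 ^ ((n + 1) ^ k) * ((2 : ℝ) ^ standardBits n k x c * 2 ^ (c * k)) := by gcongr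
      _ = 2 ^ interpolationBits n k x c := by
          rw [interpolationBits, pow_add, pow_add]; ring
  · intro s hs y
    set p := s - reduction pt G k s with hp
    have hpe : ∀ y, eval (fun i => (pt y i : ℝ)) p = eval (fun i => (pt y i : ℝ)) s := by
      intro y
      rw [hp, map_sub, eval_reduction hG, sub_zero]
    have hpstd : ∀ m ∈ p.support, IsStandard pt m := fun m hm =>
      isStandard_of_mem_support_sub_reduction hG hs hm
    have hpk : p.totalDegree ≤ k :=
      (totalDegree_sub _ _).trans (max_le hs (totalDegree_reduction_le hG k s))
    have hsub : p.support ⊆ standardMonomials pt k := fun m hm =>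
      (mem_standardMonomials pt).2 ⟨(degree_le_totalDegree hm).trans hpk, hpstd m hm⟩
    have hps : p = ∑ y', C (eval (fun i => (pt y' i : ℝ)) s) *
        ∑ m ∈ standardMonomials pt k, monomial m ((L m y' : ℝ) * (z : ℝ) ^ k / d) := by
      simp only [Finset.mul_sum, C_mul_monomial]
      rw [Finset.sum_comm]
      conv_lhs => rw [p.as_sum, Finset.sum_subset hsub fun m _ hm => by
        rw [notMem_support_iff.1 hm, monomial_zero]]
      refine Finset.sum_congr rfl fun m hm => ?_
      rw [← map_sum]
      congr 1
      have h1 := hL p hpstd hpk m hm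
      rw [← mul_right_inj' hd0, h1, Finset.mul_sum]
      refine Finset.sum_congr rfl fun y' _ => ?_
      rw [hpe]
      field_simp
    rw [← hps, hpe]

end Standard

end PCSoS

end

noncomputable section

namespace PCSoS

open MvPolynomial Classical

/-! ### Approximate sum-of-squares proofs with bounded coefficients -/

section Approx

variable {n : ℕ} {ι : Type} [Fintype ι] {P : ι → MvPolynomial (Fin n) ℚ}

/-- From a proof of `-g ^ 2 ≥ 0` to proofs of `a * g + ε ≥ 0`. -/
theorem HasSoS.C_mul_add_const {k b u s e : ℕ} {g : MvPolynomial (Fin n) ℝ} {a ε : ℝ}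
    (hg : 2 * g.totalDegree ≤ k) (hgb : l1 g ≤ 2 ^ b) (hgs : HasSoS P k (2 ^ u) (-g ^ 2))
    (ha : |a| ≤ 2 ^ s) (hε : 1 ≤ ε * 2 ^ e) (hε' : ε ≤ 2 ^ e) :
    HasSoS P k (2 ^ (2 * e + 2 * s + b + u + 2)) (C a * g + C ε) := by
  have he : (0 : ℝ) < 2 ^ e := by positivity
  have hε0 : 0 < ε := by
    by_contra hcon
    nlinarith [mul_nonneg (sub_nonneg.2 (not_lt.1 hcon)) he.le]
  have hinv : ε⁻¹ ≤ 2 ^ e := by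
    rw [inv_le_iff_one_le_mul₀' hε0]
    exact hε
  -- Completing the square, with the unwanted square of `g` cancelled by the proof of `-g ^ 2 ≥ 0`.
  have hsplit : C a * g + C ε =
      C ε * (1 + C (a / (2 * ε)) * g) ^ 2 + C (a ^ 2 / (4 * ε)) * (-g ^ 2) := by
    have h1 : C a = (C ε * 2 * C (a / (2 * ε)) : MvPolynomial (Fin n) ℝ) := by
      rw [← map_ofNat C, ← C_mul, ← C_mul]
      congr 1
      field_simp
    have h2 : C (a ^ 2 / (4 * ε)) = (C ε * C (a / (2 * ε)) ^ 2 : MvPolynomial (Fin n) ℝ) := by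
      rw [← C_pow, ← C_mul]
      congr 1
      field_simp
      ring
    rw [h1, h2]
    ring
  have h1 : HasSoS P k (2 ^ e * 2 ^ (s + e + b + 1)) (C ε * (1 + C (a / (2 * ε)) * g) ^ 2) := by
    refine HasSoS.smul hε0.le hε' (one_le_pow₀ (by norm_num)) (HasSoS.sq ?_ ?_)
    · have h1 : (1 + C (a / (2 * ε)) * g).totalDegree ≤ g.totalDegree := by
        refine (totalDegree_add _ _).trans (max_le (by simp) ((totalDegree_mul _ _).trans ?_))
        rw [totalDegree_C, zero_add]
      omega
    · refine (l1_add_le _ _).trans ?_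
      rw [l1_one, l1_C_mul]
      have h2 : |a / (2 * ε)| ≤ 2 ^ s * 2 ^ e := by
        rw [abs_div, abs_of_pos (by positivity : 0 < 2 * ε), div_eq_mul_inv]
        refine mul_le_mul ha ?_ (by positivity) (by positivity)
        rw [mul_inv]
        nlinarith [inv_pos.2 hε0]
      have h3 : |a / (2 * ε)| * l1 g ≤ 2 ^ s * 2 ^ e * 2 ^ b :=
        mul_le_mul h2 hgb (l1_nonneg _) (by positivity)
      rw [← pow_add, ← pow_add] at h3
      have h4 : (1 : ℝ) ≤ 2 ^ (s + e + b) := one_le_pow₀ (by norm_num)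
      rw [pow_succ]
      linarith
  have h2 : HasSoS P k (2 ^ (2 * s + e) * 2 ^ u) (C (a ^ 2 / (4 * ε)) * (-g ^ 2)) := by
    refine HasSoS.smul (by positivity) ?_ (one_le_pow₀ (by norm_num)) hgs
    have h3 : a ^ 2 ≤ 2 ^ (2 * s) := by
      rw [← sq_abs, mul_comm 2 s, pow_mul]
      exact pow_le_pow_left₀ (abs_nonneg _) ha 2
    rw [div_eq_mul_inv, pow_add]
    refine mul_le_mul h3 ?_ (by positivity) (by positivity)
    rw [mul_inv]
    nlinarith [inv_pos.2 hε0]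
  rw [hsplit]
  refine (HasSoS.add (by positivity) (by positivity) h1 h2).mono le_rfl ?_
  rw [← pow_add, ← pow_add]
  have h3 : (2 : ℝ) ^ (e + (s + e + b + 1)) ≤ 2 ^ (2 * e + 2 * s + b + u + 1) :=
    pow_le_pow_right₀ (by norm_num) (by omega)
  have h4 : (2 : ℝ) ^ (2 * s + e + u) ≤ 2 ^ (2 * e + 2 * s + b + u + 1) :=
    pow_le_pow_right₀ (by norm_num) (by omega)
  rw [pow_succ _ (2 * e + 2 * s + b + u + 1)]
  linarith

variable {Y : Type} {pt : Y → Fin n → ℚ} {z c : ℕ} {G : (Fin n →₀ ℕ) → MvPolynomial (Fin n) ℚ}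

theorem PointBound.abs_coord_le (h : PointBound pt z c) (y : Y) (i : Fin n) :
    |(pt y i : ℝ)| ≤ 2 ^ c := by
  obtain ⟨t, ht, htc⟩ := h.coord y i
  have hz : (1 : ℝ) ≤ z := by exact_mod_cast Nat.one_le_iff_ne_zero.2 h.ne_zero
  have h1 : (z : ℝ) * pt y i = t := by exact_mod_cast ht
  have h2 : |(t : ℝ)| ≤ 2 ^ c := by exact_mod_cast htc
  rw [← h1, abs_mul, Nat.abs_cast] at h2
  nlinarith [abs_nonneg (pt y i : ℝ)]

/-- Bounds the squares that agree on the points with those of a given proof. -/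
def squareBits (n d x c ρ : ℕ) : ℕ := 2 * interpolationBits n d x c + 2 * x + ρ + c * (2 * d)

/-- Replaces the squares of a proof by squares with bounded coefficients. -/
theorem PointBound.exists_squares [Fintype Y] (h : PointBound pt z c) (hG : IsReducedFamily pt G)
    {x : ℕ} (hx : Fintype.card Y ≤ 2 ^ x) {d ρ : ℕ}
    (hP : ∀ j y, eval (fun i => (pt y i : ℝ)) (toReal (P j)) = 0) {r : MvPolynomial (Fin n) ℝ}
    (π : SoSProof P r) (hπ : π.DegreeLE (2 * d)) (hrd : r.totalDegree ≤ 2 * d)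
    (hr : l1 r ≤ 2 ^ ρ) :
    ∃ v : Fin π.t → MvPolynomial (Fin n) ℝ, (∀ i, (v i).totalDegree ≤ d) ∧
      ∑ i, l1 (v i) ^ 2 ≤ 2 ^ squareBits n d x c ρ ∧
      ∀ y, eval (fun i => (pt y i : ℝ)) (∑ i, v i ^ 2) = eval (fun i => (pt y i : ℝ)) r := by
  obtain ⟨ℓ, hℓd, hℓb, hℓ⟩ := h.exists_interpolation hG hx d
  set κ : ℝ := 2 ^ interpolationBits n d x c with hκ
  have hκ0 : 0 ≤ κ := by positivity
  set ev : Y → MvPolynomial (Fin n) ℝ →+* ℝ := fun y => eval (fun i => (pt y i : ℝ)) with hev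
  have hsd : ∀ i, (π.s i).totalDegree ≤ d := by
    intro i
    have h1 := hπ.1 i
    rcases eq_or_ne (π.s i) 0 with h0 | h0
    · simp [h0]
    · rw [sq, totalDegree_mul_of_isDomain h0 h0] at h1
      omega
  have hre : ∀ y, ev y r = ∑ i, ev y (π.s i) ^ 2 := by
    intro y
    have h1 := congrArg (ev y) π.identity
    rw [map_add, map_sum, map_sum] at h1
    simp only [map_mul, map_pow] at h1
    rw [h1, Finset.sum_eq_zero (s := Finset.univ (α := ι)) fun j _ => by rw [hev, hP j y, mul_zero],
      add_zero]
  have hrb : ∀ y, ev y r ≤ 2 ^ ρ * 2 ^ (c * (2 * d)) := by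
    intro y
    refine (le_abs_self _).trans ((abs_eval_le hrd (M := 2 ^ c) (one_le_pow₀ (by norm_num)) _
      (h.abs_coord_le y)).trans ?_)
    rw [pow_mul 2 c]
    gcongr
  have hcardY : (Fintype.card Y : ℝ) ≤ 2 ^ x := by exact_mod_cast hx
  -- Each `s i` is replaced by the interpolant of its values. Since the squares of these values sum
  -- to `r` at every point, the total norm is bounded regardless of the coefficients of the original
  -- proof and of its number of squares.
  refine ⟨fun i => ∑ y, C (ev y (π.s i)) * ℓ y, ?_, ?_, ?_⟩
  · intro i
    refine totalDegree_finsetSum_le fun y _ => (totalDegree_mul _ _).trans ?_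
    rw [totalDegree_C, zero_add]
    exact hℓd y
  · have h1 : ∀ i, l1 (∑ y, C (ev y (π.s i)) * ℓ y) ^ 2 ≤
        κ ^ 2 * (2 ^ x * ∑ y, ev y (π.s i) ^ 2) := by
      intro i
      have h2 : l1 (∑ y, C (ev y (π.s i)) * ℓ y) ≤ κ * ∑ y, |ev y (π.s i)| := by
        refine (l1_sum_le _ _).trans ?_
        rw [Finset.mul_sum]
        refine Finset.sum_le_sum fun y _ => ?_
        rw [l1_C_mul, mul_comm]
        exact mul_le_mul_of_nonneg_right (hℓb y) (abs_nonneg _)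
      have h3 : (∑ y, |ev y (π.s i)|) ^ 2 ≤ 2 ^ x * ∑ y, ev y (π.s i) ^ 2 := by
        have h4 := sq_sum_le_card_mul_sum_sq (s := Finset.univ) (f := fun y => |ev y (π.s i)|)
        simp only [sq_abs, Finset.card_univ] at h4
        exact h4.trans (mul_le_mul_of_nonneg_right hcardY
          (Finset.sum_nonneg fun _ _ => sq_nonneg _))
      calc _ ≤ (κ * ∑ y, |ev y (π.s i)|) ^ 2 := pow_le_pow_left₀ (l1_nonneg _) h2 2
        _ = κ ^ 2 * (∑ y, |ev y (π.s i)|) ^ 2 := mul_pow _ _ _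
        _ ≤ _ := by gcongr
    calc _ ≤ ∑ i, κ ^ 2 * (2 ^ x * ∑ y, ev y (π.s i) ^ 2) := Finset.sum_le_sum fun i _ => h1 i
      _ = κ ^ 2 * (2 ^ x * ∑ y, ev y r) := by
          rw [← Finset.mul_sum, ← Finset.mul_sum, Finset.sum_comm]
          simp only [hre]
      _ ≤ κ ^ 2 * (2 ^ x * ∑ _y : Y, 2 ^ ρ * 2 ^ (c * (2 * d))) := by
          gcongr with y
          exact hrb y
      _ = κ ^ 2 * (2 ^ x * (Fintype.card Y * (2 ^ ρ * 2 ^ (c * (2 * d))))) := by simp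
      _ ≤ κ ^ 2 * (2 ^ x * (2 ^ x * (2 ^ ρ * 2 ^ (c * (2 * d))))) := by gcongr
      _ = 2 ^ squareBits n d x c ρ := by
          rw [hκ, squareBits]
          ring
  · intro y
    rw [map_sum]
    refine Eq.trans ?_ (hre y).symm
    refine Finset.sum_congr rfl fun i _ => ?_
    rw [map_pow]
    congr 1
    exact hℓ (π.s i) (hsd i) y

/-- Bounds the coefficients of approximate proofs. -/
def approxBits (n d x c ρ e b u : ℕ) : ℕ :=
  (n + 1) ^ (2 * d) + (2 * (e + (n + 1) ^ (2 * d)) + 2 * (squareBits n d x c ρ + 1) + b + u + 2) + 2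

/-- With bounded squares `v i` that agree with `r` on the points, `r - ∑ v i ^ 2` is a combination
of the reduced polynomials `G m` of degree at most `2 * d`. Each multiple of a `G m` becomes
provably nonnegative after adding a share of `ε`. -/
theorem PointBound.hasSoS_add_const [Fintype Y] (h : PointBound pt z c)
    (hG : IsReducedFamily pt G) {x : ℕ} (hx : Fintype.card Y ≤ 2 ^ x) {d ρ e b u k : ℕ}
    (hP : ∀ j y, eval (fun i => (pt y i : ℝ)) (toReal (P j)) = 0) (hk : 4 * d ≤ k)
    (hGb : ∀ m, ¬ IsStandard pt m → m.degree ≤ 2 * d → l1 (toReal (G m)) ≤ 2 ^ b)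
    (hGs : ∀ m, ¬ IsStandard pt m → m.degree ≤ 2 * d → HasSoS P k (2 ^ u) (-(toReal (G m)) ^ 2))
    {r : MvPolynomial (Fin n) ℝ} (hrπ : ∃ π : SoSProof P r, π.DegreeLE (2 * d))
    (hr : l1 r ≤ 2 ^ ρ) {ε : ℝ} (hε : 1 ≤ ε * 2 ^ e) (hε' : ε ≤ 2 ^ e) :
    HasSoS P k (2 ^ approxBits n d x c ρ e b u) (r + C ε) := by
  obtain ⟨π, hπ⟩ := hrπ
  have hrd : r.totalDegree ≤ 2 * d := by
    rw [π.identity]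
    exact (totalDegree_add _ _).trans (max_le (totalDegree_finsetSum_le fun i _ => hπ.1 i)
      (totalDegree_finsetSum_le fun j _ => hπ.2 j))
  obtain ⟨v, hvd, hvb, hv⟩ := h.exists_squares hG hx hP π hπ hrd hr
  set σ := squareBits n d x c ρ with hσ
  set ν := (n + 1) ^ (2 * d) with hν
  set N := nonstandardMonomials pt (2 * d) with hN
  have hvd2 : ∀ i, (v i ^ 2).totalDegree ≤ 2 * d := fun i =>
    (totalDegree_pow _ _).trans (Nat.mul_le_mul_left _ (hvd i))
  have hσ1 : (1 : ℝ) ≤ 2 ^ σ := one_le_pow₀ (by norm_num)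
  have hsq : HasSoS P k (2 ^ (σ + 1)) (∑ i, v i ^ 2) := by
    refine ⟨⟨π.t, v, fun _ => 0, by simp⟩, ⟨fun i => (hvd2 i).trans (by omega), by simp⟩,
      fun i => ?_, fun _ => by rw [l1_zero]; positivity⟩
    have h1 : l1 (v i) ^ 2 ≤ ∑ i, l1 (v i) ^ 2 :=
      Finset.single_le_sum (f := fun i => l1 (v i) ^ 2) (fun _ _ => sq_nonneg _) (Finset.mem_univ i)
    rw [pow_succ]
    change l1 (v i) ≤ _
    nlinarith [sq_nonneg (l1 (v i) - 1)]
  set q := r - ∑ i, v i ^ 2 with hq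
  have hqd : q.totalDegree ≤ 2 * d :=
    (totalDegree_sub _ _).trans (max_le hrd (totalDegree_finsetSum_le fun i _ => hvd2 i))
  have hqb : l1 q ≤ 2 ^ (σ + 1) := by
    have h1 : l1 (∑ i, v i ^ 2) ≤ 2 ^ σ :=
      (l1_sum_le _ _).trans ((Finset.sum_le_sum fun i _ => l1_pow_le _ 2).trans hvb)
    have h2 : (2 : ℝ) ^ ρ ≤ 2 ^ σ :=
      pow_le_pow_right₀ (by norm_num) (by rw [hσ, squareBits]; omega)
    have h3 := l1_sub_le r (∑ i, v i ^ 2)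
    rw [pow_succ]
    linarith
  have hqr := h.eq_reduction hG hqd fun y => by rw [hq, map_sub, hv, sub_self]
  rw [reduction, ← hN] at hqr
  have hNcard : N.card ≤ 2 ^ ν :=
    ((Finset.card_filter_le _ _).trans (card_monomials_le n (2 * d))).trans Nat.lt_two_pow_self.le
  have hNcard' : (N.card : ℝ) ≤ 2 ^ ν := by exact_mod_cast hNcard
  have hν0 : (0 : ℝ) < 2 ^ ν := by positivity
  have he0 : (0 : ℝ) < 2 ^ e := by positivity
  have hε0 : 0 < ε := by
    by_contra hcon
    nlinarith [mul_nonneg (sub_nonneg.2 (not_lt.1 hcon)) he0.le]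
  -- The share is `ε / 2 ^ ν`, where `2 ^ ν` generously exceeds the number of summands; being
  -- divided by a power of two, it costs `ν` further bits.
  have hterm : ∀ m ∈ N, HasSoS P k (2 ^ (2 * (e + ν) + 2 * (σ + 1) + b + u + 2))
      (C (q.coeff m / ((G m).coeff m : ℚ)) * toReal (G m) + C (ε / 2 ^ ν)) := by
    intro m hm
    obtain ⟨hm1, hm2⟩ := mem_nonstandardMonomials.1 hm
    refine HasSoS.C_mul_add_const ?_ (hGb m hm2 hm1) (hGs m hm2 hm1) ?_ ?_ ?_
    · rw [totalDegree_toReal]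
      have := (hG m hm2).totalDegree_le
      omega
    -- The leading coefficient is a nonzero integer, so dividing by it does not increase the
    -- coefficient of `q`.
    · obtain ⟨t, ht⟩ := mem_integralPolys.1 (hG m hm2).integral m
      have ht0 : t ≠ 0 := by
        rintro rfl
        exact (hG m hm2).coeff_ne_zero (by simpa using ht)
      have ht1 : (1 : ℝ) ≤ |(t : ℝ)| := by exact_mod_cast Int.one_le_abs ht0
      rw [ht, Rat.cast_intCast, abs_div]
      exact (div_le_self (abs_nonneg _) ht1).trans ((abs_coeff_le_l1 _ _).trans hqb)
    · rw [pow_add]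
      field_simp
      exact hε
    · refine (div_le_self hε0.le (one_le_pow₀ (by norm_num))).trans (hε'.trans ?_)
      exact pow_le_pow_right₀ (by norm_num) (by omega)
  set τ := 2 * (e + ν) + 2 * (σ + 1) + b + u + 2 with hτ
  have h4 : approxBits n d x c ρ e b u = ν + τ + 2 := by rw [approxBits]
  clear_value τ
  have hsum := HasSoS.sum N (by positivity) _ hterm
  rw [Finset.sum_add_distrib, ← hqr, Finset.sum_const, nsmul_eq_mul] at hsum
  clear hqr
  -- The part of `ε` not handed out is a nonnegative constant.
  have hconst : HasSoS P k (2 ^ (e + 1)) (C (ε - N.card * (ε / 2 ^ ν))) := by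
    have h1 : N.card * (ε / 2 ^ ν) ≤ ε := by
      rw [← mul_div_assoc, div_le_iff₀ hν0, mul_comm]
      exact mul_le_mul_of_nonneg_left hNcard' hε0.le
    refine HasSoS.const (by linarith) ?_
    have h2 : 0 ≤ N.card * (ε / 2 ^ ν) := by positivity
    have h3 : (1 : ℝ) ≤ 2 ^ e := one_le_pow₀ (by norm_num)
    rw [pow_succ]
    linarith
  have hall := HasSoS.add (by positivity) (by positivity)
    (HasSoS.add (by positivity) (by positivity) hsq hsum) hconst
  have heq : ∑ i, v i ^ 2 + (q + (N.card : MvPolynomial (Fin n) ℝ) * C (ε / 2 ^ ν)) +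
      C (ε - N.card * (ε / 2 ^ ν)) = r + C ε := by
    rw [hq, C_sub, C_mul, C_eq_coe_nat]
    ring
  rw [heq] at hall
  refine hall.mono le_rfl ?_
  have h1 : (N.card : ℝ) * 2 ^ τ ≤ 2 ^ (ν + τ) := by
    rw [pow_add]
    gcongr
  have h2 : (2 : ℝ) ^ (σ + 1) ≤ 2 ^ (ν + τ) := pow_le_pow_right₀ (by norm_num) (by omega)
  have h3 : (2 : ℝ) ^ (e + 1) ≤ 2 ^ (ν + τ) := pow_le_pow_right₀ (by norm_num) (by omega)
  have h5 : (0 : ℝ) < 2 ^ (ν + τ) := by positivity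
  rw [h4, pow_add _ _ 2]
  linarith

end Approx

end PCSoS

end

noncomputable section

namespace PCSoS

open MvPolynomial Classical

/-! ### Solutions of systems over a finite domain -/

section Solutions

variable {n : ℕ} {ι : Type} {D : Finset ℚ}

/-- The common zeros of `f` with coordinates in `D`. -/
structure Solution (D : Finset ℚ) (f : ι → MvPolynomial (Fin n) ℚ) : Type where
  val : Fin n → D
  eval_eq_zero : ∀ j, eval (fun i => (val i : ℚ)) (f j) = 0

theorem Solution.val_injective {f : ι → MvPolynomial (Fin n) ℚ} :
    Function.Injective (Solution.val (D := D) (f := f)) := by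
  rintro ⟨a, _⟩ ⟨b, _⟩ rfl
  rfl

instance (f : ι → MvPolynomial (Fin n) ℚ) : Fintype (Solution D f) :=
  Fintype.ofInjective Solution.val Solution.val_injective

/-- The coordinates of a solution. -/
def Solution.pt {f : ι → MvPolynomial (Fin n) ℚ} (y : Solution D f) (i : Fin n) : ℚ := y.1 i

theorem card_solution_le (D : Finset ℚ) (f : ι → MvPolynomial (Fin n) ℚ) :
    Fintype.card (Solution D f) ≤ 2 ^ (n * D.card) := by
  refine (Fintype.card_le_of_injective _ Solution.val_injective).trans ?_
  rw [Fintype.card_fun, Fintype.card_coe, Fintype.card_fin, mul_comm, pow_mul]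
  exact Nat.pow_le_pow_left Nat.lt_two_pow_self.le _

theorem eval_domainSystem_solution {f : ι → MvPolynomial (Fin n) ℚ} (j : ι ⊕ Fin n)
    (y : Solution D f) : eval (fun i => (y.pt i : ℝ)) (toReal (domainSystem D f j)) = 0 := by
  rw [eval_toReal]
  rcases j with j | i
  · exact_mod_cast y.2 j
  · exact_mod_cast (eval_domainPoly_eq_zero i).2 (y.1 i).2

/-- The domain polynomials split over `ℚ`, so passing to real points adds no zeros. -/
theorem mem_variety_domainSystem {f : ι → MvPolynomial (Fin n) ℚ} {x : Fin n → ℝ} :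
    x ∈ variety (domainSystem D f) ↔ ∃ y : Solution D f, x = fun i => (y.pt i : ℝ) := by
  constructor
  · intro hx
    have hdom : ∀ i, ∃ ρ : D, x i = ((ρ : ℚ) : ℝ) := by
      intro i
      have h1 : eval x (toReal (domainPoly D i)) = 0 := hx (Sum.inr i)
      rw [domainPoly, toReal_prod, map_prod, Finset.prod_eq_zero_iff] at h1
      obtain ⟨ρ, hρ, h2⟩ := h1
      exact ⟨⟨ρ, hρ⟩, by simpa [sub_eq_zero] using h2⟩
    choose a ha using hdom
    have hxa : x = fun i => ((a i : ℚ) : ℝ) := funext ha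
    refine ⟨⟨a, fun j => ?_⟩, hxa⟩
    have h1 : eval x (toReal (f j)) = 0 := hx (Sum.inl j)
    rw [hxa, eval_toReal] at h1
    exact_mod_cast h1
  · rintro ⟨y, rfl⟩ j
    exact eval_domainSystem_solution j y

theorem mem_idealOf_domainSystem {f : ι → MvPolynomial (Fin n) ℚ} {p : MvPolynomial (Fin n) ℝ} :
    p ∈ idealOf (domainSystem D f) ↔
      ∀ y : Solution D f, eval (fun i => (y.pt i : ℝ)) p = 0 := by
  rw [idealOf, mem_vanishingIdeal_iff]
  constructor
  · intro h y
    have := h _ (mem_variety_domainSystem.2 ⟨y, rfl⟩)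
    rwa [aeval_eq_eval] at this
  · intro h x hx
    obtain ⟨y, rfl⟩ := mem_variety_domainSystem.1 hx
    rw [aeval_eq_eval]
    exact h y

theorem exists_pointBound (D : Finset ℚ) : ∃ z c : ℕ, ∀ (n : ℕ) (Y : Type) (pt : Y → Fin n → ℚ),
    (∀ y i, pt y i ∈ D) → PointBound pt z c := by
  let z : ℕ := ∏ ρ ∈ D, ρ.den
  obtain ⟨c, hc⟩ := exists_nat_ge (z + ∑ ρ ∈ D, (z : ℚ) * |ρ|)
  have hS : 0 ≤ ∑ ρ ∈ D, (z : ℚ) * |ρ| := Finset.sum_nonneg fun _ _ => by positivity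
  have hc2 : (c : ℚ) ≤ 2 ^ c := by exact_mod_cast Nat.lt_two_pow_self.le
  refine ⟨z, c, fun n Y pt hpt => ⟨Finset.prod_ne_zero_iff.2 fun ρ _ => ρ.den_nz, ?_, ?_⟩⟩
  · have : (z : ℚ) ≤ 2 ^ c := by linarith
    exact_mod_cast this
  · intro y i
    obtain ⟨w, hw⟩ : (pt y i).den ∣ z := Finset.dvd_prod_of_mem _ (hpt y i)
    have h1 : (z : ℚ) * pt y i = ((w * (pt y i).num : ℤ) : ℚ) := by
      rw [hw]
      push_cast
      rw [mul_comm ((pt y i).den : ℚ), mul_assoc, mul_comm ((pt y i).den : ℚ), Rat.mul_den_eq_num]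
    refine ⟨_, h1, ?_⟩
    have h2 : |((w * (pt y i).num : ℤ) : ℚ)| ≤ 2 ^ c := by
      rw [← h1, abs_mul, Nat.abs_cast]
      have h3 := Finset.single_le_sum (f := fun ρ : ℚ => (z : ℚ) * |ρ|)
        (fun _ _ => by positivity) (hpt y i)
      have h4 : (0 : ℚ) ≤ z := by positivity
      linarith
    exact_mod_cast h2

/-- The domain polynomials have bit size linear in the number of variables. -/
theorem exists_bitSize_domainPoly_le (D : Finset ℚ) :
    ∃ K : ℕ, ∀ (n : ℕ) (i : Fin n), bitSize (domainPoly D i) ≤ K * (n + 1) := by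
  let q : Polynomial ℚ := ∏ ρ ∈ D, (Polynomial.X - Polynomial.C ρ)
  let w : ℕ → ℕ := fun e => 1 + (q.coeff e).num.natAbs.size + (q.coeff e).den.size
  let E : ℕ := D.card + 1
  refine ⟨1 + (∑ e ∈ Finset.range E, w e) + E * E, fun n i => ?_⟩
  have hdeg := totalDegree_domainPoly_le D i
  have hcoeff : ∀ m ∈ (domainPoly D i).support, m = Finsupp.single i (m i) ∧
      (domainPoly D i).coeff m = q.coeff (m i) := by
    have hform : ∀ m, (domainPoly D i).coeff m =
        ∑ e ∈ Finset.range (q.natDegree + 1), if Finsupp.single i e = m then q.coeff e else 0 := by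
      intro m
      rw [domainPoly_eq_aeval, Polynomial.aeval_eq_sum_range, coeff_sum]
      refine Finset.sum_congr rfl fun e _ => ?_
      rw [coeff_smul, coeff_X_pow, smul_eq_mul, mul_ite, mul_one, mul_zero]
    intro m hm
    have h0 := mem_support_iff.1 hm
    rw [hform] at h0
    obtain ⟨e, he, hne⟩ := Finset.exists_ne_zero_of_sum_ne_zero h0
    have hme : Finsupp.single i e = m := by
      by_contra h
      exact hne (if_neg h)
    subst hme
    refine ⟨by simp, ?_⟩
    rw [hform, Finset.sum_eq_single e]
    · simp
    · intro e' _ hne'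
      exact if_neg fun h => hne' (Finsupp.single_injective i h)
    · exact fun h => absurd he h
  have hle : ∀ m ∈ (domainPoly D i).support, ∀ i', m i' ≤ D.card := by
    intro m hm i'
    exact (Finsupp.le_degree i' m).trans ((degree_le_totalDegree hm).trans hdeg)
  have hinj : Set.InjOn (fun m : Fin n →₀ ℕ => m i) (domainPoly D i).support := by
    intro m hm m' hm' h
    rw [(hcoeff m hm).1, (hcoeff m' hm').1]
    exact congrArg _ h
  have hterm : ∀ m ∈ (domainPoly D i).support,
      1 + ((domainPoly D i).coeff m).num.natAbs.size + ((domainPoly D i).coeff m).den.size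
        + ∑ i', (1 + (m i').size) ≤ w (m i) + n * E := by
    intro m hm
    rw [(hcoeff m hm).2]
    refine Nat.add_le_add le_rfl ?_
    refine (Finset.sum_le_card_nsmul _ _ E fun i' _ => ?_).trans (by simp)
    have h1 : (m i').size ≤ m i' := Nat.size_le.2 Nat.lt_two_pow_self
    have h2 := hle m hm i'
    change 1 + (m i').size ≤ D.card + 1
    omega
  have himg : (domainPoly D i).support.image (fun m => m i) ⊆ Finset.range E := by
    intro e he
    obtain ⟨m, hm, rfl⟩ := Finset.mem_image.1 he
    exact Finset.mem_range.2 (Nat.lt_succ_of_le (hle m hm i))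
  have hsum : ∑ m ∈ (domainPoly D i).support, (w (m i) + n * E) ≤
      ∑ e ∈ Finset.range E, (w e + n * E) := by
    rw [← Finset.sum_image (f := fun e => w e + n * E) hinj]
    exact Finset.sum_le_sum_of_subset himg
  have hfin : bitSize (domainPoly D i) ≤ 1 + ∑ e ∈ Finset.range E, (w e + n * E) := by
    rw [bitSize]
    exact Nat.add_le_add le_rfl ((Finset.sum_le_sum hterm).trans hsum)
  refine hfin.trans ?_
  rw [Finset.sum_add_distrib, Finset.sum_const, Finset.card_range, smul_eq_mul]
  have h1 : E * (n * E) = n * (E * E) := by ring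
  rw [h1]
  nlinarith [Nat.zero_le (n * ∑ e ∈ Finset.range E, w e), Nat.zero_le (E * E)]

end Solutions

/-! ### Polynomial bounds -/

section PolyBounded

variable {α : Type*} {W F F' : α → ℕ}

/-- `F` is bounded by a polynomial in `W`. -/
def PolyBounded (W F : α → ℕ) : Prop := ∃ A, ∀ a, F a ≤ A * W a ^ A

theorem mul_pow_mono {A B w : ℕ} (hw : 1 ≤ w) (h : A ≤ B) : A * w ^ A ≤ B * w ^ B :=
  Nat.mul_le_mul h (Nat.pow_le_pow_right hw h)

theorem PolyBounded.const (hW : ∀ a, 1 ≤ W a) (c : ℕ) : PolyBounded W fun _ => c :=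
  ⟨c, fun a => Nat.le_mul_of_pos_right _ (Nat.pow_pos (hW a))⟩

theorem PolyBounded.of_le (h : ∀ a, F a ≤ W a) : PolyBounded W F :=
  ⟨1, fun a => by simpa using h a⟩

theorem PolyBounded.add (hW : ∀ a, 1 ≤ W a) (h : PolyBounded W F) (h' : PolyBounded W F') :
    PolyBounded W fun a => F a + F' a := by
  obtain ⟨A, hA⟩ := h
  obtain ⟨B, hB⟩ := h'
  refine ⟨A + B, fun a => (Nat.add_le_add (hA a) (hB a)).trans ?_⟩
  rw [add_mul]
  exact Nat.add_le_add (Nat.mul_le_mul_left _ (Nat.pow_le_pow_right (hW a) (by omega)))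
    (Nat.mul_le_mul_left _ (Nat.pow_le_pow_right (hW a) (by omega)))

theorem PolyBounded.mul (hW : ∀ a, 1 ≤ W a) (h : PolyBounded W F) (h' : PolyBounded W F') :
    PolyBounded W fun a => F a * F' a := by
  obtain ⟨A, hA⟩ := h
  obtain ⟨B, hB⟩ := h'
  refine ⟨A * B + (A + B), fun a => (Nat.mul_le_mul (hA a) (hB a)).trans ?_⟩
  calc A * W a ^ A * (B * W a ^ B) = A * B * W a ^ (A + B) := by ring
    _ ≤ _ := Nat.mul_le_mul (Nat.le_add_right _ _) (Nat.pow_le_pow_right (hW a) (by omega))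

theorem PolyBounded.pow (hW : ∀ a, 1 ≤ W a) (h : PolyBounded W F) (e : ℕ) :
    PolyBounded W fun a => F a ^ e := by
  induction e with
  | zero => simpa using PolyBounded.const hW 1
  | succ e ih =>
    simp only [pow_succ]
    exact ih.mul hW h

variable {n d k x b c ρ e u : α → ℕ}

theorem PolyBounded.inverseBits (hW : ∀ a, 1 ≤ W a) (hN : PolyBounded W F) (hx : PolyBounded W x)
    (hb : PolyBounded W b) : PolyBounded W fun a => inverseBits (F a) (x a) (b a) :=
  (((hN.mul hW hN).add hW (hN.mul hW (hx.add hW ((const hW 2).mul hW hb)))).add hW hN).add hW hb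

theorem PolyBounded.combinationBits (hW : ∀ a, 1 ≤ W a)
    (hq : PolyBounded W fun a => (n a + 1) ^ k a) (hb : PolyBounded W b) :
    PolyBounded W fun a => combinationBits (n a) (k a) (b a) :=
  (((const hW 2).mul hW hq).add hW (inverseBits hW hq hq hb)).add hW ((const hW 2).mul hW hb)

theorem PolyBounded.lineBits (hW : ∀ a, 1 ≤ W a) (hn : PolyBounded W n) (hk : PolyBounded W k)
    (hq : PolyBounded W fun a => (n a + 1) ^ k a) (hb : PolyBounded W b) :
    PolyBounded W fun a => lineBits (n a) (k a) (b a) :=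
  have hc := combinationBits hW hq hb
  ((const hW 1).add hW (hq.mul hW ((hc.add hW (const hW 3)).add hW
    (hn.mul hW ((const hW 1).add hW hk))))).add hW hc

theorem PolyBounded.roundCost (hW : ∀ a, 1 ≤ W a) (hk : PolyBounded W k)
    (hq : PolyBounded W fun a => (n a + 1) ^ k a) :
    PolyBounded W fun a => roundCost (n a) (k a) :=
  hq.mul hW ((hq.add hW hk).add hW (const hW 4))

theorem PolyBounded.standardBits (hW : ∀ a, 1 ≤ W a) (hk : PolyBounded W k)
    (hq : PolyBounded W fun a => (n a + 1) ^ k a) (hx : PolyBounded W x) (hc : PolyBounded W c) :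
    PolyBounded W fun a => standardBits (n a) (k a) (x a) (c a) :=
  inverseBits hW hq hx (hc.mul hW hk)

theorem PolyBounded.reducedBits (hW : ∀ a, 1 ≤ W a) (hk : PolyBounded W k)
    (hq : PolyBounded W fun a => (n a + 1) ^ k a) (hx : PolyBounded W x) (hc : PolyBounded W c) :
    PolyBounded W fun a => reducedBits (n a) (k a) (x a) (c a) :=
  ((((standardBits hW hk hq hx hc).add hW hq).add hW hx).add hW (hc.mul hW hk)).add hW (const hW 1)

theorem PolyBounded.squareBits (hW : ∀ a, 1 ≤ W a) (hd : PolyBounded W d)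
    (hq : PolyBounded W fun a => (n a + 1) ^ d a) (hx : PolyBounded W x) (hc : PolyBounded W c)
    (hρ : PolyBounded W ρ) : PolyBounded W fun a => squareBits (n a) (d a) (x a) (c a) (ρ a) :=
  ((((const hW 2).mul hW (((standardBits hW hd hq hx hc).add hW hq).add hW (hc.mul hW hd))).add hW
    ((const hW 2).mul hW hx)).add hW hρ).add hW (hc.mul hW ((const hW 2).mul hW hd))

theorem PolyBounded.approxBits (hW : ∀ a, 1 ≤ W a) (hd : PolyBounded W d)
    (hq : PolyBounded W fun a => (n a + 1) ^ d a) (hx : PolyBounded W x) (hc : PolyBounded W c)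
    (hρ : PolyBounded W ρ) (he : PolyBounded W e) (hb : PolyBounded W b) (hu : PolyBounded W u) :
    PolyBounded W fun a => approxBits (n a) (d a) (x a) (c a) (ρ a) (e a) (b a) (u a) := by
  have hq2 : PolyBounded W fun a => (n a + 1) ^ (2 * d a) := by
    simp only [mul_comm 2 (d _), pow_mul]
    exact hq.pow hW 2
  exact (hq2.add hW ((((((const hW 2).mul hW (he.add hW hq2)).add hW ((const hW 2).mul hW
    ((squareBits hW hd hq hx hc hρ).add hW (const hW 1)))).add hW hb).add hW hu).add hW
      (const hW 2))).add hW (const hW 2)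

end PolyBounded

end PCSoS

end

noncomputable section

namespace PCSoS

open MvPolynomial Classical

/-! ### The Polynomial Calculus criterion for constraint languages -/

section Criterion

/-- Constants that depend only on the constraint language. -/
structure LanguageBound {D : Finset ℚ} (Γ : Set (DomRelation D)) (r Z M K z c : ℕ) : Prop where
  nonempty : D.Nonempty
  closed : SemilatticeClosed Γ ∨ DualDiscriminatorClosed Γ
  arity : ∀ R ∈ Γ, R.arity ≤ r
  indicator : IndicatorBound D Z M
  domainPoly : ∀ (n : ℕ) (i : Fin n), bitSize (domainPoly D i) ≤ K * (n + 1)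
  point : ∀ (n : ℕ) (Y : Type) (pt : Y → Fin n → ℚ), (∀ y i, pt y i ∈ D) → PointBound pt z c

theorem exists_languageBound {D : Finset ℚ} (hD : D.Nonempty) {Γ : Set (DomRelation D)}
    (hΓf : Γ.Finite) (hΓ : SemilatticeClosed Γ ∨ DualDiscriminatorClosed Γ) :
    ∃ r Z M K z c, LanguageBound Γ r Z M K z c := by
  obtain ⟨Z, M, hZ⟩ := exists_indicatorBound D
  obtain ⟨K, hK⟩ := exists_bitSize_domainPoly_le D
  obtain ⟨z, c, hz⟩ := exists_pointBound D
  exact ⟨hΓf.toFinset.sup DomRelation.arity, Z, M, K, z, c, hD, hΓ,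
    fun R hR => Finset.le_sup (f := DomRelation.arity) (hΓf.mem_toFinset.2 hR), hZ, hK, hz⟩

/-- The factor in the degree bound of the derivations. -/
def degreeFactor (s r Δ : ℕ) : ℕ := (2 * (2 + r * s + Δ) + 2 * r + 2) * s + Δ

/-- A bound for the bit length of the reduced polynomials and of the input. -/
def basisBits (s r Δ M K c n β d : ℕ) : ℕ :=
  M * (2 * d + r * s + Δ + 1) + 2 * (β + K * (n + 1)) + reducedBits n (2 * d) (n * s) c

/-- A bound for the length of the derivations. -/
def derivationLength (s n k : ℕ) : ℕ := (n * s + 4) * roundCost n k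

variable {D : Finset ℚ} {Γ : Set (DomRelation D)} {r Z M K z c : ℕ} {n : ℕ} {ι : Type}
  {f : ι → MvPolynomial (Fin n) ℚ} {C : ι → Constraint Γ n} {β Δ d : ℕ}

theorem LanguageBound.pointBound (h : LanguageBound Γ r Z M K z c)
    (f : ι → MvPolynomial (Fin n) ℚ) : PointBound (Solution.pt (D := D) (f := f)) z c :=
  h.point n _ _ fun y i => (y.1 i).2

theorem LanguageBound.exists_reducedFamily [Fintype ι] (h : LanguageBound Γ r Z M K z c)
    (hf : ∀ j, Represents (f j) (C j)) (hΔ : ∀ j, (f j).totalDegree ≤ Δ)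
    (hβ : ∀ j, bitSize (f j) ≤ β) (hd : 1 ≤ d) :
    ∃ G, IsReducedFamily (Solution.pt (D := D) (f := f)) G ∧
      ∀ m, ¬ IsStandard (Solution.pt (D := D) (f := f)) m → m.degree ≤ 2 * d →
        l1 (toReal (G m)) ≤ 2 ^ basisBits D.card r Δ M K c n β d ∧
        ∃ L, IsBoundedDerivation (domainSystem D f) (degreeFactor D.card r Δ * d)
          (lineBits n (degreeFactor D.card r Δ * d) (basisBits D.card r Δ M K c n β d)) ∅ L ∧
          G m ∈ L ∧ L.length ≤ derivationLength D.card n (degreeFactor D.card r Δ * d) := by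
  set s := D.card with hs
  set k := degreeFactor s r Δ * d with hk
  set bb := basisBits s r Δ M K c n β d with hbb
  have hs1 : 1 ≤ s := Finset.card_pos.2 h.nonempty
  have hpb := h.pointBound f
  have hcard := card_solution_le D f
  have hex : ∀ m, ∃ g, ¬ IsStandard (Solution.pt (D := D) (f := f)) m →
      IsReduced (Solution.pt (D := D) (f := f)) m g ∧
        (m.degree ≤ 2 * d → l1 (toReal g) ≤ 2 ^ reducedBits n (2 * d) (n * s) c) := by
    intro m
    by_cases hm : IsStandard (Solution.pt (D := D) (f := f)) m
    · exact ⟨0, fun h => absurd hm h⟩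
    · by_cases hmd : m.degree ≤ 2 * d
      · obtain ⟨g, hg, hgb⟩ := hpb.exists_reduced hcard hm hmd
        exact ⟨g, fun _ => ⟨hg, fun _ => hgb⟩⟩
      · obtain ⟨g, hg, -⟩ := hpb.exists_reduced hcard hm le_rfl
        exact ⟨g, fun _ => ⟨hg, fun h => absurd h hmd⟩⟩
  choose G hG using hex
  refine ⟨G, fun m hm => (hG m hm).1, fun m hm hmd => ?_⟩
  obtain ⟨hred, hb⟩ := hG m hm
  have hbits : l1 (toReal (G m)) ≤ 2 ^ bb :=
    (hb hmd).trans (pow_le_pow_right₀ (by norm_num) (by rw [hbb, basisBits]; omega))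
  refine ⟨hbits, ?_⟩
  -- The degree needed is affine in `d`; since `d ≥ 1`, the constants are absorbed into a multiple
  -- of `d`. The parameter `2 * d` is the degree up to which basis elements are derived.
  have hkd : (2 * (2 * d + r * s + Δ) + 2 * r + 2) * s + Δ ≤ k := by
    rw [hk, degreeFactor, add_mul _ Δ d]
    refine Nat.add_le_add ?_ (Nat.le_mul_of_pos_right _ hd)
    have h1 : r * s + Δ ≤ (r * s + Δ) * d := Nat.le_mul_of_pos_right _ hd
    have h2 : r ≤ r * d := Nat.le_mul_of_pos_right _ hd
    calc _ ≤ ((2 * (2 + r * s + Δ) + 2 * r + 2) * d) * s := Nat.mul_le_mul_right _ (by nlinarith)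
      _ = _ := by ring
  have h2dk : 2 * d ≤ k := by
    refine le_trans ?_ ((Nat.le_mul_of_pos_right _ hs1).trans ((Nat.le_add_right _ Δ).trans hkd))
    omega
  have hdeg : (G m).totalDegree ≤ 2 * d := hred.totalDegree_le.trans hmd
  have hlevel := mem_level_of_language (e := 2 * d) (k := k) (b := M * (2 * d + r * s + Δ + 1))
    h.closed h.arity hf hΔ ⟨h.nonempty, h.indicator, hkd, le_rfl⟩ hdeg
    fun a ha => hred.vanishes ⟨a, ha⟩
  have hPβ : ∀ j, bitSize (domainSystem D f j) ≤ β + K * (n + 1) := by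
    rintro (j | i)
    · exact (hβ j).trans (Nat.le_add_right _ _)
    · exact (h.domainPoly n i).trans (Nat.le_add_left _ _)
  obtain ⟨L, hL, hGL, hlen⟩ := exists_derivation_of_mem_level (b' := bb) hPβ
    (by rw [hbb, basisBits]; omega) (by rw [hbb, basisBits]; omega) hlevel
    ⟨hred.integral, hbits, hdeg.trans h2dk⟩ hred.ne_zero
  refine ⟨L, hL, hGL, hlen.trans (Nat.mul_le_mul_right _ ?_)⟩
  rw [DomainOrder.closureLevel]

end Criterion

end PCSoS

end

noncomputable section

namespace PCSoS

open MvPolynomial Classical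

/-! ### Polynomial dependence of all bounds on the parameters -/

section Bounds

theorem HasPCDerivation.mono {n : ℕ} {ι : Type} {P : ι → MvPolynomial (Fin n) ℚ}
    {r : MvPolynomial (Fin n) ℚ} {k k' l l' : ℕ} (h : HasPCDerivation P r k l) (hk : k ≤ k')
    (hl : l ≤ l') : HasPCDerivation P r k' l' := by
  obtain ⟨L, h1, h2, h3⟩ := h
  exact ⟨L, h1, fun q hq => (h2 q hq).trans hk, h3.trans hl⟩

theorem SoSProof.DegreeLE.mono {n : ℕ} {ι : Type} [Fintype ι] {P : ι → MvPolynomial (Fin n) ℚ}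
    {r : MvPolynomial (Fin n) ℝ} {π : SoSProof P r} {k k' : ℕ} (h : π.DegreeLE k) (hk : k ≤ k') :
    π.DegreeLE k' :=
  ⟨fun i => (h.1 i).trans hk, fun j => (h.2 j).trans hk⟩

theorem SoSProof.CoeffLE.mono {n : ℕ} {ι : Type} [Fintype ι] {P : ι → MvPolynomial (Fin n) ℚ}
    {r : MvPolynomial (Fin n) ℝ} {π : SoSProof P r} {B B' : ℝ} (h : π.CoeffLE B) (hB : B ≤ B') :
    π.CoeffLE B' :=
  ⟨fun i => (h.1 i).trans hB, fun j => (h.2 j).trans hB⟩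

/-- The parameters of the criterion; `e` and `ρ` bound the logarithms of the error and of the norm
of the approximated polynomial. -/
structure Params where
  n : ℕ
  β : ℕ
  d : ℕ
  e : ℕ
  ρ : ℕ
  one_le : 1 ≤ d
  le_pow : d ≤ (n + 1) ^ d

/-- The quantity in which all bounds are polynomial. -/
def Params.size (p : Params) : ℕ := (p.n + 1) ^ p.d * (p.β + 1) * (p.e + 1) * (p.ρ + 1)

theorem Params.one_le_size (p : Params) : 1 ≤ p.size := Nat.succ_le_of_lt (by
  rw [Params.size]
  positivity)

theorem Params.le_size (p : Params) :
    (p.n + 1) ^ p.d ≤ p.size ∧ p.β + 1 ≤ p.size ∧ p.e + 1 ≤ p.size ∧ p.ρ + 1 ≤ p.size := by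
  have hN : 0 < (p.n + 1) ^ p.d := by positivity
  rw [Params.size]
  refine ⟨?_, ?_, ?_, ?_⟩
  · rw [mul_assoc, mul_assoc]
    exact Nat.le_mul_of_pos_right _ (by positivity)
  · rw [mul_comm ((p.n + 1) ^ p.d), mul_assoc, mul_assoc]
    exact Nat.le_mul_of_pos_right _ (by positivity)
  · rw [mul_assoc, mul_left_comm]
    exact Nat.le_mul_of_pos_right _ (by positivity)
  · exact Nat.le_mul_of_pos_left _ (by positivity)

theorem polyBounded_pow (K : ℕ) :
    PolyBounded Params.size fun p : Params => (p.n + 1) ^ (K * p.d) := by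
  simp only [mul_comm K, pow_mul]
  exact (PolyBounded.of_le fun p => p.le_size.1).pow Params.one_le_size K

theorem polyBounded_d : PolyBounded Params.size Params.d :=
  PolyBounded.of_le fun p => p.le_pow.trans p.le_size.1

theorem polyBounded_n : PolyBounded Params.size Params.n :=
  PolyBounded.of_le fun p => (Nat.le_succ _).trans
    ((Nat.le_self_pow (Nat.one_le_iff_ne_zero.1 p.one_le) _).trans p.le_size.1)

theorem polyBounded_β : PolyBounded Params.size Params.β :=
  PolyBounded.of_le fun p => (Nat.le_succ _).trans p.le_size.2.1

theorem polyBounded_e : PolyBounded Params.size Params.e :=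
  PolyBounded.of_le fun p => (Nat.le_succ _).trans p.le_size.2.2.1

theorem polyBounded_ρ : PolyBounded Params.size Params.ρ :=
  PolyBounded.of_le fun p => (Nat.le_succ _).trans p.le_size.2.2.2

variable (s r Δ M K c κ K₀ : ℕ)

theorem polyBounded_basisBits :
    PolyBounded Params.size fun p => basisBits s r Δ M K c p.n p.β p.d := by
  have hW := Params.one_le_size
  have h2 : PolyBounded Params.size fun p => 2 * p.d := (PolyBounded.const hW 2).mul hW polyBounded_d
  have hred := PolyBounded.reducedBits hW h2 (polyBounded_pow 2)
    (polyBounded_n.mul hW (.const hW s)) (.const hW c)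
  exact (((PolyBounded.const hW M).mul hW (((h2.add hW (.const hW (r * s))).add hW
    (.const hW Δ)).add hW (.const hW 1))).add hW ((PolyBounded.const hW 2).mul hW
      (polyBounded_β.add hW ((PolyBounded.const hW K).mul hW
        (polyBounded_n.add hW (.const hW 1)))))).add hW hred

/-- A bound for the lines of the derivations of the reduced polynomials. -/
def basisLineBits (n β d : ℕ) : ℕ := lineBits n (κ * d) (basisBits s r Δ M K c n β d)

theorem polyBounded_basisLineBits :
    PolyBounded Params.size fun p => basisLineBits s r Δ M K c κ p.n p.β p.d := by
  have hW := Params.one_le_size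
  exact PolyBounded.lineBits hW polyBounded_n ((PolyBounded.const hW κ).mul hW polyBounded_d)
    (polyBounded_pow κ) (polyBounded_basisBits s r Δ M K c)

theorem polyBounded_derivationLength :
    PolyBounded Params.size fun p => derivationLength s p.n (κ * p.d) := by
  have hW := Params.one_le_size
  exact ((polyBounded_n.mul hW (.const hW s)).add hW (.const hW 4)).mul hW
    (PolyBounded.roundCost hW ((PolyBounded.const hW κ).mul hW polyBounded_d) (polyBounded_pow κ))

theorem polyBounded_derivationSize : PolyBounded Params.size fun p =>
    (derivationLength s p.n (κ * p.d) + 1) * basisLineBits s r Δ M K c κ p.n p.β p.d := by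
  have hW := Params.one_le_size
  exact ((polyBounded_derivationLength s κ).add hW (.const hW 1)).mul hW
    (polyBounded_basisLineBits s r Δ M K c κ)

/-- A bound for the coefficients of approximate proofs. -/
def languageApproxBits (n β d e ρ : ℕ) : ℕ :=
  approxBits n d (n * s) c ((n + 1) ^ (2 * d) + ρ) e (basisBits s r Δ M K c n β d)
    ((K₀ + 2 * basisLineBits s r Δ M K c κ n β d) * derivationLength s n (κ * d))

theorem polyBounded_languageApproxBits : PolyBounded Params.size fun p =>
    languageApproxBits s r Δ M K c κ K₀ p.n p.β p.d p.e p.ρ := by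
  have hW := Params.one_le_size
  refine PolyBounded.approxBits hW polyBounded_d (PolyBounded.of_le fun p => p.le_size.1)
    (polyBounded_n.mul hW (.const hW s)) (.const hW c) ((polyBounded_pow 2).add hW polyBounded_ρ)
    polyBounded_e (polyBounded_basisBits s r Δ M K c) ?_
  exact ((PolyBounded.const hW K₀).add hW ((PolyBounded.const hW 2).mul hW
    (polyBounded_basisLineBits s r Δ M K c κ))).mul hW (polyBounded_derivationLength s κ)

/-- The natural numbers `e` and `ρ` are logarithms rounded up. Rounding costs a factor `2` for each
of them, hence the factor `4 ^ B`. -/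
theorem two_pow_le_rpow {A B e ρ a : ℕ} {t x y : ℝ} (ht : 1 ≤ t) (hx : 0 ≤ x) (hy : 0 ≤ y)
    (he : (e : ℝ) ≤ 1 + x) (hρ : (ρ : ℝ) ≤ 1 + y)
    (ha : (a : ℝ) ≤ B * (t * (e + 1) * (ρ + 1)) ^ B) (hA : B * 4 ^ B + B ≤ A) :
    (2 : ℝ) ^ a ≤ (2 : ℝ) ^ ((A : ℝ) * (t * (1 + x) * (1 + y)) ^ A) := by
  rw [← Real.rpow_natCast]
  refine Real.rpow_le_rpow_of_exponent_le (by norm_num) (ha.trans ?_)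
  set w := t * (1 + x) * (1 + y) with hw
  have hw1 : 1 ≤ w := by
    have h1 : 1 ≤ t * (1 + x) := one_le_mul_of_one_le_of_one_le ht (by linarith)
    exact one_le_mul_of_one_le_of_one_le h1 (by linarith)
  have h1 : t * (e + 1) * (ρ + 1) ≤ 4 * w := by
    calc t * (e + 1) * (ρ + 1) ≤ t * (2 * (1 + x)) * (2 * (1 + y)) := by
          gcongr <;> linarith
      _ = 4 * w := by rw [hw]; ring
  calc (B : ℝ) * (t * (e + 1) * (ρ + 1)) ^ B ≤ B * (4 * w) ^ B := by gcongr
    _ = (B * 4 ^ B) * w ^ B := by rw [mul_pow]; ring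
    _ ≤ A * w ^ A := by
        refine mul_le_mul ?_ (pow_le_pow_right₀ hw1 (by omega)) (by positivity) (by positivity)
        have : B * 4 ^ B ≤ A := by omega
        exact_mod_cast this

end Bounds

/-! ### The criterion and its conclusion for constraint languages -/

section Criterion

variable {D : Finset ℚ} {Γ : Set (DomRelation D)} {r Z M K z c : ℕ}

theorem LanguageBound.exists_pcCriterion (h : LanguageBound Γ r Z M K z c) (Δ : ℕ) :
    ∃ A₀ : ℕ, ∀ (n : ℕ) (ι : Type) [Fintype ι] (C : ι → Constraint Γ n)
      (f : ι → MvPolynomial (Fin n) ℚ) (β : ℕ),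
      (∀ j, Represents (f j) (C j)) → (∀ j, (f j).totalDegree ≤ Δ) →
      (∀ j, bitSize (f j) ≤ β) → ∀ d : ℕ, 1 ≤ d → d ≤ (n + 1) ^ d →
        ∀ A, A₀ ≤ A → PCCriterionApplies (domainSystem D f) A β d := by
  obtain ⟨A₁, hA₁⟩ := polyBounded_basisBits D.card r Δ M K c
  obtain ⟨A₂, hA₂⟩ := polyBounded_derivationSize D.card r Δ M K c (degreeFactor D.card r Δ)
  refine ⟨A₁ + A₂ + degreeFactor D.card r Δ, ?_⟩
  intro n ι _ C f β hf hΔ hβ d hd hnd A hA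
  obtain ⟨G, hG, hGd⟩ := h.exists_reducedFamily hf hΔ hβ hd
  have hpb := h.pointBound f
  have hT : 1 ≤ (n + 1) ^ d * (β + 1) := Nat.succ_le_of_lt (by positivity)
  -- The cutoff must reach `n * D.card` for a Gröbner basis. Only elements of degree at most `2 * d`
  -- need derivations.
  refine ⟨(nonstandardMonomials Solution.pt (2 * d + n * D.card)).image G,
    hpb.isGroebnerBasis hG (fun y i => (y.1 i).2) (Nat.le_add_left _ _)
      fun p => mem_idealOf_domainSystem, ?_⟩
  intro g hg hgd
  obtain ⟨m, hm, rfl⟩ := Finset.mem_image.1 hg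
  have hm2 := (mem_nonstandardMonomials.1 hm).2
  rw [(hG m hm2).totalDegree_eq] at hgd
  obtain ⟨hb, L, hL, hGL, hlen⟩ := hGd m hm2 hgd
  have h1 := hA₁ ⟨n, β, d, 0, 0, hd, hnd⟩
  have h2 := hA₂ ⟨n, β, d, 0, 0, hd, hnd⟩
  simp only [Params.size, zero_add, mul_one] at h1 h2
  refine ⟨(coeffNorm_le_l1 _).trans (hb.trans (pow_le_pow_right₀ (by norm_num)
    (h1.trans (mul_pow_mono hT (by omega))))), ?_⟩
  refine (hL.hasPCDerivation hGL).mono (Nat.mul_le_mul_right _ (by omega)) ?_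
  refine le_trans ?_ (h2.trans (mul_pow_mono hT (by omega)))
  exact Nat.mul_le_mul_right _ (by omega)

theorem LanguageBound.exists_approxSoS (h : LanguageBound Γ r Z M K z c) (Δ : ℕ) :
    ∃ A₀ : ℕ, ∀ (n : ℕ) (ι : Type) [Fintype ι] (C : ι → Constraint Γ n)
      (f : ι → MvPolynomial (Fin n) ℚ) (β : ℕ),
      (∀ j, Represents (f j) (C j)) → (∀ j, (f j).totalDegree ≤ Δ) →
      (∀ j, bitSize (f j) ≤ β) → ∀ d : ℕ, 1 ≤ d → d ≤ (n + 1) ^ d →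
        ∀ A, A₀ ≤ A → HasApproxSoSProofs (domainSystem D f) A β d := by
  obtain ⟨K₀, hK₀⟩ := exists_negSq_constant D
  set s := D.card with hs
  set κ := degreeFactor s r Δ with hκ
  obtain ⟨A₁, hA₁⟩ := polyBounded_languageApproxBits s r Δ M K c κ K₀
  refine ⟨A₁ * 4 ^ A₁ + A₁ + (2 * κ + K₀ + 4), ?_⟩
  intro n ι _ C f β hf hΔ hβ d hd hnd A hA p hp ε hε
  obtain ⟨G, hG, hGd⟩ := h.exists_reducedFamily hf hΔ hβ hd
  have hpb := h.pointBound f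
  have hp0 : (0 : ℝ) ≤ coeffNorm p := (coeffNorm p).2
  set e := ⌈|Real.logb 2 ε|⌉₊ with he
  set ρ := ⌈Real.logb 2 (1 + coeffNorm p)⌉₊ with hρ
  have hy : 0 ≤ Real.logb 2 (1 + coeffNorm p) := Real.logb_nonneg (by norm_num) (by linarith)
  have he1 : |Real.logb 2 ε| ≤ e := Nat.le_ceil _
  have hε1 : ε ≤ 2 ^ e := by
    rw [← Real.rpow_natCast, ← Real.logb_le_iff_le_rpow (by norm_num) hε]
    exact (le_abs_self _).trans he1
  have hε2 : 1 ≤ ε * 2 ^ e := by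
    rw [← inv_le_iff_one_le_mul₀' hε, ← Real.rpow_natCast,
      ← Real.logb_le_iff_le_rpow (by norm_num) (inv_pos.2 hε), Real.logb_inv]
    exact (neg_le_abs _).trans he1
  have hpρ : (coeffNorm p : ℝ) ≤ 2 ^ ρ := by
    have h1 : 1 + (coeffNorm p : ℝ) ≤ 2 ^ ρ := by
      rw [← Real.rpow_natCast, ← Real.logb_le_iff_le_rpow (by norm_num) (by linarith)]
      exact Nat.le_ceil _
    linarith
  have hpd : p.totalDegree ≤ 2 * d := by
    obtain ⟨π, hπ⟩ := hp
    rw [π.identity]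
    exact (totalDegree_add _ _).trans (max_le (totalDegree_finsetSum_le fun i _ => hπ.1 i)
      (totalDegree_finsetSum_le fun j _ => hπ.2 j))
  -- The passage from the largest coefficient to `l1` costs the number of monomials, bounded crudely
  -- by a power of two.
  have hpl : l1 p ≤ 2 ^ ((n + 1) ^ (2 * d) + ρ) := by
    refine (l1_le_card_mul_coeffNorm hpd).trans ?_
    rw [pow_add]
    refine mul_le_mul ?_ hpρ hp0 (by positivity)
    exact_mod_cast Nat.lt_two_pow_self.le
  have hsos := hpb.hasSoS_add_const hG (card_solution_le D f) (k := (2 * κ + K₀ + 4) * d)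
    (b := basisBits s r Δ M K c n β d)
    (u := (K₀ + 2 * basisLineBits s r Δ M K c κ n β d) * derivationLength s n (κ * d))
    (fun j y => eval_domainSystem_solution j y) (by nlinarith) (fun m hm hmd => (hGd m hm hmd).1)
    (fun m hm hmd => by
      obtain ⟨-, L, hL, hGL, hlen⟩ := hGd m hm hmd
      refine (hK₀ n ι f _ _ L hL _ hGL).mono ?_ (pow_le_pow_right₀ (by norm_num)
        (Nat.mul_le_mul_left _ hlen))
      nlinarith) hp hpl hε2 hε1
  obtain ⟨π, hπd, hπc⟩ := hsos.exists_coeffLE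
  refine ⟨π, hπd.mono (Nat.mul_le_mul_right _ (by omega)), hπc.mono ?_⟩
  have hbound := hA₁ ⟨n, β, d, e, ρ, hd, hnd⟩
  refine two_pow_le_rpow (B := A₁) (e := e) (ρ := ρ) ?_ (abs_nonneg _) hy ?_ ?_ ?_ (by omega)
  · have h1 : (1 : ℝ) ≤ ((n : ℝ) + 1) ^ d := one_le_pow₀ (by linarith [Nat.cast_nonneg (α := ℝ) n])
    exact one_le_mul_of_one_le_of_one_le h1 (by linarith [Nat.cast_nonneg (α := ℝ) β])
  · linarith [Nat.ceil_lt_add_one (abs_nonneg (Real.logb 2 ε))]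
  · linarith [Nat.ceil_lt_add_one hy]
  · exact_mod_cast hbound

theorem totalDegree_eq_zero_of_fin_zero {R : Type*} [CommSemiring R] {n : ℕ} (hn : n = 0)
    (p : MvPolynomial (Fin n) R) : p.totalDegree = 0 := by
  subst hn
  exact Nat.le_zero.1 (totalDegree_le_of_support fun m _ => by simp [Finsupp.degree_eq_sum])

/-- Polynomial Calculus derivations and approximate sum-of-squares proofs for languages with a
semilattice or a dual discriminator polymorphism. -/
theorem exists_criterion_constant {D : Finset ℚ} (hD : D.Nonempty) {Γ : Set (DomRelation D)}
    (hΓf : Γ.Finite) (hΓ : SemilatticeClosed Γ ∨ DualDiscriminatorClosed Γ) (Δ : ℕ) :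
    ∃ A : ℕ, ∀ (n : ℕ) (ι : Type) [Fintype ι] (c : ι → Constraint Γ n)
      (f : ι → MvPolynomial (Fin n) ℚ) (β : ℕ),
      (∀ j, Represents (f j) (c j)) → (∀ j, (f j).totalDegree ≤ Δ) →
      (∀ j, bitSize (f j) ≤ β) → ∀ d : ℕ, 1 ≤ d →
        PCCriterionApplies (domainSystem D f) A β d ∧
          HasApproxSoSProofs (domainSystem D f) A β d := by
  obtain ⟨r, Z, M, K, z, c, h⟩ := exists_languageBound hD hΓf hΓ
  obtain ⟨A₁, hA₁⟩ := h.exists_pcCriterion Δ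
  obtain ⟨A₂, hA₂⟩ := h.exists_approxSoS Δ
  refine ⟨A₁ + A₂, ?_⟩
  intro n ι _ C f β hf hΔ hβ d hd
  have hsmall : ∀ d, 1 ≤ d → d ≤ (n + 1) ^ d → PCCriterionApplies (domainSystem D f) (A₁ + A₂) β d ∧
      HasApproxSoSProofs (domainSystem D f) (A₁ + A₂) β d := fun d hd hnd =>
    ⟨hA₁ n ι C f β hf hΔ hβ d hd hnd _ (by omega), hA₂ n ι C f β hf hΔ hβ d hd hnd _ (by omega)⟩
  -- For `n = 0` the quantity `(n + 1) ^ d` is `1` and does not bound `d`. All polynomials are then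
  -- constant, and the case `d = 1` yields every `d`.
  rcases Nat.eq_zero_or_pos n with hn | hn
  · obtain ⟨h1, h2⟩ := hsmall 1 le_rfl (by simp)
    have hle : (A₁ + A₂) * 1 ≤ (A₁ + A₂) * d := Nat.mul_le_mul_left _ hd
    have hpow : (n + 1) ^ 1 = (n + 1) ^ d := by simp [hn]
    have hpow' : ((n : ℝ) + 1) ^ 1 = ((n : ℝ) + 1) ^ d := by simp [hn]
    refine ⟨?_, ?_⟩
    · obtain ⟨G, hG, hGd⟩ := h1
      refine ⟨G, hG, fun g hg _ => ?_⟩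
      obtain ⟨h3, h4⟩ := hGd g hg (by rw [totalDegree_eq_zero_of_fin_zero hn]; omega)
      rw [hpow] at h3 h4
      exact ⟨h3, h4.mono hle le_rfl⟩
    · intro p ⟨π, _⟩ ε hε
      obtain ⟨π', h3, h4⟩ := h2 p ⟨π, fun _ => by rw [totalDegree_eq_zero_of_fin_zero hn]; omega,
        fun _ => by rw [totalDegree_eq_zero_of_fin_zero hn]; omega⟩ ε hε
      rw [hpow'] at h4
      exact ⟨π', h3.mono hle, h4⟩
  · refine hsmall d hd (Nat.lt_two_pow_self.le.trans (Nat.pow_le_pow_left (by omega) d))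

end Criterion

end PCSoS

end

noncomputable section

namespace PCSoS

open MvPolynomial

/-! ### A functional that defeats low-degree refutations of the induction principle -/

section Functional

/-- Concatenates the first `N` values of `u` with `v`. -/
def join (N : ℕ) (u v : ℕ → ℝ) (i : ℕ) : ℝ := if i < N then u i else v (i - N)

/-- A functional on functions of assignments that annihilates the axioms of the induction
principle, multiplied by arbitrary monomials, up to degree `t + 1`. -/
def refuter : ℕ → ((ℕ → ℝ) → ℝ) →ₗ[ℝ] ℝ
  | 0 => LinearMap.proj fun i => if i = 0 then 1 else 0
  | t + 1 =>
    refuter t ∘ₗ LinearMap.funLeft ℝ ℝ (join (2 ^ (t + 1)) fun _ => 1) +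
      refuter t ∘ₗ LinearMap.funLeft ℝ ℝ (fun u => join (2 ^ (t + 1)) u fun _ => 0) -
      refuter t ∘ₗ LinearMap.pi fun u => refuter t ∘ₗ LinearMap.funLeft ℝ ℝ (join (2 ^ (t + 1)) u)

theorem refuter_zero (F : (ℕ → ℝ) → ℝ) : refuter 0 F = F fun i => if i = 0 then 1 else 0 := rfl

/-- The chain is cut in two. The summands set the left half to `1`, set the right half to `0`, and
run the functional independently on both halves; the signs give total weight `1 + 1 - 1 = 1`. -/
theorem refuter_succ (t : ℕ) (F : (ℕ → ℝ) → ℝ) : refuter (t + 1) F =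
    refuter t (fun v => F (join (2 ^ (t + 1)) (fun _ => 1) v)) +
      refuter t (fun u => F (join (2 ^ (t + 1)) u fun _ => 0)) -
      refuter t fun u => refuter t fun v => F (join (2 ^ (t + 1)) u v) := rfl

/-- The assignments that the functional looks at. -/
structure IsNode (t : ℕ) (w : ℕ → ℝ) : Prop where
  first : w 0 = 1
  last : ∀ i, 2 ^ (t + 1) ≤ i + 1 → w i = 0
  boolean : ∀ i, w i = 0 ∨ w i = 1

theorem IsNode.join {t : ℕ} {u v : ℕ → ℝ} (hu : u 0 = 1) (hub : ∀ i, u i = 0 ∨ u i = 1)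
    (hv : ∀ i, 2 ^ (t + 1) ≤ i + 1 → v i = 0) (hvb : ∀ i, v i = 0 ∨ v i = 1) :
    IsNode (t + 1) (join (2 ^ (t + 1)) u v) := by
  have hpos : 0 < 2 ^ (t + 1) := by positivity
  refine ⟨?_, fun i hi => ?_, fun i => ?_⟩
  · rw [PCSoS.join, if_pos hpos, hu]
  · rw [pow_succ] at hi
    rw [PCSoS.join, if_neg (by omega)]
    exact hv _ (by omega)
  · rw [PCSoS.join]
    split_ifs
    · exact hub i
    · exact hvb _

/-- The functional is a combination of evaluations at nodes. As nodes are Boolean, start with `1`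
and end with `0`, all axioms except the implications are annihilated in every degree. -/
theorem refuter_eq_zero {t : ℕ} {F : (ℕ → ℝ) → ℝ} (h : ∀ w, IsNode t w → F w = 0) :
    refuter t F = 0 := by
  induction t generalizing F with
  | zero =>
    rw [refuter_zero]
    refine h _ ⟨by simp, fun i hi => if_neg (by omega), fun i => ?_⟩
    split_ifs <;> simp
  | succ t ih =>
    rw [refuter_succ, ih, ih, ih]
    · simp
    · intro u hu
      exact ih fun v hv => h _ (.join hu.first hu.boolean hv.last hv.boolean)
    · intro u hu
      exact h _ (.join hu.first hu.boolean (fun _ _ => rfl) fun _ => Or.inl rfl)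
    · intro v hv
      exact h _ (.join rfl (fun _ => Or.inr rfl) hv.last hv.boolean)

theorem refuter_const (t : ℕ) (a : ℝ) : refuter t (fun _ => a) = a := by
  induction t with
  | zero => rfl
  | succ t ih =>
    rw [refuter_succ]
    simp only [ih]
    ring

theorem refuter_mul_const (t : ℕ) (F : (ℕ → ℝ) → ℝ) (a : ℝ) :
    refuter t (fun w => F w * a) = refuter t F * a := by
  have : (fun w => F w * a) = a • F := by
    funext w
    simp [mul_comm]
  rw [this, map_smul, smul_eq_mul, mul_comm]

theorem refuter_const_mul (t : ℕ) (F : (ℕ → ℝ) → ℝ) (a : ℝ) :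
    refuter t (fun w => a * F w) = a * refuter t F := by
  simp only [mul_comm a]
  exact refuter_mul_const t F a

/-- The value of a monomial, given as the list of its variables. -/
def listMon (l : List ℕ) (w : ℕ → ℝ) : ℝ := (l.map w).prod

theorem refuter_listMon_nil (t : ℕ) : refuter t (listMon []) = 1 := refuter_const t 1

theorem exists_listMon_join (N : ℕ) (l : List ℕ) : ∃ l₁ l₂ : List ℕ,
    l₁.length + l₂.length = l.length ∧
      ∀ u v, listMon l (join N u v) = listMon l₁ u * listMon l₂ v := by
  induction l with
  | nil => exact ⟨[], [], rfl, fun u v => by simp [listMon]⟩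
  | cons i l ih =>
    obtain ⟨l₁, l₂, hlen, h⟩ := ih
    by_cases hi : i < N
    · refine ⟨i :: l₁, l₂, by simp only [List.length_cons]; omega, fun u v => ?_⟩
      have := h u v
      simp only [listMon, List.map_cons, List.prod_cons] at this ⊢
      rw [this, join, if_pos hi, mul_assoc]
    · refine ⟨l₁, (i - N) :: l₂, by simp only [List.length_cons]; omega, fun u v => ?_⟩
      have := h u v
      simp only [listMon, List.map_cons, List.prod_cons] at this ⊢
      rw [this, join, if_neg hi, mul_left_comm]

/-- The product of an implication axiom and a monomial of low degree is annihilated. -/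
theorem refuter_implication {t i : ℕ} (l : List ℕ) (hl : l.length + 1 ≤ t)
    (hi : i + 1 < 2 ^ (t + 1)) :
    refuter t (fun w => w i * (1 - w (i + 1)) * listMon l w) = 0 := by
  induction t generalizing i l with
  | zero => omega
  | succ t ih =>
    set N := 2 ^ (t + 1) with hN
    have hN1 : 1 ≤ N := Nat.one_le_two_pow
    rw [pow_succ, ← hN] at hi
    obtain ⟨l₁, l₂, hlen, hjoin⟩ := exists_listMon_join N l
    rw [refuter_succ, ← hN]
    simp only [hjoin]
    -- The implication lies in the left half, crosses the cut, or lies in the right half. The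
    -- crossing one vanishes at every assignment used, since there either the last left value is `0`
    -- or the first right value is `1`.
    rcases lt_trichotomy (i + 1) N with h | h | h
    · have hji : ∀ u v, join N u v i = u i := fun u v => if_pos (by omega)
      have hji' : ∀ u v, join N u v (i + 1) = u (i + 1) := fun u v => if_pos h
      simp only [hji, hji', sub_self, mul_zero, zero_mul]
      simp only [← mul_assoc, refuter_mul_const, refuter_const_mul, refuter_const]
      -- The constant left half kills the first summand. If the monomial does not involve the right
      -- half, the other two cancel. Otherwise its left part is shorter and the induction hypothesis
      -- applies with `t`.
      rcases l₂ with _ | ⟨a, l₂⟩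
      · simp [listMon, refuter_listMon_nil]
      · simp only [List.length_cons] at hlen
        rw [ih l₁ (by omega) h]
        simp
    · have hji : ∀ u v, join N u v i = u i := fun u v => if_pos (by omega)
      have hji' : ∀ u v, join N u v (i + 1) = v 0 := fun u v => by
        rw [join, if_neg (by omega)]
        congr 1
        omega
      simp only [hji, hji']
      rw [refuter_eq_zero, refuter_eq_zero, refuter_eq_zero]
      · simp
      · intro u hu
        refine refuter_eq_zero fun v hv => ?_
        simp [hv.first]
      · intro u hu
        rw [hu.last i (by omega)]
        simp
      · intro v hv
        simp [hv.first]
    · have hji : ∀ u v, join N u v i = v (i - N) := fun u v => if_neg (by omega)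
      have hji' : ∀ u v, join N u v (i + 1) = v (i - N + 1) := fun u v => by
        rw [join, if_neg (by omega)]
        congr 1
        omega
      simp only [hji, hji', zero_mul]
      have hcomm : ∀ u v : ℕ → ℝ, v (i - N) * (1 - v (i - N + 1)) * (listMon l₁ u * listMon l₂ v) =
          listMon l₁ u * (v (i - N) * (1 - v (i - N + 1)) * listMon l₂ v) := fun u v => by ring
      simp only [hcomm, refuter_const_mul, refuter_mul_const, refuter_const]
      -- The mirror image: now the constant right half kills the second summand.
      rcases l₁ with _ | ⟨a, l₁⟩
      · simp [listMon, refuter_listMon_nil]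
      · simp only [List.length_cons] at hlen
        rw [ih l₂ (by omega) (by omega)]
        simp

end Functional

/-! ### Degree lower bound for Nullstellensatz proofs -/

section LowerBound

theorem exists_listMon_monomial {n : ℕ} (m : Fin n →₀ ℕ) : ∃ l : List ℕ, l.length = m.degree ∧
    ∀ w : ℕ → ℝ, listMon l w = eval (fun i : Fin n => w i) (monomial m 1) := by
  induction m using Finsupp.induction_linear with
  | zero => exact ⟨[], by simp, fun w => by simp [listMon]⟩
  | add m m' h h' =>
    obtain ⟨l, hl, hlm⟩ := h
    obtain ⟨l', hl', hlm'⟩ := h'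
    refine ⟨l ++ l', by simp [hl, hl'], fun w => ?_⟩
    have h1 : (monomial (m + m') (1 : ℝ)) = monomial m 1 * monomial m' 1 := by simp [monomial_mul]
    rw [h1, map_mul, ← hlm, ← hlm']
    simp [listMon]
  | single i e =>
    refine ⟨List.replicate e i, by simp, fun w => ?_⟩
    simp [listMon, eval_monomial]

/-- Applying `refuter t` to a refutation would give `1 = 0`, since it annihilates every product on
the right. -/
theorem not_nsatz_of_degree_lt {n t : ℕ} (hn : 2 ^ (t + 1) ≤ n + 1)
    (h : (Fin n ⊕ Fin 2) ⊕ Fin (n + 1) → MvPolynomial (Fin (n + 1)) ℝ)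
    (hdeg : ∀ j, (h j * toReal (inductionSystem n j)).totalDegree ≤ t + 1) :
    (1 : MvPolynomial (Fin (n + 1)) ℝ) ≠ ∑ j, h j * toReal (inductionSystem n j) := by
  intro hone
  let val : MvPolynomial (Fin (n + 1)) ℝ → (ℕ → ℝ) → ℝ := fun p w =>
    eval (fun i : Fin (n + 1) => w i) p
  have hval : ∀ j, refuter t (val (h j * toReal (inductionSystem n j))) = 0 := by
    rintro ((i | i) | i)
    · have hax : toReal (inductionSystem n (Sum.inl (Sum.inl i))) =
          X i.castSucc * (1 - X i.succ) := by
        simp [inductionSystem, domainSystem, inductionEq]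
      -- The chain may be longer than the functional sees; nodes vanish from index `2 ^ (t + 1) - 1`
      -- on, which satisfies the implications there.
      by_cases hi : 2 ^ (t + 1) ≤ (i : ℕ) + 1
      · refine refuter_eq_zero fun w hw => ?_
        simp only [val, hax, map_mul, eval_X, Fin.val_castSucc, hw.last i hi]
        ring
      · set q := h (Sum.inl (Sum.inl i)) with hq
        have hd := hdeg (Sum.inl (Sum.inl i))
        rw [← hq, hax] at hd
        -- Degrees add over a domain and the axiom has degree two, so the multiplier has degree at
        -- most `t - 1`, as `refuter_implication` requires.
        have hqd : q ≠ 0 → q.totalDegree + 2 ≤ t + 1 := by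
          intro hq0
          have h1 : (1 - X i.succ : MvPolynomial (Fin (n + 1)) ℝ).coeff
              (Finsupp.single i.succ 1) ≠ 0 := by
            rw [coeff_sub, coeff_one, coeff_X, if_neg, if_pos rfl]
            · norm_num
            · intro h0
              simpa using (Finsupp.single_eq_zero.1 h0.symm)
          have h2 : (1 - X i.succ : MvPolynomial (Fin (n + 1)) ℝ) ≠ 0 := by
            intro h0
            rw [h0] at h1
            exact h1 (coeff_zero _)
          have h3 := degree_le_totalDegree (mem_support_iff.2 h1)
          rw [Finsupp.degree_single] at h3
          rw [totalDegree_mul_of_isDomain hq0 (mul_ne_zero (X_ne_zero _) h2),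
            totalDegree_mul_of_isDomain (X_ne_zero _) h2, totalDegree_X] at hd
          omega
        have hsum : val (q * toReal (inductionSystem n (Sum.inl (Sum.inl i)))) =
            ∑ m ∈ q.support, q.coeff m • fun w : ℕ → ℝ =>
              w i * (1 - w (i + 1)) * eval (fun i : Fin (n + 1) => w i) (monomial m 1) := by
          funext w
          rw [Finset.sum_apply]
          simp only [val, hax, map_mul, map_sub, map_one, eval_X, Fin.val_castSucc, Fin.val_succ,
            Pi.smul_apply, smul_eq_mul]
          conv_lhs => rw [q.as_sum, map_sum, Finset.sum_mul]
          refine Finset.sum_congr rfl fun m _ => ?_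
          rw [eval_monomial, eval_monomial]
          ring
        rw [hsum, map_sum]
        refine Finset.sum_eq_zero fun m hm => ?_
        obtain ⟨l, hl, hlm⟩ := exists_listMon_monomial m
        simp only [← hlm]
        rw [map_smul, refuter_implication l _ (by omega), smul_zero]
        have h1 := hqd (by rintro h0; simp [h0] at hm)
        have h2 := degree_le_totalDegree hm
        omega
    · refine refuter_eq_zero fun w hw => ?_
      fin_cases i
      · simp [val, inductionSystem, domainSystem, inductionEq, hw.first]
      · simp [val, inductionSystem, domainSystem, inductionEq, hw.last n hn]
    · refine refuter_eq_zero fun w hw => ?_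
      have h1 : toReal (inductionSystem n (Sum.inr i)) = ∏ ρ ∈ boolDomain, (X i - C (ρ : ℝ)) := by
        simp [inductionSystem, domainSystem, domainPoly, toReal_prod]
      have h2 : eval (fun i : Fin (n + 1) => w i) (toReal (inductionSystem n (Sum.inr i))) = 0 := by
        rw [h1, map_prod, Finset.prod_eq_zero_iff]
        rcases hw.boolean i with h3 | h3
        · exact ⟨0, by simp [boolDomain], by simp [h3]⟩
        · exact ⟨1, by simp [boolDomain], by simp [h3]⟩
      simp only [val, map_mul, h2, mul_zero]
  have h1 : refuter t (val 1) = 0 := by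
    have hadd : val (∑ j, h j * toReal (inductionSystem n j)) =
        ∑ j, val (h j * toReal (inductionSystem n j)) := by
      funext w
      rw [Finset.sum_apply]
      exact map_sum _ _ _
    rw [hone, hadd, map_sum]
    exact Finset.sum_eq_zero fun j _ => hval j
  have h2 : val 1 = fun _ => 1 := by
    funext w
    simp [val]
  rw [h2, refuter_const] at h1
  exact one_ne_zero h1

theorem variety_inductionSystem (n : ℕ) : variety (inductionSystem n) = ∅ := by
  rw [Set.eq_empty_iff_forall_notMem]
  intro x hx
  have h0 : x 0 = 1 := by
    have := hx (Sum.inl (Sum.inr 0))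
    simp [inductionSystem, domainSystem, inductionEq, sub_eq_zero] at this
    exact this.symm
  have hlast : x (Fin.last n) = 0 := by
    have := hx (Sum.inl (Sum.inr 1))
    simpa [inductionSystem, domainSystem, inductionEq] using this
  have hall : ∀ i, x i = 1 := by
    intro i
    induction i using Fin.induction with
    | zero => exact h0
    | succ i ih =>
      have := hx (Sum.inl (Sum.inl i))
      simp [inductionSystem, domainSystem, inductionEq, ih, sub_eq_zero] at this
      exact this.symm
  rw [hall] at hlast
  exact one_ne_zero hlast

/-- Without solutions the vanishing ideal contains `1`, so completeness would refute the system in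
degree `K * d`. The constant `1` works with the natural logarithm because `2 ≤ Real.exp 1`. -/
theorem not_nsatzComplete_inductionSystem {n K d : ℕ}
    (h : (K : ℝ) * d < 1 * Real.log (n + 1)) : ¬ NsatzComplete (inductionSystem n) K d := by
  intro hcomplete
  have hn : (0 : ℝ) < n + 1 := by positivity
  have hexp : (2 : ℝ) ^ (K * d) < n + 1 := by
    have h1 : Real.exp ((K : ℝ) * d) < n + 1 := by
      rw [← Real.lt_log_iff_exp_lt hn]
      linarith
    refine lt_of_le_of_lt ?_ h1
    have h2 : (2 : ℝ) ≤ Real.exp 1 := by linarith [Real.add_one_le_exp (1 : ℝ)]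
    calc (2 : ℝ) ^ (K * d) ≤ Real.exp 1 ^ (K * d) := by gcongr
      _ = Real.exp ((K : ℝ) * d) := by rw [← Real.exp_nat_mul]; simp
  have hnat : 2 ^ (K * d) < n + 1 := by exact_mod_cast hexp
  obtain ⟨g, hg, hgd⟩ := hcomplete 1 (by
    rw [idealOf, variety_inductionSystem]
    simp) (by simp)
  -- For `K * d = 0` the truncated subtraction gives `t = 0`, which only requires `1 ≤ n`.
  refine not_nsatz_of_degree_lt (t := K * d - 1) ?_ g (fun j => (hgd j).trans (by omega)) hg
  rcases Nat.eq_zero_or_pos (K * d) with h0 | h0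
  · rw [h0] at hnat ⊢
    simp at hnat ⊢
    omega
  · rw [Nat.sub_add_cancel h0]
    exact hnat.le

end LowerBound

end PCSoS

end

noncomputable section

namespace PCSoS

open MvPolynomial

/-! ### The induction principle as a constraint system -/

section Induction

/-- The relation `x = 1`. -/
def relOne : DomRelation boolDomain := ⟨1, {t | (t 0 : ℚ) = 1}⟩

/-- The relation `x = 0`. -/
def relZero : DomRelation boolDomain := ⟨1, {t | (t 0 : ℚ) = 0}⟩

/-- The relation `x → y`. -/
def relImp : DomRelation boolDomain := ⟨2, {t | (t 0 : ℚ) = 0 ∨ (t 1 : ℚ) = 1}⟩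

/-- The constraint language of the induction principle. -/
def inductionLanguage : Set (DomRelation boolDomain) := {relOne, relZero, relImp}

theorem boolDomain_cases (a : boolDomain) : (a : ℚ) = 0 ∨ (a : ℚ) = 1 := by
  simpa [boolDomain] using a.2

theorem semilatticeClosed_inductionLanguage : SemilatticeClosed inductionLanguage := by
  refine ⟨fun t => min (t 0) (t 1), ⟨fun a => min_self a, fun a b => min_comm a b,
    fun a b c => min_assoc a b c⟩, ?_⟩
  have hcoe : ∀ a b : boolDomain, ((min a b : boolDomain) : ℚ) = min (a : ℚ) b := fun a b =>
    Monotone.map_min (f := fun a : boolDomain => (a : ℚ)) fun _ _ h => h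
  rintro R (rfl | rfl | rfl)
  · intro (t : Fin 2 → Fin 1 → boolDomain) ht
    change ((min (t 0 0) (t 1 0) : boolDomain) : ℚ) = 1
    rw [hcoe, show ((t 0 0 : boolDomain) : ℚ) = 1 from ht 0,
      show ((t 1 0 : boolDomain) : ℚ) = 1 from ht 1, min_self]
  · intro (t : Fin 2 → Fin 1 → boolDomain) ht
    change ((min (t 0 0) (t 1 0) : boolDomain) : ℚ) = 0
    rw [hcoe, show ((t 0 0 : boolDomain) : ℚ) = 0 from ht 0,
      show ((t 1 0 : boolDomain) : ℚ) = 0 from ht 1, min_self]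
  · intro (t : Fin 2 → Fin 2 → boolDomain) ht
    change ((min (t 0 0) (t 1 0) : boolDomain) : ℚ) = 0 ∨
      ((min (t 0 1) (t 1 1) : boolDomain) : ℚ) = 1
    rw [hcoe, hcoe]
    have h0 : ((t 0 0 : boolDomain) : ℚ) = 0 ∨ ((t 0 1 : boolDomain) : ℚ) = 1 := ht 0
    have h1 : ((t 1 0 : boolDomain) : ℚ) = 0 ∨ ((t 1 1 : boolDomain) : ℚ) = 1 := ht 1
    rcases h0 with h0 | h0
    · rw [h0]
      left
      rcases boolDomain_cases (t 1 0) with h | h <;> rw [h] <;> norm_num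
    · rcases h1 with h1 | h1
      · rw [h1]
        left
        rcases boolDomain_cases (t 0 0) with h | h <;> rw [h] <;> norm_num
      · right
        rw [h0, h1, min_self]

theorem dualDiscriminatorClosed_inductionLanguage : DualDiscriminatorClosed inductionLanguage := by
  refine ⟨fun t => if t 1 = t 2 then t 1 else t 0, ⟨fun a b => ⟨?_, ?_, ?_⟩, ?_⟩, ?_⟩
  · change (if a = b then a else a) = a
    exact ite_self _
  · change (if b = a then b else a) = a
    split_ifs with h
    · exact h
    · rfl
  · change (if a = a then a else b) = a
    exact if_pos rfl
  · intro a b c _ _ hbc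
    exact if_neg hbc
  -- The operation returns any value taken by two of its arguments. Of three tuples satisfying the
  -- clause `x = 0 ∨ y = 1`, two satisfy the same literal, and so does the result.
  · have key : ∀ (v : ℚ) (a b c : boolDomain), ((a : ℚ) = v ∧ (b : ℚ) = v) ∨
        ((a : ℚ) = v ∧ (c : ℚ) = v) ∨ ((b : ℚ) = v ∧ (c : ℚ) = v) →
        ((if b = c then b else a : boolDomain) : ℚ) = v := by
      intro v a b c h
      split_ifs with hbc
      · subst hbc
        tauto
      · rcases h with h | h | h
        · exact h.1
        · exact h.1
        · exact absurd (Subtype.ext (h.1.trans h.2.symm)) hbc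
    rintro R (rfl | rfl | rfl)
    · intro (t : Fin 3 → Fin 1 → boolDomain) ht
      exact key 1 (t 0 0) (t 1 0) (t 2 0) (Or.inl ⟨ht 0, ht 1⟩)
    · intro (t : Fin 3 → Fin 1 → boolDomain) ht
      exact key 0 (t 0 0) (t 1 0) (t 2 0) (Or.inl ⟨ht 0, ht 1⟩)
    · intro (t : Fin 3 → Fin 2 → boolDomain) ht
      have h0 : ((t 0 0 : boolDomain) : ℚ) = 0 ∨ ((t 0 1 : boolDomain) : ℚ) = 1 := ht 0
      have h1 : ((t 1 0 : boolDomain) : ℚ) = 0 ∨ ((t 1 1 : boolDomain) : ℚ) = 1 := ht 1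
      have h2 : ((t 2 0 : boolDomain) : ℚ) = 0 ∨ ((t 2 1 : boolDomain) : ℚ) = 1 := ht 2
      have k0 := key 0 (t 0 0) (t 1 0) (t 2 0)
      have k1 := key 1 (t 0 1) (t 1 1) (t 2 1)
      change ((if t 1 0 = t 2 0 then t 1 0 else t 0 0 : boolDomain) : ℚ) = 0 ∨
        ((if t 1 1 = t 2 1 then t 1 1 else t 0 1 : boolDomain) : ℚ) = 1
      tauto

theorem exists_represents_inductionEq (n : ℕ) :
    ∃ c : Fin n ⊕ Fin 2 → Constraint inductionLanguage (n + 1),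
      ∀ j, Represents (inductionEq n j) (c j) := by
  have hone : relOne ∈ inductionLanguage := Or.inl rfl
  have hzero : relZero ∈ inductionLanguage := Or.inr (Or.inl rfl)
  have himp : relImp ∈ inductionLanguage := Or.inr (Or.inr rfl)
  refine ⟨Sum.elim (fun i => ⟨relImp, himp, ![i.castSucc, i.succ]⟩)
    ![⟨relOne, hone, ![0]⟩, ⟨relZero, hzero, ![Fin.last n]⟩], ?_⟩
  rintro (i | j)
  · refine ⟨fun v hv => ?_, fun a => ?_⟩
    · change v ∈ (X i.castSucc * (1 - X i.succ) : MvPolynomial (Fin (n + 1)) ℚ).vars at hv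
      change v ∈ Set.range ![i.castSucc, i.succ]
      rcases Finset.mem_union.1 (vars_mul _ _ hv) with h | h
      · rw [vars_X, Finset.mem_singleton] at h
        exact ⟨0, h.symm⟩
      · rcases Finset.mem_union.1 (vars_sub_subset _ h) with h | h
        · simp at h
        · rw [vars_X, Finset.mem_singleton] at h
          exact ⟨1, h.symm⟩
    · change eval _ (X i.castSucc * (1 - X i.succ)) = 0 ↔
        ((a i.castSucc : ℚ) = 0 ∨ (a i.succ : ℚ) = 1)
      rw [map_mul, map_sub, map_one, eval_X, eval_X, mul_eq_zero, sub_eq_zero, eq_comm (a := (1 : ℚ))]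
  · fin_cases j
    · refine ⟨fun v hv => ?_, fun a => ?_⟩
      · change v ∈ (1 - X 0 : MvPolynomial (Fin (n + 1)) ℚ).vars at hv
        change v ∈ Set.range ![(0 : Fin (n + 1))]
        rcases Finset.mem_union.1 (vars_sub_subset _ hv) with h | h
        · simp at h
        · rw [vars_X, Finset.mem_singleton] at h
          exact ⟨0, h.symm⟩
      · change eval _ (1 - X 0) = 0 ↔ (a 0 : ℚ) = 1
        rw [map_sub, map_one, eval_X, sub_eq_zero, eq_comm]
    · refine ⟨fun v hv => ?_, fun a => ?_⟩
      · change v ∈ (X (Fin.last n) : MvPolynomial (Fin (n + 1)) ℚ).vars at hv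
        change v ∈ Set.range ![Fin.last n]
        rw [vars_X, Finset.mem_singleton] at hv
        exact ⟨0, hv.symm⟩
      · change eval _ (X (Fin.last n)) = 0 ↔ (a (Fin.last n) : ℚ) = 0
        rw [eval_X]

theorem inductionEq_mem_boundedIntegral (n : ℕ) (j : Fin n ⊕ Fin 2) :
    inductionEq n j ∈ boundedIntegral (n + 1) 2 1 := by
  have hX : ∀ i : Fin (n + 1), X i ∈ integralPolys (n + 1) := fun i =>
    monomial_one_mem_integralPolys (Finsupp.single i 1)
  have hd : ∀ i : Fin (n + 1), (1 - X i : MvPolynomial (Fin (n + 1)) ℚ).totalDegree ≤ 1 := fun i =>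
    (totalDegree_sub _ _).trans (max_le (by simp) (totalDegree_X i).le)
  have hl : ∀ i : Fin (n + 1), l1 (1 - X i) ≤ 2 := fun i => by
    have := l1_sub_le (1 : MvPolynomial (Fin (n + 1)) ℝ) (X i)
    rw [l1_one, l1_X] at this
    linarith
  rcases j with i | j
  · change X i.castSucc * (1 - X i.succ) ∈ _
    refine ⟨mul_mem (hX _) (sub_mem (one_mem _) (hX _)), ?_, ?_⟩
    · rw [toReal_mul, toReal_sub, toReal_one, toReal_X, toReal_X, pow_one]
      exact (l1_X_mul_le _ _).trans (hl _)
    · refine (totalDegree_mul _ _).trans ?_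
      have := hd i.succ
      rw [totalDegree_X]
      omega
  · fin_cases j
    · change 1 - X 0 ∈ _
      refine ⟨sub_mem (one_mem _) (hX _), ?_, (hd 0).trans (by norm_num)⟩
      rw [toReal_sub, toReal_one, toReal_X, pow_one]
      exact hl 0
    · change X (Fin.last n) ∈ _
      refine ⟨hX _, ?_, by rw [totalDegree_X]; norm_num⟩
      rw [toReal_X, l1_X]
      norm_num

/-- The input size can be dropped from the bounds when it is polynomial in `(n + 1) ^ d`: the
exponent `q` is absorbed into the constant. -/
theorem PCCriterionApplies.of_pow {n : ℕ} {ι : Type} {P : ι → MvPolynomial (Fin n) ℚ}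
    {A β d q : ℕ} (h : PCCriterionApplies P A β d) (hq : 1 ≤ q)
    (hβ : (n + 1) ^ d * (β + 1) ≤ ((n + 1) ^ d) ^ q) : PCCriterionApplies P (q * A) 0 d := by
  obtain ⟨G, hG, hGd⟩ := h
  have hA : A ≤ q * A := Nat.le_mul_of_pos_left _ hq
  have hle : A * ((n + 1) ^ d * (β + 1)) ^ A ≤ q * A * ((n + 1) ^ d * (0 + 1)) ^ (q * A) := by
    rw [zero_add, mul_one, pow_mul]
    exact Nat.mul_le_mul hA (Nat.pow_le_pow_left hβ _)
  refine ⟨G, hG, fun g hg hgd => ?_⟩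
  obtain ⟨h1, h2⟩ := hGd g hg hgd
  exact ⟨h1.trans (pow_le_pow_right₀ (by norm_num) hle), h2.mono (Nat.mul_le_mul_right _ hA) hle⟩

theorem HasApproxSoSProofs.of_pow {n : ℕ} {ι : Type} [Fintype ι] {P : ι → MvPolynomial (Fin n) ℚ}
    {A β d q : ℕ} (h : HasApproxSoSProofs P A β d) (hq : 1 ≤ q)
    (hβ : (n + 1) ^ d * (β + 1) ≤ ((n + 1) ^ d) ^ q) : HasApproxSoSProofs P (q * A) 0 d := by
  intro r hr ε hε
  obtain ⟨π, h1, h2⟩ := h r hr ε hε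
  have hA : A ≤ q * A := Nat.le_mul_of_pos_left _ hq
  refine ⟨π, h1.mono (Nat.mul_le_mul_right _ hA), h2.mono ?_⟩
  refine Real.rpow_le_rpow_of_exponent_le (by norm_num) ?_
  have hy : 0 ≤ Real.logb 2 (1 + coeffNorm r) :=
    Real.logb_nonneg (by norm_num) (by linarith [(coeffNorm r).2])
  set x := 1 + |Real.logb 2 ε| with hx
  set y := 1 + Real.logb 2 (1 + coeffNorm r) with hy'
  have hx1 : 1 ≤ x := by linarith [abs_nonneg (Real.logb 2 ε)]
  have hy1 : 1 ≤ y := by linarith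
  have hβ' : ((n : ℝ) + 1) ^ d * (β + 1) ≤ (((n : ℝ) + 1) ^ d) ^ q := by exact_mod_cast hβ
  have hAr : (A : ℝ) ≤ ((q * A : ℕ) : ℝ) := by exact_mod_cast hA
  refine mul_le_mul hAr ?_ (by positivity) (by positivity)
  rw [Nat.cast_zero, zero_add, mul_one, pow_mul]
  refine pow_le_pow_left₀ (by positivity) ?_ _
  rw [mul_pow, mul_pow]
  have hxq : x ≤ x ^ q := le_self_pow₀ hx1 (by omega)
  have hyq : y ≤ y ^ q := le_self_pow₀ hy1 (by omega)
  gcongr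

theorem exists_criterion_inductionSystem : ∃ A : ℕ, ∀ n d : ℕ, 1 ≤ d →
    PCCriterionApplies (inductionSystem n) A 0 d ∧ HasApproxSoSProofs (inductionSystem n) A 0 d := by
  obtain ⟨A, hA⟩ := exists_criterion_constant (D := boolDomain) ⟨0, by simp [boolDomain]⟩
    (Γ := inductionLanguage) (by simp [inductionLanguage])
    (Or.inl semilatticeClosed_inductionLanguage) 2
  refine ⟨7 * A, fun n d hd => ?_⟩
  obtain ⟨c, hc⟩ := exists_represents_inductionEq n
  obtain ⟨h1, h2⟩ := hA (n + 1) (Fin n ⊕ Fin 2) c (inductionEq n) _ hc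
    (fun j => (inductionEq_mem_boundedIntegral n j).2.2)
    (fun j => bitSize_le (inductionEq_mem_boundedIntegral n j)) d hd
  have hT : n + 2 ≤ (n + 1 + 1) ^ d := Nat.le_self_pow (by omega) _
  set T := (n + 1 + 1) ^ d with hTdef
  -- The bit size of an axiom is at most cubic in `n + 2`, and its constant factor `8 ≤ (n + 2) ^ 3`
  -- raises the exponent to six. Together with the factor `T` this explains the `7`.
  have hβ : T * (1 + (n + 1 + 1) ^ 2 * (1 + 3 + (n + 1) * (1 + 2)) + 1) ≤ T ^ 7 := by
    have h3 : 1 + (n + 1 + 1) ^ 2 * (1 + 3 + (n + 1) * (1 + 2)) + 1 ≤ (n + 2) ^ 6 := by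
      have h4 : 1 + (n + 1 + 1) ^ 2 * (1 + 3 + (n + 1) * (1 + 2)) + 1 ≤ 8 * (n + 2) ^ 3 := by
        nlinarith [Nat.zero_le n, Nat.zero_le (n ^ 2), Nat.zero_le (n ^ 3)]
      have h5 : 2 ^ 3 ≤ (n + 2) ^ 3 := Nat.pow_le_pow_left (by omega) 3
      calc _ ≤ 8 * (n + 2) ^ 3 := h4
        _ ≤ (n + 2) ^ 3 * (n + 2) ^ 3 := Nat.mul_le_mul_right _ h5
        _ = (n + 2) ^ 6 := by ring
    calc _ ≤ T * T ^ 6 := Nat.mul_le_mul_left _ (h3.trans (Nat.pow_le_pow_left hT 6))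
      _ = T ^ 7 := by ring
  exact ⟨h1.of_pow (by norm_num) hβ, h2.of_pow (by norm_num) hβ⟩

end Induction

end PCSoS

end

/-! ### The main theorem -/

open PCSoS in
theorem mainTheorem5 :
    (∀ (D : Finset ℚ), D.Nonempty → ∀ Γ : Set (DomRelation D), Γ.Finite →
      (SemilatticeClosed Γ ∨ DualDiscriminatorClosed Γ) → ∀ Δ : ℕ, ∃ A : ℕ,
        ∀ (n : ℕ) (ι : Type) [Fintype ι] (c : ι → Constraint Γ n)
          (f : ι → MvPolynomial (Fin n) ℚ) (β : ℕ),
          (∀ j, Represents (f j) (c j)) → (∀ j, (f j).totalDegree ≤ Δ) →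
          (∀ j, bitSize (f j) ≤ β) → ∀ d : ℕ, 1 ≤ d →
            PCCriterionApplies (domainSystem D f) A β d ∧
              HasApproxSoSProofs (domainSystem D f) A β d) ∧
    (∃ Γ : Set (DomRelation boolDomain), Γ.Finite ∧ SemilatticeClosed Γ ∧
      DualDiscriminatorClosed Γ ∧
      (∀ n : ℕ, ∃ c : Fin n ⊕ Fin 2 → Constraint Γ (n + 1),
        ∀ j, Represents (inductionEq n j) (c j)) ∧
      (∃ A : ℕ, ∀ n d : ℕ, 1 ≤ d → PCCriterionApplies (inductionSystem n) A 0 d ∧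
        HasApproxSoSProofs (inductionSystem n) A 0 d) ∧
      ∃ δ : ℝ, 0 < δ ∧ ∀ n K d : ℕ, (K : ℝ) * d < δ * Real.log (n + 1) →
        ¬ NsatzComplete (inductionSystem n) K d) :=
  ⟨fun _ hD _ hΓf hΓ Δ => exists_criterion_constant hD hΓf hΓ Δ,
    inductionLanguage, by simp [inductionLanguage], semilatticeClosed_inductionLanguage,
    dualDiscriminatorClosed_inductionLanguage, exists_represents_inductionEq,
    exists_criterion_inductionSystem, 1, one_pos, fun _ _ _ h => not_nsatzComplete_inductionSystem h⟩
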